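/- Let $1\le d\le n$ and let $G_{d,n}$ be the set of $d$-dimensional linear subspaces $S$ of $\mathbb R^n$, with the distance $\|\Pi_S-\Pi_T\|$ (operator norm), where $\Pi_S$ is the orthogonal projector onto $S$; $\mathbb R^n\times G_{d,n}$ carries the maximum of the two distances. A $d$-varifold is a nonnegative Radon measure $V$ on $\mathbb R^n\times G_{d,n}$; its mass is $\|V\|(A)=V(A\times G_{d,n})$. The varifold of a $d$-submanifold $M\subset\mathbb R^n$ is $V(B)=\mathcal H^d(\{x\in M:(x,T_xM)\in B\})$. **Kernels.** Let $\rho,\xi\in C^\infty(\mathbb R)$ be nonnegative, even, supported in $[-1,1]$, positive on $(0,1)$, with $\rho$ nonincreasing on $[0,1]$ and $n\,\xi(s)=-s\rho'(s)$ for all $s\in(-1,1)$. **Approximate mean curvature.** For a finite $d$-varifold $V$, $\varepsilon>0$, $x_0\in\mathbb R^n$ and a linear operator $\Pi=\Pi(S)$ on $\mathbb R^n$ depending on $S\in G_{d,n}$, $$H_\varepsilon^{\Pi}(x_0,V)=-\frac{d}{n\varepsilon}\,\frac{\displaystyle\int \rho'\Big(\frac{|y-x_0|}{\varepsilon}\Big)\frac{\Pi(S)(y-x_0)}{|y-x_0|}\,dV(y,S)}{\displaystyle\int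 \xi\Big(\frac{|y-x_0|}{\varepsilon}\Big)\,d\|V\|(y)} .$$ **Distances.** For finite Radon measures $\mu,\nu$ on $\mathbb R^n$, $\eta_d(\mu,\nu)$ is the infimum of the $\delta>0$ such that $\mu(B)\le\nu(B^\delta)+\delta^d$ and $\nu(B)\le\mu(B^\delta)+\delta^d$ for all closed balls $B$, where $B^\delta$ is the open $\delta$-neighbourhood of $B$. For finite $d$-varifolds $V,W$ and an open ball $B\subset\mathbb R^n$, $\Delta_B(V,W)$ is the supremum of $\int\varphi\,dV-\int\varphi\,dW$ over all $1$-Lipschitz $\varphi:\mathbb R^n\times G_{d,n}\to[-1,1]$ with support in $B\times G_{d,n}$, and $$\delta(V,W)=\sup\left\{\frac{\Delta_B(V,W)}{\big(\eta_d(\|V\|,\|W\|)+\tfrac12\operatorname{diam}B\big)^d}\ :\ B \text{ an open ball centered at a point of } \operatorname{supp}\|V\|\right\}.$$ **Statement.** Let $V$ be the $d$-varifold of a compact $d$-submanifold $M\subset\mathbb R^n$ without boundary of class $C^3$, with mean curvature vector $H$ (the trace of the second fundamental form). Let $(V_i)_i$ be a sequence of $d$-varifolds converging weak-star to $V$, that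 is, against continuous compactly supported functions, and assume that there is a compact set $K\subset\mathbb R^n$ with $\operatorname{supp}V_i\subset K\times G_{d,n}$ for all $i$. Put $d_i=\delta(V,V_i)$. Let $x\in M$, let $N=(T_xM)^\perp$, and let $\Pi$ be any one of the six operators $$\Pi_S,\quad -2\Pi_{S^\perp},\quad 2\,\mathrm{Id},\quad \Pi_N\circ\Pi_S,\quad -2\,\Pi_N\circ\Pi_{S^\perp},\quad 2\,\Pi_N .$$ Then $d_i<\infty$ for all $i$, and for all sequences $(z_i)_i\subset\mathbb R^n$ with $z_i\to x$ and $(\varepsilon_i)_i\subset(0,1)$ with $\varepsilon_i\to0$ and $|x-z_i|+\eta_d(\|V\|,\|V_i\|)=o(\varepsilon_i)$, $$\big|H_{\varepsilon_i}^{\Pi}(z_i,V_i)-H(x)\big| = O\!\left(\frac{d_i+|x-z_i|}{\varepsilon_i^2}\right)+O(\varepsilon_i)\qquad (i\to\infty).$$ If moreover $\sqrt{d_i+|x-z_i|}=o(\varepsilon_i)$, then $H_{\varepsilon_i}^{\Pi}(z_i,V_i)\to H(x)$ as $i\to\infty$. -/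

import Mathlib

open MeasureTheory Filter Set Topology Asymptotics
open scoped ENNReal NNReal ContDiff

namespace Varifold

/-- The Euclidean space of dimension `n`. -/
abbrev Euc (n : ℕ) : Type := EuclideanSpace ℝ (Fin n)

/-- The Grassmannian of `d`-dimensional linear subspaces of `ℝⁿ`. -/
def Gr (d n : ℕ) : Type := {S : Submodule ℝ (Euc n) // Module.finrank ℝ S = d}

/-- The orthogonal projector `Π_S` onto a `d`-plane `S`. -/
noncomputable def Gr.proj {d n : ℕ} (S : Gr d n) : Euc n →L[ℝ] Euc n :=
  S.1.starProjection

/-- The orthogonal projector `Π_{S^⊥}` onto the orthogonal complement of a `d`-plane `S`. -/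
noncomputable def Gr.projOrth {d n : ℕ} (S : Gr d n) : Euc n →L[ℝ] Euc n :=
  (S.1)ᗮ.starProjection

theorem Gr.proj_injective {d n : ℕ} :
    Function.Injective (Gr.proj : Gr d n → (Euc n →L[ℝ] Euc n)) := by
  intro S T h
  exact Subtype.ext (Submodule.starProjection_inj.mp h)

/-- The distance on the Grassmannian is the operator norm of the difference of the projectors. -/
noncomputable instance Gr.instMetricSpace (d n : ℕ) : MetricSpace (Gr d n) :=
  MetricSpace.induced Gr.proj Gr.proj_injective inferInstance

noncomputable instance Gr.instMeasurableSpace (d n : ℕ) : MeasurableSpace (Gr d n) := borel _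

instance Gr.instBorelSpace (d n : ℕ) : BorelSpace (Gr d n) := ⟨rfl⟩

/-! A `d`-varifold in `ℝⁿ` is a Radon measure on `ℝⁿ × Gr d n`, that is, a locally finite measure on
the Borel sets of this locally compact separable metric space. The product carries the maximum of
the two distances. -/

/-- The mass `‖V‖` of a varifold: `‖V‖(A) = V (A × Gr d n)`. -/
noncomputable def mass {d n : ℕ} (V : Measure (Euc n × Gr d n)) : Measure (Euc n) :=
  V.map Prod.fst

/-- `M` is a `d`-dimensional submanifold (without boundary) of class `C^k` of `ℝⁿ`: near each of its
points, a `C^k` diffeomorphism between open sets of `ℝⁿ` straightens `M` to a `d`-dimensional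
linear subspace. -/
def IsSubmanifold {n : ℕ} (k : ℕ∞) (d : ℕ) (M : Set (Euc n)) : Prop :=
  ∀ x ∈ M, ∃ (Φ : OpenPartialHomeomorph (Euc n) (Euc n)) (L : Submodule ℝ (Euc n)),
    x ∈ Φ.source ∧ ContDiffOn ℝ k Φ Φ.source ∧ ContDiffOn ℝ k Φ.symm Φ.target ∧
    Module.finrank ℝ L = d ∧ ∀ y ∈ Φ.source, (y ∈ M ↔ Φ y ∈ L)

/-- The tangent space `T_x M`, as a linear subspace of `ℝⁿ`: the span of the tangent directions to
`M` at `x`. -/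
noncomputable def tangentSpace {n : ℕ} (M : Set (Euc n)) (x : Euc n) : Submodule ℝ (Euc n) :=
  Submodule.span ℝ (tangentConeAt ℝ M x)

/-- The points of `M` together with the fact that the tangent space is `d`-dimensional; when `M` is
a `d`-dimensional `C^1` submanifold these are all the points of `M`. -/
abbrev TangentPoint {n : ℕ} (d : ℕ) (M : Set (Euc n)) : Type :=
  {x : Euc n // x ∈ M ∧ Module.finrank ℝ (tangentSpace M x) = d}

/-- The map `x ↦ (x, T_x M)`. -/
noncomputable def gaussGraph {n : ℕ} (d : ℕ) (M : Set (Euc n)) (x : TangentPoint d M) :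
    Euc n × Gr d n :=
  (x.1, ⟨tangentSpace M x.1, x.2.2⟩)

/-- The smooth varifold associated with a `d`-submanifold `M`,
`V (B) = ℋᵈ {x ∈ M | (x, T_x M) ∈ B}`: the image under `x ↦ (x, T_x M)` of the `d`-dimensional
Hausdorff measure of `M` (normalised to agree with Lebesgue measure on `ℝᵈ`). -/
noncomputable def smoothVarifold {n : ℕ} (d : ℕ) (M : Set (Euc n)) : Measure (Euc n × Gr d n) :=
  Measure.map (gaussGraph d M)
    (Measure.comap (Subtype.val : TangentPoint d M → Euc n) (Measure.euclideanHausdorffMeasure d))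

/-- Near `x`, the set `M` is the graph, over the affine space `x + T`, of the function `u` with values
in the orthogonal complement of `T`. -/
def IsLocalGraph {n : ℕ} (M : Set (Euc n)) (x : Euc n) (T : Submodule ℝ (Euc n)) (u : T → Euc n) :
    Prop :=
  (∀ y, u y ∈ Tᗮ) ∧
    ∀ᶠ p in 𝓝 x, (p ∈ M ↔ Tᗮ.starProjection (p - x) = u (T.orthogonalProjectionOnto (p - x)))

/-- `h` is the mean curvature vector of `M` at `x`, that is, the trace of the second fundamental form:
near `x`, the set `M` is the graph over its tangent space at `x` of a `C^2` function `u` with values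
in the normal space, and `h` is the trace of the Hessian of `u` at `0`. -/
def IsMeanCurvatureAt {n : ℕ} (M : Set (Euc n)) (x h : Euc n) : Prop :=
  ∃ u : tangentSpace M x → Euc n,
    ContDiffAt ℝ 2 u 0 ∧ IsLocalGraph M x (tangentSpace M x) u ∧ h = Laplacian.laplacian u 0

open Classical in
/-- The mean curvature vector `H(x)` of `M` at `x`; the vector in the definition is unique when
`x ∈ M`, and exists when `M` is a `C^2` submanifold. -/
noncomputable def meanCurvature {n : ℕ} (M : Set (Euc n)) (x : Euc n) : Euc n :=
  if h : ∃ v, IsMeanCurvatureAt M x v then h.choose else 0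

/-- The assumptions on the pair of kernel profiles `ρ`, `ξ` in dimension `n`. -/
structure IsKernelPair (n : ℕ) (ρ ξ : ℝ → ℝ) : Prop where
  smooth_rho : ContDiff ℝ ∞ ρ
  smooth_xi : ContDiff ℝ ∞ ξ
  nonneg_rho : ∀ s, 0 ≤ ρ s
  nonneg_xi : ∀ s, 0 ≤ ξ s
  even_rho : ∀ s, ρ (-s) = ρ s
  even_xi : ∀ s, ξ (-s) = ξ s
  support_rho : tsupport ρ ⊆ Icc (-1) 1
  support_xi : tsupport ξ ⊆ Icc (-1) 1
  pos_rho : ∀ s ∈ Ioo (0 : ℝ) 1, 0 < ρ s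
  pos_xi : ∀ s ∈ Ioo (0 : ℝ) 1, 0 < ξ s
  antitone_rho : AntitoneOn ρ (Icc 0 1)
  relation : ∀ s ∈ Ioo (-1 : ℝ) 1, (n : ℝ) * ξ s = -s * deriv ρ s

/-- The approximate mean curvature `H_ε^Π (x₀, V)`; the linear operator `Π` may depend on the
plane `S` (and on the base point, when it is instantiated). -/
noncomputable def approxMeanCurvature {d n : ℕ} (ρ ξ : ℝ → ℝ)
    (P : Gr d n → (Euc n →L[ℝ] Euc n)) (ε : ℝ) (x₀ : Euc n) (V : Measure (Euc n × Gr d n)) :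
    Euc n :=
  (-((d : ℝ) / (n * ε)) * (∫ x, ξ (‖x - x₀‖ / ε) ∂(mass V))⁻¹) •
    ∫ p, (deriv ρ (‖p.1 - x₀‖ / ε) * ‖p.1 - x₀‖⁻¹) • P p.2 (p.1 - x₀) ∂V

/-- The six admissible operators `Π_S`, `-2 Π_{S^⊥}`, `2 Id`, and their post-compositions with the
orthogonal projection onto the normal space `N = (T_x M)^⊥` at the point `x` of `M`. -/
noncomputable def admissibleOperators {n : ℕ} (d : ℕ) (M : Set (Euc n)) (x : Euc n) :
    Set (Gr d n → (Euc n →L[ℝ] Euc n)) :=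
  let N : Euc n →L[ℝ] Euc n := (tangentSpace M x)ᗮ.starProjection
  {fun S => S.proj,
   fun S => (-2 : ℝ) • S.projOrth,
   fun _ => (2 : ℝ) • ContinuousLinearMap.id ℝ (Euc n),
   fun S => N ∘L S.proj,
   fun S => (-2 : ℝ) • (N ∘L S.projOrth),
   fun _ => (2 : ℝ) • N}

/-- Weak star convergence of measures: convergence against continuous compactly supported
functions. -/
def WeakStarConverges {X : Type*} [TopologicalSpace X] [MeasurableSpace X]
    (W : ℕ → Measure X) (V : Measure X) : Prop :=
  ∀ φ : X → ℝ, Continuous φ → HasCompactSupport φ →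
    Tendsto (fun i => ∫ p, φ p ∂(W i)) atTop (𝓝 (∫ p, φ p ∂V))

/-- The localized bounded Lipschitz (flat) distance `Δ_U (μ, ν)`. -/
noncomputable def flatDist {X : Type*} [PseudoMetricSpace X] [MeasurableSpace X]
    (U : Set X) (μ ν : Measure X) : ℝ≥0∞ :=
  ⨆ (φ : X → ℝ) (_ : LipschitzWith 1 φ ∧ (∀ p, |φ p| ≤ 1) ∧ tsupport φ ⊆ U),
    ENNReal.ofReal (∫ p, φ p ∂μ - ∫ p, φ p ∂ν)

/-- The modified Prokhorov distance `η_d (μ, ν)` between finite Radon measures of `ℝⁿ`. -/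
noncomputable def prokhorovDist {n : ℕ} (d : ℕ) (μ ν : Measure (Euc n)) : ℝ :=
  sInf {δ : ℝ | 0 < δ ∧ ∀ (c : Euc n) (r : ℝ), 0 < r →
    μ (Metric.closedBall c r) ≤
        ν (Metric.thickening δ (Metric.closedBall c r)) + ENNReal.ofReal (δ ^ d) ∧
    ν (Metric.closedBall c r) ≤
        μ (Metric.thickening δ (Metric.closedBall c r)) + ENNReal.ofReal (δ ^ d)}

/-- The quantity `δ (V, W)`: the supremum over the balls `B` centered in the support of `‖V‖` of
`Δ_B (V, W) / (η_d (‖V‖, ‖W‖) + diam B / 2) ^ d`, where `Δ_B` is localized in `B × Gr d n`. -/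
noncomputable def varifoldDelta {d n : ℕ} (V W : Measure (Euc n × Gr d n)) : ℝ≥0∞ :=
  ⨆ (x : Euc n) (_ : x ∈ (mass V).support) (r : ℝ) (_ : 0 < r),
    flatDist (Metric.ball x r ×ˢ univ) V W /
      ENNReal.ofReal ((prokhorovDist d (mass V) (mass W) + r) ^ d)

end Varifold

open Varifold

/-!
Near a point `x` of `M`, the submanifold is the graph over `x + T`, with `T = T_x M`, of a normal
`C^3` function `u` with `u 0 = 0` and `Du 0 = 0` (`exists_isTaylorGraph`, by the inverse function
theorem). Over a ball of radius `ε` the `d`-dimensional Hausdorff measure of the graph is between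
Lebesgue measure on `T` and `1 + O(ε²)` times it: the projection to `T` is `1`-Lipschitz and the
graph map is `1 + O(ε²)`-Lipschitz (`IsTaylorGraph.projMeasure_le`), so that no area formula is
needed.

With `B = D²u 0`, each of the six operators satisfies `Π(T_y M) (y - x) = a v + B (v, v) + O(|v|³)`
at `y = x + v + u v`, with a constant `a` (`IsAdmissible.norm_apply_sub_le`): the planes themselves
are the graphs of `Du v`, and `Du v v` is twice `u v` to second order. Integrated against a radial
weight on `T`, the linear term vanishes and `B (v, v)` contributes its trace, which is `H(x)`, times
a second moment that the relation `n ξ(s) = - s ρ'(s)` identifies with the integral of `ξ`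
(`integral_quotient_smul`). Hence the numerator of the approximate mean curvature of `M` at `x` is
`- (n ε / d) H(x)` times its denominator up to a relative error `O(ε²)`
(`IsTaylorGraph.exists_consistency`), which after division by `ε` gives the term `O(ε)`.

Both integrands are `O(1 / ε)`-Lipschitz and supported in a ball of radius `ε`, so replacing
`(V, x)` by `(V_i, z_i)` changes the integrals by `O((d_i + |x - z_i|) / ε)` relative to `ε ^ d`
(`norm_integral_sub_integral_le_delta`). The denominator for `V_i` stays bounded below by a multiple
of `ε ^ d`, because `V_i` must charge a small ball at distance about `ε / 2` from `x`
(`IsTaylorGraph.exists_lower_bound`). Finally `d_i` is finite, and even bounded, because `‖V‖` is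
upper Ahlfors regular and the Prokhorov distance transfers this to `‖V_i‖`
(`varifoldDelta_lt_top`).
-/

/-! ### Local graphs and their tangent spaces -/

namespace Varifold

/-- A `C^3` submanifold is locally the graph of a `C^3` function `u` over its tangent space, with
`u` and its derivative vanishing at the origin. With `ψ` the restriction to `L` of the inverse of a
straightening chart, `T` is the range of the derivative of `ψ`, the inverse function theorem inverts
the projection of `ψ` to `T`, and `u` is the normal part of `ψ` in the resulting coordinates. -/
theorem exists_graph {n d : ℕ} {M : Set (Euc n)} (hM : IsSubmanifold 3 d M) {x : Euc n}
    (hx : x ∈ M) : ∃ (T : Submodule ℝ (Euc n)) (u : T → Euc n), Module.finrank ℝ T = d ∧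
      ContDiffAt ℝ 3 u 0 ∧ IsLocalGraph M x T u ∧ u 0 = 0 ∧ fderiv ℝ u 0 = 0 := by
  obtain ⟨Φ, L, hxs, hΦ, hΨ, hL, hML⟩ := hM x hx
  set w₀ := Φ x with hw₀
  have hw₀t : w₀ ∈ Φ.target := Φ.map_source hxs
  have hw₀L : w₀ ∈ L := (hML x hxs).1 hx
  have hΦx : ContDiffAt ℝ 3 Φ x := hΦ.contDiffAt (Φ.open_source.mem_nhds hxs)
  have hΨx : ContDiffAt ℝ 3 Φ.symm w₀ := hΨ.contDiffAt (Φ.open_target.mem_nhds hw₀t)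
  have hΨw : Φ.symm w₀ = x := Φ.left_inv hxs
  set A := fderiv ℝ Φ.symm w₀ with hA
  have hAd : HasFDerivAt Φ.symm A w₀ := (hΨx.differentiableAt (by simp)).hasFDerivAt
  -- `A` has the derivative of `Φ` as a left inverse.
  have hAinj : Function.Injective A := by
    have h1 : HasFDerivAt (Φ ∘ Φ.symm) ((fderiv ℝ Φ x).comp A) w₀ := by
      refine HasFDerivAt.comp w₀ ?_ hAd
      rw [hΨw]
      exact (hΦx.differentiableAt (by simp)).hasFDerivAt
    have h2 : HasFDerivAt (Φ ∘ Φ.symm) (ContinuousLinearMap.id ℝ (Euc n)) w₀ := by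
      refine (hasFDerivAt_id w₀).congr_of_eventuallyEq ?_
      filter_upwards [Φ.open_target.mem_nhds hw₀t] with w hw
      exact Φ.right_inv hw
    have h3 := h1.unique h2
    intro a b hab
    have := congrArg (fun B : Euc n →L[ℝ] Euc n => B a) h3
    have h' := congrArg (fun B : Euc n →L[ℝ] Euc n => B b) h3
    simp only [ContinuousLinearMap.comp_apply, ContinuousLinearMap.id_apply] at this h'
    rw [← this, ← h', hab]
  set T := L.map (A : Euc n →ₗ[ℝ] Euc n) with hT
  let e : L ≃ₗ[ℝ] T := Submodule.equivMapOfInjective (A : Euc n →ₗ[ℝ] Euc n) hAinj L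
  have hTd : Module.finrank ℝ T = d := by rw [← e.finrank_eq, hL]
  set ψ : L → Euc n := fun l => Φ.symm (w₀ + l) - x with hψ
  have hlin : ContDiffAt ℝ 3 (fun l : L => w₀ + (l : Euc n)) 0 :=
    contDiffAt_const.add L.subtypeL.contDiff.contDiffAt
  have hlind : HasFDerivAt (fun l : L => w₀ + (l : Euc n)) L.subtypeL 0 :=
    L.subtypeL.hasFDerivAt.const_add w₀
  have hψc : ContDiffAt ℝ 3 ψ 0 := by
    refine ContDiffAt.sub (ContDiffAt.comp (0 : L) ?_ hlin) contDiffAt_const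
    simpa using hΨx
  have hψd : HasFDerivAt ψ (A.comp L.subtypeL) 0 := by
    refine HasFDerivAt.sub_const x (HasFDerivAt.comp (0 : L) ?_ hlind)
    simpa using hAd
  set g : L → T := fun l => T.orthogonalProjectionOnto (ψ l) with hg
  have hgc : ContDiffAt ℝ 3 g 0 := T.orthogonalProjectionOnto.contDiff.contDiffAt.comp (0 : L) hψc
  have hAT : ∀ l : L, A l ∈ T := fun l => Submodule.mem_map_of_mem l.2
  have hgd : HasFDerivAt g (e.toContinuousLinearEquiv : L →L[ℝ] T) 0 := by
    have h1 : HasFDerivAt g (T.orthogonalProjectionOnto.comp (A.comp L.subtypeL)) 0 :=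
      T.orthogonalProjectionOnto.hasFDerivAt.comp (0 : L) hψd
    convert h1 using 1
    ext1 l
    have : (T.orthogonalProjectionOnto (A l)) = ⟨A l, hAT l⟩ :=
      Submodule.orthogonalProjectionOnto_mem_subspace_eq_self (⟨A l, hAT l⟩ : T)
    simp only [ContinuousLinearMap.comp_apply, Submodule.subtypeL_apply, this]
    rfl
  have hψ0 : ψ 0 = 0 := by simp [hψ, hΨw]
  have hg0 : g 0 = 0 := by simp [hg, hψ0]
  have hgs := hgc.hasStrictFDerivAt' hgd (by simp)
  set h : T → L := hgs.localInverse g e.toContinuousLinearEquiv 0 with hh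
  have hhc : ContDiffAt ℝ 3 h 0 := by
    have := hgc.to_localInverse hgd (by simp)
    rwa [hg0] at this
  have hh0 : h 0 = 0 := by
    have := hgs.localInverse_apply_image
    rwa [hg0] at this
  have hli : ∀ᶠ l in 𝓝 (0 : L), h (g l) = l := hgs.eventually_left_inverse
  have hri : ∀ᶠ v in 𝓝 (0 : T), g (h v) = v := by
    have := hgs.eventually_right_inverse
    rwa [hg0] at this
  set u : T → Euc n := fun v => Tᗮ.starProjection (ψ (h v)) with hu
  refine ⟨T, u, hTd, ?_, ⟨fun y => Submodule.starProjection_apply_mem _ _, ?_⟩, ?_, ?_⟩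
  · have h1 : ContDiffAt ℝ 3 ψ (h 0) := by rwa [hh0]
    have h2 : ContDiffAt ℝ 3 (fun v => ψ (h v)) 0 := h1.comp (0 : T) hhc
    exact ContDiffAt.continuousLinearMap_comp Tᗮ.starProjection h2
  · have hc1 : Tendsto (fun p => T.orthogonalProjectionOnto (p - x)) (𝓝 x) (𝓝 (0 : T)) := by
      have : Continuous (fun p => T.orthogonalProjectionOnto (p - x)) := by fun_prop
      simpa using this.tendsto x
    have hc2 : Tendsto (fun p => Φ p - w₀) (𝓝 x) (𝓝 0) := by
      have := (Φ.continuousAt hxs).sub_const w₀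
      simpa [ContinuousAt, hw₀] using this
    have hli' : ∀ᶠ w in 𝓝 (0 : Euc n), ∀ l : L, (l : Euc n) = w → h (g l) = l := by
      rw [nhds_subtype_eq_comap, eventually_comap] at hli
      simpa using hli
    have htar : ∀ᶠ v in 𝓝 (0 : T), w₀ + (h v : Euc n) ∈ Φ.target := by
      have : ContinuousAt (fun v : T => w₀ + (h v : Euc n)) 0 :=
        continuousAt_const.add (continuous_subtype_val.continuousAt.comp hhc.continuousAt)
      refine this (Φ.open_target.mem_nhds ?_)
      simpa [hh0] using hw₀t
    filter_upwards [Φ.open_source.mem_nhds hxs, hc2.eventually hli', hc1.eventually hri,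
      hc1.eventually htar] with p hps hpl hpr hpt
    constructor
    · intro hpM
      have hpL : Φ p - w₀ ∈ L := L.sub_mem ((hML p hps).1 hpM) hw₀L
      have h1 := hpl ⟨_, hpL⟩ rfl
      have h2 : ψ ⟨_, hpL⟩ = p - x := by simp [hψ, Φ.left_inv hps]
      have h3 : g ⟨_, hpL⟩ = T.orthogonalProjectionOnto (p - x) := by rw [hg]; simp only [h2]
      rw [hu]
      simp only
      rw [← h3, h1, h2]
    · intro hp
      set v := T.orthogonalProjectionOnto (p - x) with hv
      have h1 : T.starProjection (ψ (h v)) = T.starProjection (p - x) := by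
        rw [Submodule.starProjection_apply, Submodule.starProjection_apply]
        exact congrArg _ hpr
      have h2 : ψ (h v) = p - x := by
        have h2 := T.starProjection_add_starProjection_orthogonal (ψ (h v))
        have h3 := T.starProjection_add_starProjection_orthogonal (p - x)
        rw [h1] at h2
        rw [hp] at h3
        exact h2.symm.trans h3
      have h3 : Φ.symm (w₀ + h v) = p := by
        have := h2
        simp only [hψ] at this
        simpa using this
      rw [hML p hps, ← h3, Φ.right_inv hpt]
      exact L.add_mem hw₀L (h v).2
  · simp [hu, hh0, hψ0]
  · have h1 : HasFDerivAt ψ (A.comp L.subtypeL) (h 0) := by rwa [hh0]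
    have h2 : HasFDerivAt h (fderiv ℝ h 0) 0 := (hhc.differentiableAt (by simp)).hasFDerivAt
    have h3 := Tᗮ.starProjection.hasFDerivAt.comp (0 : T) (h1.comp (0 : T) h2)
    refine HasFDerivAt.fderiv (h3.congr_fderiv ?_)
    ext1 v
    have := hAT (fderiv ℝ h 0 v)
    simp only [ContinuousLinearMap.comp_apply, Submodule.subtypeL_apply,
      zero_apply]
    rw [Submodule.starProjection_apply_eq_zero_iff, Submodule.orthogonal_orthogonal]
    exact this

/-- The point of the graph of `u` over the point `x + v` of `x + T`. -/
noncomputable def graphMap {n : ℕ} {T : Submodule ℝ (Euc n)} (x : Euc n) (u : T → Euc n)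
    (v : T) : Euc n := x + v + u v

/-- The tangent plane at `graphMap x u v` to the graph of `u` when `D` is the derivative of `u`
at `v`: it is the graph of `D`. -/
noncomputable def graphPlane {n : ℕ} {T : Submodule ℝ (Euc n)} (D : T →L[ℝ] Euc n) :
    Submodule ℝ (Euc n) :=
  LinearMap.range (T.subtypeL + D : T →L[ℝ] Euc n).toLinearMap

section Graph

variable {n : ℕ} {M : Set (Euc n)} {x : Euc n} {T : Submodule ℝ (Euc n)} {u : T → Euc n}

theorem proj_graphMap (hu : ∀ v, u v ∈ Tᗮ) (v : T) :
    T.orthogonalProjectionOnto (graphMap x u v - x) = v := by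
  have : graphMap x u v - x = v + u v := by simp [graphMap, add_assoc]
  rw [this, map_add, Submodule.orthogonalProjectionOnto_mem_subspace_eq_self]
  have : T.orthogonalProjectionOnto (u v) = 0 := by
    rw [← Submodule.coe_eq_zero, ← Submodule.starProjection_apply,
      Submodule.starProjection_apply_eq_zero_iff]
    exact hu v
  simp [this]

theorem projOrth_graphMap (hu : ∀ v, u v ∈ Tᗮ) (v : T) :
    Tᗮ.starProjection (graphMap x u v - x) = u v := by
  have : graphMap x u v - x = v + u v := by simp [graphMap, add_assoc]
  have h0 : Tᗮ.starProjection (v : Euc n) = 0 := by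
    rw [Submodule.starProjection_apply_eq_zero_iff, Submodule.orthogonal_orthogonal]
    exact v.2
  rw [this, map_add, h0, Submodule.starProjection_eq_self_iff.2 (hu v), zero_add]

theorem eq_graphMap_of_projOrth {p : Euc n}
    (h : Tᗮ.starProjection (p - x) = u (T.orthogonalProjectionOnto (p - x))) :
    p = graphMap x u (T.orthogonalProjectionOnto (p - x)) := by
  have := T.starProjection_add_starProjection_orthogonal (p - x)
  rw [graphMap, ← h, ← Submodule.starProjection_apply, add_assoc, this]
  simp

theorem graphMap_zero (h0 : u 0 = 0) : graphMap x u 0 = x := by simp [graphMap, h0]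

theorem hasFDerivAt_graphMap {v : T} {D : T →L[ℝ] Euc n} (h : HasFDerivAt u D v) :
    HasFDerivAt (graphMap x u) (T.subtypeL + D) v :=
  (T.subtypeL.hasFDerivAt.const_add x).add h

theorem tendsto_graphMap (hc : ContinuousAt u 0) (h0 : u 0 = 0) :
    Tendsto (graphMap x u) (𝓝 0) (𝓝 x) := by
  have : ContinuousAt (graphMap x u) 0 :=
    (continuousAt_const.add continuous_subtype_val.continuousAt).add hc
  simpa [ContinuousAt, graphMap_zero h0] using this

/-- The tangent space of `M`, defined through tangent cones, is that of the graph: the derivative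
of the graph map sends `T` into the tangent cone, and the tangent cone lies in the kernel of the
derivative of the equation of the graph. -/
theorem tangentSpace_graphMap (hM : IsLocalGraph M x T u) (hc : ContDiffAt ℝ 3 u 0)
    (h0 : u 0 = 0) :
    ∀ᶠ v in 𝓝 (0 : T), tangentSpace M (graphMap x u v) = graphPlane (fderiv ℝ u v) := by
  have hd : ∀ᶠ v in 𝓝 (0 : T), DifferentiableAt ℝ u v :=
    (hc.eventually (by simp)).mono fun v hv => hv.differentiableAt (by simp)
  have hg := hM.2.eventually_nhds
  filter_upwards [hd, (tendsto_graphMap hc.continuousAt h0).eventually hg] with v hv hgv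
  set D := fderiv ℝ u v with hD
  have hDv : HasFDerivAt u D v := hv.hasFDerivAt
  set y := graphMap x u v with hy
  have hG := hasFDerivAt_graphMap (x := x) hDv
  apply le_antisymm
  · refine Submodule.span_le.2 fun w hw => ?_
    obtain ⟨s, hs, hsM⟩ := hgv.exists_mem
    have hw' : w ∈ tangentConeAt ℝ (M ∩ s) y := by rwa [tangentConeAt_inter_nhds hs]
    let F : Euc n → Euc n := fun p =>
      Tᗮ.starProjection (p - x) - u (T.orthogonalProjectionOnto (p - x))
    have hF : HasFDerivAt F (Tᗮ.starProjection - D.comp T.orthogonalProjectionOnto) y := by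
      have hsub : HasFDerivAt (fun p : Euc n => p - x) (ContinuousLinearMap.id ℝ _) y :=
        (hasFDerivAt_id y).sub_const x
      have h1 := (Tᗮ.starProjection).hasFDerivAt.comp y hsub
      have h2 := (T.orthogonalProjectionOnto).hasFDerivAt.comp y hsub
      refine (h1.sub (HasFDerivAt.comp y ?_ h2))
      simp only [hy, proj_graphMap hM.1]
      exact hDv
    have h1 := hF.hasFDerivWithinAt.mapsTo_tangent_cone hw'
    -- `F` vanishes on `M` near `y`, so its derivative maps tangent directions to those of `{0}`.
    have h2 : F '' (M ∩ s) ⊆ {0} := by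
      rintro _ ⟨p, ⟨hpM, hps⟩, rfl⟩
      exact sub_eq_zero.2 ((hsM p hps).1 hpM)
    have h3 : (Tᗮ.starProjection - D.comp T.orthogonalProjectionOnto) w = 0 := by
      have := tangentConeAt_mono h2 h1
      refine tangentConeAt_subset_zero ?_ this
      intro hacc
      rw [accPt_iff_nhds] at hacc
      obtain ⟨y', ⟨-, hy'⟩, hne⟩ := hacc univ univ_mem
      have hFy : F y = 0 := by
        simp only [F, hy, projOrth_graphMap hM.1, proj_graphMap hM.1, sub_self]
      exact hne (by rw [hFy]; exact hy')
    refine ⟨T.orthogonalProjectionOnto w, ?_⟩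
    have h4 : Tᗮ.starProjection w = D (T.orthogonalProjectionOnto w) := by
      simpa [sub_eq_zero] using h3
    have h5 := T.starProjection_add_starProjection_orthogonal w
    rw [h4, Submodule.starProjection_apply] at h5
    simpa using h5
  · rintro _ ⟨w, rfl⟩
    refine Submodule.subset_span ?_
    obtain ⟨s, hs, hsM⟩ := hgv.exists_mem
    have hs' : graphMap x u ⁻¹' s ∈ 𝓝 v := hG.continuousAt hs
    have h2 := (hG.hasFDerivWithinAt (s := graphMap x u ⁻¹' s)).mapsTo_tangent_cone
      (show w ∈ tangentConeAt ℝ _ v by rw [tangentConeAt_of_mem_nhds hs']; trivial)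
    refine tangentConeAt_mono ?_ h2
    rintro _ ⟨v', hv', rfl⟩
    refine (hsM _ hv').2 ?_
    rw [projOrth_graphMap hM.1, proj_graphMap hM.1]

end Graph

end Varifold

/-! ### Taylor bounds and projectors onto tangent planes -/

namespace Varifold

section Taylor

variable {E F : Type*} [NormedAddCommGroup E] [NormedSpace ℝ E] [NormedAddCommGroup F]
  [NormedSpace ℝ F]

theorem norm_sub_le_pow_succ {g : E → F} {g' : E → E →L[ℝ] F} {C r : ℝ} {k : ℕ} (hC : 0 ≤ C)
    (hg : ∀ w, ‖w‖ < r → HasFDerivAt g (g' w) w) (hb : ∀ w, ‖w‖ < r → ‖g' w‖ ≤ C * ‖w‖ ^ k)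
    {v : E} (hv : ‖v‖ < r) : ‖g v - g 0‖ ≤ C * ‖v‖ ^ (k + 1) := by
  have hs : ∀ w ∈ Metric.closedBall (0 : E) ‖v‖, ‖w‖ ≤ ‖v‖ := fun w hw => by simpa using hw
  have := Convex.norm_image_sub_le_of_norm_hasFDerivWithin_le (𝕜 := ℝ) (f := g) (f' := g')
    (s := Metric.closedBall (0 : E) ‖v‖) (C := C * ‖v‖ ^ k)
    (fun w hw => (hg w ((hs w hw).trans_lt hv)).hasFDerivWithinAt)
    (fun w hw => (hb w ((hs w hw).trans_lt hv)).trans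
      (mul_le_mul_of_nonneg_left (pow_le_pow_left₀ (norm_nonneg _) (hs w hw) _) hC))
    (convex_closedBall _ _) (x := 0) (y := v) (by simp) (by simp)
  calc _ ≤ _ := this
    _ = _ := by rw [sub_zero, pow_succ]; ring

theorem exists_norm_sub_fderiv_le {f : E → F} (hf : ContDiffAt ℝ 2 f 0) :
    ∃ C r : ℝ, 0 ≤ C ∧ 0 < r ∧ ∀ v, ‖v‖ < r → DifferentiableAt ℝ f v ∧
      ‖f v - f 0 - fderiv ℝ f 0 v‖ ≤ C * ‖v‖ ^ 2 := by
  have h1 : ContDiffAt ℝ 1 (fderiv ℝ f) 0 := hf.fderiv_right (by norm_num)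
  obtain ⟨K, t, ht, hK⟩ := h1.exists_lipschitzOnWith
  have h2 : ∀ᶠ v in 𝓝 (0 : E), DifferentiableAt ℝ f v :=
    (hf.eventually (by simp)).mono fun v hv => hv.differentiableAt (by simp)
  obtain ⟨r, hr, hball⟩ := Metric.eventually_nhds_iff_ball.1 (h2.and ht)
  have hd : ∀ v, ‖v‖ < r → DifferentiableAt ℝ f v := fun v hv => (hball v (by simpa using hv)).1
  -- The derivative is Lipschitz near `0`, since it is of class `C^1`.
  have hb : ∀ w, ‖w‖ < r → ‖fderiv ℝ f w - fderiv ℝ f 0‖ ≤ K * ‖w‖ ^ 1 := fun w hw => by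
    have := hK.dist_le_mul w (hball w (by simpa using hw)).2 0 (mem_of_mem_nhds ht)
    simpa [dist_eq_norm] using this
  refine ⟨K, r, K.2, hr, fun v hv => ⟨hd v hv, ?_⟩⟩
  have := norm_sub_le_pow_succ (g := fun w => f w - fderiv ℝ f 0 w)
    (g' := fun w => fderiv ℝ f w - fderiv ℝ f 0) K.2
    (fun w hw => (hd w hw).hasFDerivAt.sub (fderiv ℝ f 0).hasFDerivAt) hb hv
  simp only [map_zero, sub_zero] at this
  rwa [sub_right_comm] at this

/-- Second order Taylor bounds, with cubic remainders, at a critical zero of a `C^3` function. -/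
theorem exists_taylor_bounds {u : E → F} (hu : ContDiffAt ℝ 3 u 0) (h0 : u 0 = 0)
    (h1 : fderiv ℝ u 0 = 0) : ∃ C r : ℝ, 0 ≤ C ∧ 0 < r ∧ ∀ v, ‖v‖ < r →
      DifferentiableAt ℝ u v ∧ ‖fderiv ℝ u v‖ ≤ C * ‖v‖ ∧ ‖u v‖ ≤ C * ‖v‖ ^ 2 ∧
      ‖fderiv ℝ u v v - fderiv ℝ (fderiv ℝ u) 0 v v‖ ≤ C * ‖v‖ ^ 3 ∧
      ‖u v - (1 / 2 : ℝ) • fderiv ℝ (fderiv ℝ u) 0 v v‖ ≤ C * ‖v‖ ^ 3 := by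
  set B := fderiv ℝ (fderiv ℝ u) 0 with hB
  have hsymm : ∀ v w, B v w = B w v := fun v w =>
    (hu.isSymmSndFDerivAt (by simpa using (by norm_num : (2 : WithTop ℕ∞) ≤ 3))) v w
  obtain ⟨C₁, r₁, hC₁, hr₁, hf⟩ := exists_norm_sub_fderiv_le
    (f := fderiv ℝ u) (hu.fderiv_right (by norm_num))
  obtain ⟨C₂, r₂, hC₂, hr₂, hd⟩ := exists_norm_sub_fderiv_le (f := u)
    (hu.of_le (by norm_num))
  set C := C₁ + ‖B‖ with hC
  have hC0 : 0 ≤ C := by positivity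
  set r := min (min r₁ r₂) 1 with hr
  have hr' : 0 < r := by positivity
  have k1 : ∀ v, ‖v‖ < r → ‖fderiv ℝ u v - B v‖ ≤ C₁ * ‖v‖ ^ 2 := fun v hv => by
    have := (hf v (hv.trans_le ((min_le_left _ _).trans (min_le_left _ _)))).2
    rwa [h1, sub_zero] at this
  have k2 : ∀ v, ‖v‖ < r → DifferentiableAt ℝ u v := fun v hv =>
    (hd v (hv.trans_le ((min_le_left _ _).trans (min_le_right _ _)))).1
  have k3 : ∀ v, ‖v‖ < r → ‖fderiv ℝ u v‖ ≤ C * ‖v‖ ^ 1 := fun v hv => by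
    have hv1 : ‖v‖ ≤ 1 := (hv.trans_le (min_le_right _ _)).le
    have := norm_add_le (fderiv ℝ u v - B v) (B v)
    rw [sub_add_cancel] at this
    have h2 := k1 v hv
    have h3 := B.le_opNorm v
    have h4 : C₁ * ‖v‖ ^ 2 ≤ C₁ * ‖v‖ := by
      refine mul_le_mul_of_nonneg_left ?_ hC₁
      nlinarith [norm_nonneg v]
    rw [hC]
    linarith
  refine ⟨C, r, hC0, hr', fun v hv => ⟨k2 v hv, by simpa using k3 v hv, ?_, ?_, ?_⟩⟩
  · have := norm_sub_le_pow_succ hC0 (fun w hw => (k2 w hw).hasFDerivAt) k3 hv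
    simpa [h0] using this
  · have h2 := (fderiv ℝ u v - B v).le_opNorm v
    rw [sub_apply] at h2
    calc _ ≤ _ := h2
      _ ≤ C₁ * ‖v‖ ^ 2 * ‖v‖ := by gcongr; exact k1 v hv
      _ = C₁ * ‖v‖ ^ 3 := by ring
      _ ≤ C * ‖v‖ ^ 3 := by gcongr; rw [hC]; linarith [norm_nonneg B]
  · -- By symmetry of `B`, the derivative of `v ↦ B v v / 2` at `w` is `B w`.
    have hquad : ∀ w, HasFDerivAt (fun v => (1 / 2 : ℝ) • B v v) (B w) w := fun w => by
      have h2 : HasFDerivAt (fun v => B v v) _ w := B.hasFDerivAt.clm_apply (hasFDerivAt_id w)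
      refine (h2.const_smul (1 / 2 : ℝ)).congr_fderiv ?_
      ext z
      have h3 : (2⁻¹ : ℝ) • B w z + (2⁻¹ : ℝ) • B w z = B w z := by
        rw [← add_smul]; norm_num
      simpa [hsymm z w] using h3
    have := norm_sub_le_pow_succ (k := 2) hC₁
      (fun w hw => (k2 w hw).hasFDerivAt.sub (hquad w)) k1 hv
    have h2 : ∀ a : F, a - (u 0 - (1 / 2 : ℝ) • B 0 0) = a := by simp [h0]
    simp only [Pi.sub_apply, h2] at this
    calc _ ≤ _ := this
      _ ≤ C * ‖v‖ ^ 3 := by gcongr; rw [hC]; linarith [norm_nonneg B]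

end Taylor

section Plane

variable {n : ℕ} {T : Submodule ℝ (Euc n)} {D : T →L[ℝ] Euc n}

theorem norm_le_norm_add_of_mem_orthogonal (v : T) {w : Euc n} (hw : w ∈ Tᗮ) :
    ‖v‖ ≤ ‖(v : Euc n) + w‖ := by
  have h : inner ℝ (v : Euc n) w = 0 := hw v v.2
  have := norm_add_sq_eq_norm_sq_add_norm_sq_real h
  have h2 : ‖(v : Euc n)‖ = ‖v‖ := rfl
  nlinarith [norm_nonneg w, norm_nonneg v, norm_nonneg ((v : Euc n) + w), h2]

/-- Normal vectors to `T` are almost normal to the graph of `D`: with `t + D t` the projection of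
`q`, the square of its norm is `⟪t + D t, q⟫ = ⟪D t, q⟫`. -/
theorem norm_graphPlane_proj_le (hD : ∀ v, D v ∈ Tᗮ) {q : Euc n} (hq : q ∈ Tᗮ) :
    ‖(graphPlane D).starProjection q‖ ≤ ‖D‖ * ‖q‖ := by
  obtain ⟨t, ht⟩ : (graphPlane D).starProjection q ∈ graphPlane D :=
    Submodule.starProjection_apply_mem _ _
  have ht' : (t : Euc n) + D t = (graphPlane D).starProjection q := by simpa using ht
  have h1 : ‖(graphPlane D).starProjection q‖ ^ 2 = inner ℝ (D t) q := by
    have h2 : inner ℝ ((graphPlane D).starProjection q) ((graphPlane D).starProjection q)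
        = inner ℝ ((graphPlane D).starProjection q) q := by
      rw [Submodule.inner_starProjection_left_eq_right]
      rw [Submodule.starProjection_eq_self_iff.2 (Submodule.starProjection_apply_mem _ _)]
      rw [← Submodule.inner_starProjection_left_eq_right]
    rw [← real_inner_self_eq_norm_sq, h2, ← ht', inner_add_left, hq t t.2, zero_add]
  have h3 : ‖t‖ ≤ ‖(graphPlane D).starProjection q‖ := by
    rw [← ht']; exact norm_le_norm_add_of_mem_orthogonal t (hD t)
  have h4 : inner ℝ (D t) q ≤ ‖D‖ * ‖t‖ * ‖q‖ :=
    (real_inner_le_norm _ _).trans (by gcongr; exact D.le_opNorm t)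
  by_contra! hlt
  have h5 : 0 < ‖(graphPlane D).starProjection q‖ := lt_of_le_of_lt (by positivity) hlt
  have h6 : ‖D‖ * ‖t‖ * ‖q‖ ≤ ‖(graphPlane D).starProjection q‖ * (‖D‖ * ‖q‖) := by
    calc ‖D‖ * ‖t‖ * ‖q‖ = ‖t‖ * (‖D‖ * ‖q‖) := by ring
      _ ≤ _ := by gcongr
  nlinarith

theorem graphPlane_proj_tangent (v : T) :
    (graphPlane D).starProjection (v + D v) = v + D v :=
  Submodule.starProjection_eq_self_iff.2 ⟨v, by simp⟩

/-- The vector `v + w` with `w` normal is projected onto the graph of `D` close to `v + D v`. -/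
theorem norm_graphPlane_proj_sub_le (hD : ∀ v, D v ∈ Tᗮ) (v : T) {w : Euc n} (hw : w ∈ Tᗮ) :
    ‖(graphPlane D).starProjection (v + w) - (v + D v)‖ ≤ ‖D‖ * ‖w - D v‖ := by
  have : (v : Euc n) + w = (v + D v) + (w - D v) := by abel
  rw [this, map_add, graphPlane_proj_tangent, add_sub_cancel_left]
  exact norm_graphPlane_proj_le hD (Submodule.sub_mem _ hw (hD v))

/-- The projector onto the graph of `D` depends continuously on `D` at `0`, hence so does the tangent
plane on the base point. -/
theorem norm_graphPlane_proj_sub_proj_le (hD : ∀ v, D v ∈ Tᗮ) :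
    ‖(graphPlane D).starProjection - T.starProjection‖ ≤ ‖D‖ * (‖D‖ + 2) := by
  refine ContinuousLinearMap.opNorm_le_bound _ (by positivity) fun p => ?_
  set v : T := T.orthogonalProjectionOnto p with hv
  have hw : Tᗮ.starProjection p ∈ Tᗮ := Submodule.starProjection_apply_mem _ _
  have hp : p = v + Tᗮ.starProjection p := by
    rw [hv, ← Submodule.starProjection_apply, Submodule.starProjection_add_starProjection_orthogonal]
  have h1 := norm_graphPlane_proj_sub_le hD v hw
  rw [← hp] at h1
  have hv1 : ‖v‖ ≤ ‖p‖ := T.norm_orthogonalProjectionOnto_apply_le p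
  have hw1 : ‖Tᗮ.starProjection p‖ ≤ ‖p‖ := Submodule.norm_starProjection_apply_le _ p
  have hDv : ‖D v‖ ≤ ‖D‖ * ‖p‖ := (D.le_opNorm v).trans (by gcongr)
  have h2 : ((graphPlane D).starProjection - T.starProjection) p =
      ((graphPlane D).starProjection p - (v + D v)) + D v := by
    rw [sub_apply, T.starProjection_apply, ← hv]; abel
  rw [h2]
  calc _ ≤ ‖D‖ * ‖Tᗮ.starProjection p - D v‖ + ‖D v‖ := (norm_add_le _ _).trans (by gcongr)
    _ ≤ ‖D‖ * (‖p‖ + ‖D‖ * ‖p‖) + ‖D‖ * ‖p‖ := by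
      gcongr
      exact (norm_sub_le _ _).trans (by gcongr)
    _ = _ := by ring

end Plane

/-- On the ball of radius `r`, the set `M` is the graph over `x + T` of the normal function `u`,
which vanishes to second order at `0`, with the explicit constant `C` in the Taylor expansions. -/
structure IsTaylorGraph {n : ℕ} (M : Set (Euc n)) (x : Euc n) (T : Submodule ℝ (Euc n))
    (u : T → Euc n) (C r : ℝ) : Prop where
  r_pos : 0 < r
  one_le : 1 ≤ C
  C_mul_r : C * r ≤ 1
  normal : ∀ v, u v ∈ Tᗮ
  zero : u 0 = 0
  mem : ∀ v : T, ‖v‖ < r → graphMap x u v ∈ M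
  eq : ∀ p ∈ M, ‖p - x‖ < r → graphMap x u (T.orthogonalProjectionOnto (p - x)) = p
  diff : ∀ v : T, ‖v‖ < r → DifferentiableAt ℝ u v
  fderiv_mem : ∀ v : T, ‖v‖ < r → ∀ w, fderiv ℝ u v w ∈ Tᗮ
  norm_fderiv : ∀ v : T, ‖v‖ < r → ‖fderiv ℝ u v‖ ≤ C * ‖v‖
  norm_le : ∀ v : T, ‖v‖ < r → ‖u v‖ ≤ C * ‖v‖ ^ 2
  norm_fderiv_sub : ∀ v : T, ‖v‖ < r →
    ‖fderiv ℝ u v v - fderiv ℝ (fderiv ℝ u) 0 v v‖ ≤ C * ‖v‖ ^ 3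
  norm_sub : ∀ v : T, ‖v‖ < r →
    ‖u v - (1 / 2 : ℝ) • fderiv ℝ (fderiv ℝ u) 0 v v‖ ≤ C * ‖v‖ ^ 3
  tangent : ∀ v : T, ‖v‖ < r → tangentSpace M (graphMap x u v) = graphPlane (fderiv ℝ u v)

theorem fderiv_mem_of_forall_mem {n : ℕ} {T : Submodule ℝ (Euc n)} {u : T → Euc n}
    (hu : ∀ v, u v ∈ Tᗮ) {v : T} (hd : DifferentiableAt ℝ u v) (w : T) :
    fderiv ℝ u v w ∈ Tᗮ := by
  have h1 := T.starProjection.hasFDerivAt.comp v hd.hasFDerivAt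
  have h2 : (T.starProjection ∘ u) = fun _ => 0 := by
    ext1 v
    rw [Function.comp_apply, Submodule.starProjection_apply_eq_zero_iff]
    exact hu v
  rw [h2] at h1
  have h3 := h1.unique (hasFDerivAt_const 0 v)
  have h4 := congrArg (fun A : T →L[ℝ] Euc n => A w) h3
  simpa [Submodule.starProjection_apply_eq_zero_iff] using h4

theorem isTaylorGraph_of_isLocalGraph {n : ℕ} {M : Set (Euc n)} {x : Euc n}
    {T : Submodule ℝ (Euc n)} {u : T → Euc n} (hg : IsLocalGraph M x T u)
    (hu : ContDiffAt ℝ 3 u 0) (h0 : u 0 = 0) (h1 : fderiv ℝ u 0 = 0) :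
    ∃ C r, IsTaylorGraph M x T u C r := by
  obtain ⟨C, r₁, hC, hr₁, hb⟩ := exists_taylor_bounds hu h0 h1
  have hn := (tendsto_graphMap hu.continuousAt h0).eventually hg.2
  obtain ⟨r₂, hr₂, hb₂⟩ := Metric.eventually_nhds_iff_ball.1
    ((tangentSpace_graphMap hg hu h0).and hn)
  obtain ⟨r₃, hr₃, hb₃⟩ := Metric.eventually_nhds_iff_ball.1 hg.2
  set r := min (min r₁ r₂) (min r₃ (C + 1)⁻¹) with hr
  have hrr₁ : r ≤ r₁ := (min_le_left _ _).trans (min_le_left _ _)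
  have hrr₂ : r ≤ r₂ := (min_le_left _ _).trans (min_le_right _ _)
  have hrr₃ : r ≤ r₃ := (min_le_right _ _).trans (min_le_left _ _)
  have hrr₄ : r ≤ (C + 1)⁻¹ := (min_le_right _ _).trans (min_le_right _ _)
  have hC1 : C ≤ C + 1 := by linarith
  have hb' : ∀ v : T, ‖v‖ < r → _ := fun v hv => hb v (hv.trans_le hrr₁)
  have hb₂' : ∀ v : T, ‖v‖ < r → _ := fun v hv => hb₂ v (by simpa using hv.trans_le hrr₂)
  refine ⟨C + 1, r, ⟨by positivity, by linarith, ?_, hg.1, h0, fun v hv => ?_, fun p hp hpr => ?_,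
    fun v hv => (hb' v hv).1, fun v hv => fderiv_mem_of_forall_mem hg.1 (hb' v hv).1,
    fun v hv => (hb' v hv).2.1.trans (by gcongr), fun v hv => (hb' v hv).2.2.1.trans (by gcongr),
    fun v hv => (hb' v hv).2.2.2.1.trans (by gcongr),
    fun v hv => (hb' v hv).2.2.2.2.trans (by gcongr), fun v hv => (hb₂' v hv).1⟩⟩
  · calc (C + 1) * r ≤ (C + 1) * (C + 1)⁻¹ := by gcongr
      _ = 1 := mul_inv_cancel₀ (by positivity)
  · refine (hb₂' v hv).2.2 ?_
    rw [projOrth_graphMap hg.1, proj_graphMap hg.1]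
  · exact (eq_graphMap_of_projOrth ((hb₃ p (by simpa [dist_eq_norm] using hpr.trans_le hrr₃)).1
      hp)).symm

/-- The mean curvature vector can be computed from any local graph, because two local graphs over
the same tangent space coincide near the origin. -/
theorem meanCurvature_eq {n : ℕ} {M : Set (Euc n)} {x : Euc n} {u : tangentSpace M x → Euc n}
    (hg : IsLocalGraph M x (tangentSpace M x) u) (hu : ContDiffAt ℝ 2 u 0) (h0 : u 0 = 0) :
    meanCurvature M x = Laplacian.laplacian u 0 := by
  have hex : ∃ v, IsMeanCurvatureAt M x v := ⟨_, u, hu, hg, rfl⟩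
  rw [meanCurvature, dif_pos hex]
  obtain ⟨u', hu', hg', h'⟩ := hex.choose_spec
  rw [h']
  have : u' =ᶠ[𝓝 0] u := by
    have ht := tendsto_graphMap (x := x) hu.continuousAt h0
    filter_upwards [ht.eventually hg.2, ht.eventually hg'.2] with v h1 h2
    rw [projOrth_graphMap hg.1, proj_graphMap hg.1] at h1 h2
    exact (h2.1 (h1.2 rfl)).symm
  exact (InnerProductSpace.laplacian_congr_nhds this).self_of_nhds

theorem laplacian_eq_sum_fderiv {E F ι : Type*} [NormedAddCommGroup E] [InnerProductSpace ℝ E]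
    [FiniteDimensional ℝ E] [NormedAddCommGroup F] [NormedSpace ℝ F] [Fintype ι]
    (b : OrthonormalBasis ι ℝ E) (u : E → F) (x : E) :
    Laplacian.laplacian u x = ∑ i, fderiv ℝ (fderiv ℝ u) x (b i) (b i) := by
  rw [InnerProductSpace.laplacian_eq_iteratedFDeriv_orthonormalBasis u b]
  simp [iteratedFDeriv_two_apply]

/-- At a point of a `C^3` submanifold, the tangent space is `d`-dimensional, the submanifold is a
graph over it with Taylor bounds, and the mean curvature vector is the Laplacian of the graph. -/
theorem exists_isTaylorGraph {n d : ℕ} {M : Set (Euc n)} (hM : IsSubmanifold 3 d M) {x : Euc n}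
    (hx : x ∈ M) : Module.finrank ℝ (tangentSpace M x) = d ∧
      ∃ (u : tangentSpace M x → Euc n) (C r : ℝ), IsTaylorGraph M x (tangentSpace M x) u C r ∧
        meanCurvature M x = Laplacian.laplacian u 0 := by
  obtain ⟨T, u, hT, hu, hg, h0, h1⟩ := exists_graph hM hx
  have ht : tangentSpace M x = T := by
    have := (tangentSpace_graphMap hg hu h0).self_of_nhds
    rw [graphMap_zero h0, h1] at this
    rw [this]
    simp [graphPlane]
  subst ht
  obtain ⟨C, r, h⟩ := isTaylorGraph_of_isLocalGraph hg hu h0 h1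
  exact ⟨hT, u, C, r, h, meanCurvature_eq hg (hu.of_le (by norm_num)) h0⟩

end Varifold

/-! ### Area of a graph compared with Lebesgue measure on the tangent space -/

namespace Varifold

theorem euclideanHausdorffMeasure_image_le {X Y : Type*} [EMetricSpace X] [EMetricSpace Y]
    [MeasurableSpace X] [BorelSpace X] [MeasurableSpace Y] [BorelSpace Y] {K : ℝ≥0} {f : X → Y}
    {s : Set X} (h : LipschitzOnWith K f s) (d : ℕ) : μHE[d] (f '' s) ≤ K ^ d * μHE[d] s := by
  simp only [Measure.euclideanHausdorffMeasure_def, Measure.smul_apply]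
  have := h.hausdorffMeasure_image_le (d := (d : ℝ)) (by positivity)
  rw [ENNReal.rpow_natCast] at this
  calc _ ≤ _ • (↑K ^ d * μH[(d : ℝ)] s) := by gcongr
    _ = _ := by rw [mul_smul_comm]

theorem one_add_pow_le {a : ℝ} (h0 : 0 ≤ a) (h1 : a ≤ 1) (d : ℕ) :
    (1 + a) ^ d ≤ 1 + (2 ^ d - 1) * a := by
  induction d with
  | zero => simp
  | succ k ih =>
    have h2 : (1 : ℝ) ≤ 2 ^ k := one_le_pow₀ (by norm_num)
    calc (1 + a) ^ (k + 1) = (1 + a) ^ k * (1 + a) := pow_succ _ _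
      _ ≤ (1 + (2 ^ k - 1) * a) * (1 + a) := by gcongr
      _ ≤ 1 + (2 ^ (k + 1) - 1) * a := by
        rw [pow_succ]
        nlinarith [mul_nonneg (sub_nonneg.2 h2) (mul_nonneg h0 (sub_nonneg.2 h1))]

namespace IsTaylorGraph

variable {n : ℕ} {M : Set (Euc n)} {x : Euc n} {T : Submodule ℝ (Euc n)} {u : T → Euc n}
  {C r : ℝ}

theorem lipschitzWith_proj (T : Submodule ℝ (Euc n)) (x : Euc n) :
    LipschitzWith 1 (fun p => T.orthogonalProjectionOnto (p - x)) := by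
  refine LipschitzWith.of_dist_le_mul fun p q => ?_
  rw [dist_eq_norm, ← map_sub, sub_sub_sub_cancel_right, dist_eq_norm]
  simpa using T.norm_orthogonalProjectionOnto_apply_le (p - q)

/-- Over a ball of radius `s` the graph map expands distances at most by the factor
`1 + (C s)²`: increments in `T` and in the normal space are orthogonal. -/
theorem lipschitzOnWith_graphMap (h : IsTaylorGraph M x T u C r) {s : ℝ} (hs0 : 0 < s)
    (hs : s ≤ r) :
    LipschitzOnWith (Real.toNNReal (1 + (C * s) ^ 2)) (graphMap x u) (Metric.ball 0 s) := by
  have hC : 0 ≤ C := zero_le_one.trans h.one_le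
  refine LipschitzOnWith.of_dist_le_mul fun v hv w hw => ?_
  rw [Real.coe_toNNReal _ (by positivity), dist_eq_norm, dist_eq_norm]
  have h1 : ‖u v - u w‖ ≤ C * s * ‖v - w‖ := by
    refine Convex.norm_image_sub_le_of_norm_hasFDerivWithin_le (𝕜 := ℝ) (f' := fderiv ℝ u)
      (s := Metric.ball 0 s) (fun z hz => ?_) (fun z hz => ?_) (convex_ball _ _) hw hv
    · exact (h.diff z (by simpa using hz.trans_le hs)).hasFDerivAt.hasFDerivWithinAt
    · have hz' : ‖z‖ < s := by simpa using hz
      exact (h.norm_fderiv z (hz'.trans_le hs)).trans (by gcongr)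
  have h2 : graphMap x u v - graphMap x u w = ((v - w : T) : Euc n) + (u v - u w) := by
    simp only [graphMap, Submodule.coe_sub]; abel
  have h3 : inner ℝ ((v - w : T) : Euc n) (u v - u w) = 0 :=
    (Submodule.sub_mem _ (h.normal v) (h.normal w)) _ (v - w).2
  have h4 := norm_add_sq_eq_norm_sq_add_norm_sq_real h3
  rw [← h2] at h4
  have h5 : ‖((v - w : T) : Euc n)‖ = ‖v - w‖ := rfl
  rw [h5] at h4
  have h6 : ‖u v - u w‖ * ‖u v - u w‖ ≤ (C * s) ^ 2 * ‖v - w‖ ^ 2 := by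
    rw [← mul_pow, sq]; gcongr
  refine abs_le_of_sq_le_sq' ?_ (by positivity) |>.2
  have h7 : 0 ≤ (C * s) ^ 2 * ‖v - w‖ ^ 2 := by positivity
  have h8 : 0 ≤ ((C * s) ^ 2) ^ 2 * ‖v - w‖ ^ 2 := by positivity
  nlinarith

theorem lipschitzOnWith_two (h : IsTaylorGraph M x T u C r) :
    LipschitzOnWith 2 (graphMap x u) (Metric.ball 0 r) := by
  refine (h.lipschitzOnWith_graphMap h.r_pos le_rfl).weaken ?_
  rw [Real.toNNReal_le_iff_le_coe]
  have h1 := h.C_mul_r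
  have h2 : 0 ≤ C * r := mul_nonneg (zero_le_one.trans h.one_le) h.r_pos.le
  have : (C * r) ^ 2 ≤ 1 := pow_le_one₀ h2 h1
  norm_num
  linarith

theorem injOn_graphMap (h : IsTaylorGraph M x T u C r) (s : Set T) :
    InjOn (graphMap x u) s := fun v _ w _ hvw => by
  rw [← proj_graphMap (x := x) h.normal v, hvw, proj_graphMap h.normal]

/-- The part of the graph of `u` that lies over the ball of radius `s` of the tangent space. -/
def piece {n : ℕ} {T : Submodule ℝ (Euc n)} (x : Euc n) (u : T → Euc n) (s : ℝ) : Set (Euc n) :=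
  graphMap x u '' Metric.ball 0 s

theorem piece_subset (h : IsTaylorGraph M x T u C r) {s : ℝ} (hs : s ≤ r) :
    piece x u s ⊆ M := by
  rintro _ ⟨v, hv, rfl⟩
  exact h.mem v (by simpa using hv.trans_le hs)

theorem measurableSet_piece (h : IsTaylorGraph M x T u C r) {s : ℝ} (hs : s ≤ r) :
    MeasurableSet (piece x u s) :=
  Metric.isOpen_ball.measurableSet.image_of_continuousOn_injOn
    (h.lipschitzOnWith_two.continuousOn.mono (Metric.ball_subset_ball hs)) (h.injOn_graphMap _)

/-- The projection to the tangent space of the area measure of the graph of `u` over the ball of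
radius `s`. -/
noncomputable def projMeasure {n : ℕ} {T : Submodule ℝ (Euc n)} (x : Euc n) (u : T → Euc n)
    (s : ℝ) : Measure T :=
  (μHE[Module.finrank ℝ T].restrict (piece x u s)).map
    (fun p => T.orthogonalProjectionOnto (p - x))

theorem measurable_proj (T : Submodule ℝ (Euc n)) (x : Euc n) :
    Measurable (fun p => T.orthogonalProjectionOnto (p - x)) :=
  (lipschitzWith_proj T x).continuous.measurable

/-- Area decreases under the projection to the tangent space. -/
theorem volume_le_image (h : IsTaylorGraph M x T u C r) (A : Set T) :
    volume A ≤ μHE[Module.finrank ℝ T] (graphMap x u '' A) := by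
  have h1 := euclideanHausdorffMeasure_image_le
    (lipschitzWith_proj T x).lipschitzOnWith (s := graphMap x u '' A) (Module.finrank ℝ T)
  have h2 : (fun p => T.orthogonalProjectionOnto (p - x)) '' (graphMap x u '' A) = A := by
    rw [image_image]
    simp only [proj_graphMap h.normal, image_id']
  rw [h2, InnerProductSpace.euclideanHausdorffMeasure_eq_volume] at h1
  simpa using h1

theorem projMeasure_apply (h : IsTaylorGraph M x T u C r) {s : ℝ} {A : Set T}
    (hA : MeasurableSet A) : projMeasure x u s A =
      μHE[Module.finrank ℝ T] (graphMap x u '' (A ∩ Metric.ball 0 s)) := by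
  rw [projMeasure, Measure.map_apply (measurable_proj T x) hA,
    Measure.restrict_apply (measurable_proj T x hA)]
  congr 1
  ext p
  constructor
  · rintro ⟨hp, v, hv, rfl⟩
    rw [mem_preimage, proj_graphMap h.normal] at hp
    exact ⟨v, ⟨hp, hv⟩, rfl⟩
  · rintro ⟨v, ⟨hv, hv'⟩, rfl⟩
    exact ⟨by rwa [mem_preimage, proj_graphMap h.normal], v, hv', rfl⟩

theorem restrict_le_projMeasure (h : IsTaylorGraph M x T u C r) {s : ℝ} :
    (volume : Measure T).restrict (Metric.ball 0 s) ≤ projMeasure x u s := by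
  refine Measure.le_iff.2 fun A hA => ?_
  rw [h.projMeasure_apply hA, Measure.restrict_apply hA]
  exact h.volume_le_image _

/-- The area of the graph differs from the area of its projection by a quadratic factor. -/
theorem projMeasure_le (h : IsTaylorGraph M x T u C r) {s : ℝ} (hs0 : 0 < s) (hs : s ≤ r) :
    projMeasure x u s ≤ ENNReal.ofReal (1 + 2 ^ (Module.finrank ℝ T) * C ^ 2 * s ^ 2) •
      (volume : Measure T).restrict (Metric.ball 0 s) := by
  have hC : 0 ≤ C := zero_le_one.trans h.one_le
  refine Measure.le_iff.2 fun A hA => ?_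
  rw [h.projMeasure_apply hA, Measure.smul_apply, Measure.restrict_apply hA]
  refine (euclideanHausdorffMeasure_image_le
    ((h.lipschitzOnWith_graphMap hs0 hs).mono inter_subset_right) _).trans ?_
  rw [InnerProductSpace.euclideanHausdorffMeasure_eq_volume, smul_eq_mul]
  gcongr
  rw [← ENNReal.ofReal, ← ENNReal.ofReal_pow (by positivity)]
  refine ENNReal.ofReal_le_ofReal ?_
  have h1 : C * s ≤ 1 := le_trans (by gcongr) h.C_mul_r
  have h2 : (C * s) ^ 2 ≤ 1 := pow_le_one₀ (by positivity) h1
  have := one_add_pow_le (sq_nonneg (C * s)) h2 (Module.finrank ℝ T)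
  nlinarith [sq_nonneg (C * s)]

end IsTaylorGraph

/-- Comparison of integrals against two measures, one of which dominates the other by a factor
close to `1`. -/
theorem norm_integral_sub_integral_le {X E : Type*} [MeasurableSpace X] [NormedAddCommGroup E]
    [NormedSpace ℝ E] {ν lam : Measure X} [IsFiniteMeasure lam] {κ : ℝ} (hκ : 0 ≤ κ)
    (h1 : lam ≤ ν) (h2 : ν ≤ ENNReal.ofReal (1 + κ) • lam) {g : X → E}
    (hg : AEStronglyMeasurable g ν) {a : ℝ} (ha : ∀ᵐ v ∂ν, ‖g v‖ ≤ a) :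
    ‖∫ v, g v ∂ν - ∫ v, g v ∂lam‖ ≤ κ * a * lam.real univ := by
  have hνu : ν univ < ⊤ := by
    refine (h2 univ).trans_lt ?_
    rw [Measure.smul_apply, smul_eq_mul]
    exact ENNReal.mul_lt_top ENNReal.ofReal_lt_top (measure_lt_top _ _)
  have : IsFiniteMeasure ν := ⟨hνu⟩
  have hsum : ν = (ν - lam) + lam := (Measure.sub_add_cancel_of_le h1).symm
  have hle : ν - lam ≤ ν := Measure.sub_le
  have hgi : Integrable g ν := Integrable.of_bound hg a ha
  have h3 : ∫ v, g v ∂ν = ∫ v, g v ∂(ν - lam) + ∫ v, g v ∂lam := by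
    conv_lhs => rw [hsum]
    exact integral_add_measure (hgi.mono_measure hle) (hgi.mono_measure h1)
  rw [h3, add_sub_cancel_right]
  have h4 : ‖∫ v, g v ∂(ν - lam)‖ ≤ a * (ν - lam).real univ :=
    norm_integral_le_of_norm_le_const (ae_mono hle ha)
  have h5 : (ν - lam).real univ ≤ κ * lam.real univ := by
    have h6 : ν.real univ = (ν - lam).real univ + lam.real univ := by
      conv_lhs => rw [hsum]
      rw [measureReal_add_apply]
    have h7 : ν.real univ ≤ (1 + κ) * lam.real univ := by
      have := ENNReal.toReal_mono (by
        rw [Measure.smul_apply, smul_eq_mul]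
        exact (ENNReal.mul_lt_top ENNReal.ofReal_lt_top (measure_lt_top _ _)).ne) (h2 univ)
      rw [Measure.smul_apply, smul_eq_mul, ENNReal.toReal_mul,
        ENNReal.toReal_ofReal (by positivity)] at this
      exact this
    linarith
  rcases eq_or_ne (ν - lam) 0 with h0 | h0
  · rw [h0]
    rw [integral_zero_measure, norm_zero]
    rcases eq_or_ne lam 0 with hl | hl
    · simp [hl]
    · have : 0 ≤ a := by
        have : (ae lam).NeBot := ae_neBot.2 hl
        have hae : ∀ᵐ v ∂lam, ‖g v‖ ≤ a := ae_mono h1 ha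
        obtain ⟨v, hv⟩ := hae.exists
        exact (norm_nonneg _).trans hv
      positivity
  · have : 0 ≤ a := by
      have : (ae (ν - lam)).NeBot := ae_neBot.2 h0
      have hae : ∀ᵐ v ∂(ν - lam), ‖g v‖ ≤ a := ae_mono hle ha
      obtain ⟨v, hv⟩ := hae.exists
      exact (norm_nonneg _).trans hv
    calc _ ≤ a * (ν - lam).real univ := h4
      _ ≤ a * (κ * lam.real univ) := by gcongr
      _ = _ := by ring

namespace IsTaylorGraph

variable {n : ℕ} {M : Set (Euc n)} {x : Euc n} {T : Submodule ℝ (Euc n)} {u : T → Euc n}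
  {C r : ℝ} {E : Type*} [NormedAddCommGroup E] [NormedSpace ℝ E]

theorem volume_real_ball (T : Submodule ℝ (Euc n)) (v : T) {s : ℝ} (hs : 0 < s) :
    (volume : Measure T).real (Metric.ball v s) =
      s ^ (Module.finrank ℝ T) * (volume : Measure T).real (Metric.ball 0 1) := by
  rw [Measure.real, Measure.addHaar_ball_of_pos _ _ hs, ENNReal.toReal_mul,
    ENNReal.toReal_ofReal (by positivity), Measure.real]

/-- Integrals over `M` of functions supported near `x` are, up to a quadratic relative error,
integrals over the tangent space. -/
theorem norm_setIntegral_sub_le (h : IsTaylorGraph M x T u C r) (hM : MeasurableSet M)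
    {s t : ℝ} (ht : t < s) (hs0 : 0 < s) (hs : s ≤ r) {f : Euc n → E} {g : T → E}
    (hf : AEStronglyMeasurable f (μHE[Module.finrank ℝ T].restrict M)) (hg : StronglyMeasurable g)
    (hsupp : ∀ p, t < ‖p - x‖ → f p = 0) {a b : ℝ} (ha : ∀ v : T, ‖v‖ < s → ‖g v‖ ≤ a)
    (hb : ∀ v : T, ‖v‖ < s → ‖f (graphMap x u v) - g v‖ ≤ b) :
    ‖∫ p in M, f p ∂μHE[Module.finrank ℝ T] - ∫ v in Metric.ball 0 s, g v‖ ≤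
      ((1 + 2 ^ (Module.finrank ℝ T)) * b + 2 ^ (Module.finrank ℝ T) * C ^ 2 * s ^ 2 * a) *
        (s ^ (Module.finrank ℝ T) * (volume : Measure T).real (Metric.ball 0 1)) := by
  set d := Module.finrank ℝ T with hd
  have hC : 0 ≤ C := zero_le_one.trans h.one_le
  have hms := h.measurableSet_piece hs
  have hsub := h.piece_subset hs
  have hb0 : 0 ≤ b := (norm_nonneg _).trans (hb 0 (by simpa using hs0))
  set π : Euc n → T := fun p => T.orthogonalProjectionOnto (p - x) with hπ
  have hπm : Measurable π := measurable_proj T x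
  set μ : Measure (Euc n) := μHE[d] with hμ
  have h1 : ∫ p in M, f p ∂μ = ∫ p in piece x u s, f p ∂μ := by
    refine setIntegral_eq_of_subset_of_forall_sdiff_eq_zero hM hsub fun p hp => ?_
    refine hsupp p ?_
    by_contra! hlt
    refine hp.2 ⟨π p, ?_, h.eq p hp.1 (hlt.trans_lt (ht.trans_le hs))⟩
    have := T.norm_orthogonalProjectionOnto_apply_le (p - x)
    rw [Metric.mem_ball, dist_zero_right]
    exact (this.trans hlt).trans_lt ht
  have hνle := h.projMeasure_le hs0 hs
  have hlle := h.restrict_le_projMeasure (s := s)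
  rw [← hd] at hνle
  have : IsFiniteMeasure ((volume : Measure T).restrict (Metric.ball 0 s)) :=
    ⟨by rw [Measure.restrict_apply_univ]; exact measure_ball_lt_top⟩
  set κ := 2 ^ d * C ^ 2 * s ^ 2 with hκ
  have hκ0 : 0 ≤ κ := by positivity
  have hlam : ((volume : Measure T).restrict (Metric.ball 0 s)).real univ =
      s ^ d * (volume : Measure T).real (Metric.ball 0 1) := by
    rw [measureReal_restrict_apply_univ, volume_real_ball T 0 hs0]
  have hνtop : projMeasure x u s univ ≠ ⊤ := by
    refine ((hνle univ).trans_lt ?_).ne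
    rw [Measure.smul_apply, smul_eq_mul]
    exact ENNReal.mul_lt_top ENNReal.ofReal_lt_top (measure_lt_top _ _)
  have hνreal : (projMeasure x u s).real univ ≤
      (1 + κ) * (s ^ d * (volume : Measure T).real (Metric.ball 0 1)) := by
    rw [← hlam]
    have := ENNReal.toReal_mono (by
      rw [Measure.smul_apply, smul_eq_mul]
      exact (ENNReal.mul_lt_top ENNReal.ofReal_lt_top (measure_lt_top _ _)).ne) (hνle univ)
    rwa [Measure.smul_apply, smul_eq_mul, ENNReal.toReal_mul,
      ENNReal.toReal_ofReal (by positivity)] at this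
  have hpiece : projMeasure x u s univ = μ (piece x u s) := by
    rw [projMeasure, Measure.map_apply hπm MeasurableSet.univ, preimage_univ,
      Measure.restrict_apply_univ]
  have : IsFiniteMeasure (μ.restrict (piece x u s)) :=
    ⟨by rw [Measure.restrict_apply_univ, ← hpiece]; exact hνtop.lt_top⟩
  have haeg : ∀ᵐ v ∂(projMeasure x u s), ‖g v‖ ≤ a := by
    rw [projMeasure, ae_map_iff hπm.aemeasurable
      (measurableSet_le hg.norm.measurable measurable_const)]
    refine (ae_restrict_iff' hms).2 (ae_of_all _ ?_)
    rintro _ ⟨v, hv, rfl⟩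
    rw [hπ]
    simp only [proj_graphMap h.normal]
    exact ha v (by simpa using hv)
  have h2 : ∫ p in piece x u s, g (π p) ∂μ = ∫ v, g v ∂(projMeasure x u s) := by
    rw [projMeasure, integral_map hπm.aemeasurable hg.aestronglyMeasurable]
  have hfb : ∀ᵐ p ∂(μ.restrict (piece x u s)), ‖f p - g (π p)‖ ≤ b := by
    refine (ae_restrict_iff' hms).2 (ae_of_all _ ?_)
    rintro _ ⟨v, hv, rfl⟩
    rw [hπ]
    simp only [proj_graphMap h.normal]
    exact hb v (by simpa using hv)
  have hgi : Integrable (fun p => g (π p)) (μ.restrict (piece x u s)) := by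
    refine Integrable.of_bound (hg.comp_measurable hπm).aestronglyMeasurable a ?_
    exact (ae_map_iff hπm.aemeasurable
      (measurableSet_le hg.norm.measurable measurable_const)).1 haeg
  have hfm : AEStronglyMeasurable f (μ.restrict (piece x u s)) :=
    hf.mono_measure (Measure.restrict_mono hsub le_rfl)
  have hdi : Integrable (fun p => f p - g (π p)) (μ.restrict (piece x u s)) :=
    Integrable.of_bound (hfm.sub hgi.aestronglyMeasurable) b hfb
  have hfi : Integrable f (μ.restrict (piece x u s)) := by
    exact (hdi.add hgi).congr (ae_of_all _ fun p => by simp)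
  -- Replacing `f` by `g ∘ π` costs `b` times the area, replacing the area by Lebesgue measure `κ a`.
  have h3 : ‖∫ p in piece x u s, f p ∂μ - ∫ p in piece x u s, g (π p) ∂μ‖ ≤
      b * (projMeasure x u s).real univ := by
    rw [← integral_sub hfi hgi]
    refine (norm_integral_le_of_norm_le_const hfb).trans (le_of_eq ?_)
    rw [Measure.real, Measure.real, hpiece, Measure.restrict_apply_univ]
  have h4 := norm_integral_sub_integral_le hκ0 hlle hνle hg.aestronglyMeasurable haeg
  rw [hlam] at h4
  have hω : 0 ≤ s ^ d * (volume : Measure T).real (Metric.ball 0 1) := by positivity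
  have hCs : C ^ 2 * s ^ 2 ≤ 1 := by
    rw [← mul_pow]
    exact pow_le_one₀ (by positivity) (le_trans (by gcongr) h.C_mul_r)
  have hκ1 : κ ≤ 2 ^ d := by
    rw [hκ, mul_assoc]
    exact mul_le_of_le_one_right (by positivity) hCs
  rw [h1]
  calc _ ≤ ‖∫ p in piece x u s, f p ∂μ - ∫ p in piece x u s, g (π p) ∂μ‖ +
        ‖∫ v, g v ∂(projMeasure x u s) - ∫ v in Metric.ball 0 s, g v‖ := by
        rw [h2]; exact norm_sub_le_norm_sub_add_norm_sub _ _ _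
    _ ≤ b * ((1 + 2 ^ d) * (s ^ d * (volume : Measure T).real (Metric.ball 0 1))) +
        κ * a * (s ^ d * (volume : Measure T).real (Metric.ball 0 1)) := by
        gcongr
        exact h3.trans (by gcongr; exact hνreal.trans (by gcongr))
    _ = _ := by ring

end IsTaylorGraph

end Varifold

/-! ### The Grassmannian and the varifold of a submanifold -/

namespace Varifold

section Grassmannian

variable {n d : ℕ}

/-- As projectors, the elements of the Grassmannian are the self-adjoint idempotents of trace `d`;
this closed and bounded description makes it compact. -/
theorem range_grProj : range (Gr.proj : Gr d n → (Euc n →L[ℝ] Euc n)) =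
    {A | A ∘L A = A ∧ ContinuousLinearMap.adjoint A = A ∧
      LinearMap.trace ℝ (Euc n) (A : Euc n →ₗ[ℝ] Euc n) = d} := by
  ext A
  constructor
  · rintro ⟨S, rfl⟩
    have hs : IsStarProjection S.proj := isStarProjection_starProjection
    refine ⟨hs.isIdempotentElem, hs.isSelfAdjoint, ?_⟩
    have hp : LinearMap.IsProj S.1 (S.proj : Euc n →ₗ[ℝ] Euc n) :=
      ⟨fun x => Submodule.starProjection_apply_mem _ _,
        fun x hx => Submodule.starProjection_eq_self_iff.2 hx⟩
    rw [hp.trace, S.2]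
  · rintro ⟨h1, h2, h3⟩
    have hs : IsStarProjection A := ⟨h1, h2⟩
    obtain ⟨L, hr, hA⟩ := isStarProjection_iff_eq_starProjection.1 hs
    have hp : LinearMap.IsProj L (A : Euc n →ₗ[ℝ] Euc n) := by
      rw [hA]
      exact ⟨fun x => Submodule.starProjection_apply_mem _ _,
        fun x hx => Submodule.starProjection_eq_self_iff.2 hx⟩
    rw [hp.trace] at h3
    exact ⟨⟨L, by exact_mod_cast h3⟩, hA.symm⟩

instance Gr.instCompactSpace : CompactSpace (Gr d n) := by
  have hind : IsInducing (Gr.proj : Gr d n → (Euc n →L[ℝ] Euc n)) := ⟨rfl⟩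
  rw [← isCompact_univ_iff, hind.isCompact_iff, image_univ]
  have : ProperSpace (Euc n →L[ℝ] Euc n) := FiniteDimensional.proper ℝ _
  refine Metric.isCompact_of_isClosed_isBounded ?_ ?_
  · rw [range_grProj]
    refine IsClosed.inter ?_ (IsClosed.inter ?_ ?_)
    · exact isClosed_eq (by fun_prop) continuous_id
    · exact isClosed_eq (by fun_prop) continuous_id
    · refine isClosed_eq ?_ continuous_const
      exact ((LinearMap.trace ℝ (Euc n)).comp
        (ContinuousLinearMap.coeLM ℝ)).continuous_of_finiteDimensional
  · refine isBounded_iff_forall_norm_le.2 ⟨1, ?_⟩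
    rintro _ ⟨S, rfl⟩
    exact Submodule.starProjection_norm_le _

/-- A locally finite measure whose support projects into a compact set is finite, because the
Grassmannian is compact. -/
theorem isFiniteMeasure_of_support_subset {W : Measure (Euc n × Gr d n)}
    [IsLocallyFiniteMeasure W] {K : Set (Euc n)} (hK : IsCompact K)
    (hW : W.support ⊆ K ×ˢ univ) : IsFiniteMeasure W := by
  have h1 : IsCompact (K ×ˢ (univ : Set (Gr d n))) := hK.prod isCompact_univ
  have h2 : IsCompact W.support := h1.of_isClosed_subset Measure.isClosed_support hW
  constructor
  rw [← measure_add_measure_compl₀ Measure.nullMeasurableSet_support,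
    Measure.measure_compl_support, add_zero]
  exact h2.measure_lt_top

end Grassmannian

section SmoothVarifold

variable {n d : ℕ} {M : Set (Euc n)}

/-- The Gauss map of `M` is continuous: near each point, compare with the graph at that point. -/
theorem continuousOn_tangentProj (hM : IsSubmanifold 3 d M) :
    ContinuousOn (fun y => (tangentSpace M y).starProjection) M := by
  intro x hx
  obtain ⟨-, u, C, r, h, -⟩ := exists_isTaylorGraph hM hx
  have hC : 0 ≤ C := zero_le_one.trans h.one_le
  rw [ContinuousWithinAt, tendsto_iff_norm_sub_tendsto_zero]
  have hlim : Tendsto (fun y => C * ‖y - x‖ * (1 + 2)) (𝓝[M] x) (𝓝 0) := by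
    have : Continuous (fun y : Euc n => C * ‖y - x‖ * (1 + 2)) := by fun_prop
    simpa using (this.tendsto x).mono_left nhdsWithin_le_nhds
  refine squeeze_zero' (Eventually.of_forall fun _ => norm_nonneg _) ?_ hlim
  filter_upwards [self_mem_nhdsWithin, nhdsWithin_le_nhds (Metric.ball_mem_nhds x h.r_pos)]
    with y hyM hy
  have hyr : ‖y - x‖ < r := by simpa [dist_eq_norm] using hy
  set v := (tangentSpace M x).orthogonalProjectionOnto (y - x) with hv
  have hvy : ‖v‖ ≤ ‖y - x‖ := (tangentSpace M x).norm_orthogonalProjectionOnto_apply_le _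
  have hvr := hvy.trans_lt hyr
  have hyv := h.eq y hyM hyr
  have ht := h.tangent v hvr
  rw [hv, hyv, ← hv] at ht
  have hD := h.norm_fderiv v hvr
  have hD1 : ‖fderiv ℝ u v‖ ≤ 1 := hD.trans (le_trans (by gcongr) h.C_mul_r)
  rw [ht]
  refine (norm_graphPlane_proj_sub_proj_le (h.fderiv_mem v hvr)).trans ?_
  gcongr
  exact hD.trans (by gcongr)

theorem range_tangentPoint (hM : IsSubmanifold 3 d M) :
    range (Subtype.val : TangentPoint d M → Euc n) = M := by
  ext x
  refine ⟨?_, fun hx => ⟨⟨x, hx, (exists_isTaylorGraph hM hx).1⟩, rfl⟩⟩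
  rintro ⟨y, rfl⟩
  exact y.2.1

theorem setOf_tangentPoint (hM : IsSubmanifold 3 d M) :
    {x | x ∈ M ∧ Module.finrank ℝ (tangentSpace M x) = d} = M := by
  ext x
  exact ⟨fun h => h.1, fun h => ⟨h, (exists_isTaylorGraph hM h).1⟩⟩

theorem continuous_gaussGraph (hM : IsSubmanifold 3 d M) : Continuous (gaussGraph d M) := by
  refine continuous_subtype_val.prodMk ?_
  have hind : IsInducing (Gr.proj : Gr d n → (Euc n →L[ℝ] Euc n)) := ⟨rfl⟩
  refine hind.continuous_iff.2 ?_
  exact (continuousOn_tangentProj hM).comp_continuous continuous_subtype_val fun x => x.2.1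

theorem continuous_proj : Continuous (Gr.proj : Gr d n → (Euc n →L[ℝ] Euc n)) :=
  continuous_induced_dom

theorem measurableEmbedding_val (hMc : IsCompact M) (hM : IsSubmanifold 3 d M) :
    MeasurableEmbedding (Subtype.val : TangentPoint d M → Euc n) := by
  refine MeasurableEmbedding.subtype_coe ?_
  have h := hMc.measurableSet
  rw [← setOf_tangentPoint hM] at h
  exact h

theorem mass_smoothVarifold (hMc : IsCompact M) (hM : IsSubmanifold 3 d M) :
    mass (smoothVarifold d M) = μHE[d].restrict M := by
  rw [mass, smoothVarifold, Measure.map_map measurable_fst (continuous_gaussGraph hM).measurable]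
  have : Prod.fst ∘ gaussGraph d M = (Subtype.val : TangentPoint d M → Euc n) := rfl
  rw [this, (measurableEmbedding_val hMc hM).map_comap, range_tangentPoint hM]

/-- Integrals against the varifold of `M`, of functions of the point and of the projector onto the
plane, are integrals over `M`. -/
theorem integral_smoothVarifold {E : Type*} [NormedAddCommGroup E] [NormedSpace ℝ E]
    (hMc : IsCompact M) (hM : IsSubmanifold 3 d M)
    {F : Euc n × (Euc n →L[ℝ] Euc n) → E} (hF : Continuous F) :
    ∫ p, F (p.1, p.2.proj) ∂(smoothVarifold d M) =
      ∫ y in M, F (y, (tangentSpace M y).starProjection) ∂μHE[d] := by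
  have hFc : Continuous fun p : Euc n × Gr d n => F (p.1, p.2.proj) :=
    hF.comp (continuous_fst.prodMk (continuous_proj.comp continuous_snd))
  have hgc := continuous_gaussGraph hM
  have hme := measurableEmbedding_val hMc hM
  have hF' : AEStronglyMeasurable (fun p : Euc n × Gr d n => F (p.1, p.2.proj))
      (Measure.map (gaussGraph d M)
        (Measure.comap (Subtype.val : TangentPoint d M → Euc n) μHE[d])) :=
    hFc.aestronglyMeasurable
  rw [smoothVarifold, integral_map hgc.measurable.aemeasurable hF']
  have h2 := hme.setIntegral_map (μ := Measure.comap (Subtype.val : TangentPoint d M → Euc n) μHE[d])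
    (fun y => F (y, (tangentSpace M y).starProjection)) univ
  rw [hme.map_comap, range_tangentPoint hM] at h2
  simp only [Measure.restrict_univ, preimage_univ] at h2
  rw [h2]
  rfl

theorem aestronglyMeasurable_tangent {E : Type*} [NormedAddCommGroup E] [NormedSpace ℝ E]
    (hMc : IsCompact M) (hM : IsSubmanifold 3 d M)
    {F : Euc n × (Euc n →L[ℝ] Euc n) → E} (hF : Continuous F) (μ : Measure (Euc n)) :
    AEStronglyMeasurable (fun y => F (y, (tangentSpace M y).starProjection)) (μ.restrict M) := by
  have h1 : ContinuousOn (fun y => F (y, (tangentSpace M y).starProjection)) M :=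
    hF.comp_continuousOn (continuousOn_id.prodMk (continuousOn_tangentProj hM))
  exact h1.aestronglyMeasurable hMc.measurableSet

theorem IsTaylorGraph.measure_closedBall_le {x : Euc n} {T : Submodule ℝ (Euc n)} {u : T → Euc n}
    {C r : ℝ} (h : IsTaylorGraph M x T u C r) {y : Euc n} (hyx : ‖y - x‖ < r / 2)
    {s : ℝ} (hs0 : 0 < s) (hs : s < r / 2) :
    μHE[Module.finrank ℝ T] (M ∩ Metric.closedBall y s) ≤
      ENNReal.ofReal (2 ^ Module.finrank ℝ T * volume.real (Metric.closedBall (0 : T) 1)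
        * s ^ Module.finrank ℝ T) := by
  set v := T.orthogonalProjectionOnto (y - x) with hv
  have hsub : M ∩ Metric.closedBall y s ⊆
      graphMap x u '' (Metric.closedBall v s ∩ Metric.ball 0 r) := by
    rintro p ⟨hpM, hp⟩
    have hpx : ‖p - x‖ < r := by
      have h1 : ‖p - y‖ ≤ s := by simpa [dist_eq_norm] using hp
      have h2 := norm_sub_le_norm_sub_add_norm_sub p y x
      linarith
    refine ⟨T.orthogonalProjectionOnto (p - x), ⟨?_, ?_⟩, h.eq p hpM hpx⟩
    · have := (IsTaylorGraph.lipschitzWith_proj T x).dist_le_mul p y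
      rw [NNReal.coe_one, one_mul] at this
      exact this.trans hp
    · rw [Metric.mem_ball, dist_zero_right]
      exact (T.norm_orthogonalProjectionOnto_apply_le _).trans_lt hpx
  calc _ ≤ μHE[Module.finrank ℝ T] (graphMap x u '' (Metric.closedBall v s ∩ Metric.ball 0 r)) :=
        measure_mono hsub
    _ ≤ (2 : ℝ≥0) ^ Module.finrank ℝ T *
        μHE[Module.finrank ℝ T] (Metric.closedBall v s ∩ Metric.ball 0 r) :=
        euclideanHausdorffMeasure_image_le (h.lipschitzOnWith_two.mono inter_subset_right) _
    _ ≤ (2 : ℝ≥0) ^ Module.finrank ℝ T * volume (Metric.closedBall v s) := by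
        rw [InnerProductSpace.euclideanHausdorffMeasure_eq_volume]
        gcongr
        exact inter_subset_left
    _ = _ := by
        rw [Measure.addHaar_closedBall' _ _ hs0.le, mul_assoc, ENNReal.ofReal_mul (by positivity),
          ENNReal.ofReal_mul (by positivity), ofReal_measureReal
            measure_closedBall_lt_top.ne, ENNReal.ofReal_pow (p := 2) (by norm_num)]
        rw [mul_comm (volume _)]
        norm_num

theorem IsTaylorGraph.le_measure_closedBall {x : Euc n} {T : Submodule ℝ (Euc n)} {u : T → Euc n}
    {C r : ℝ} (h : IsTaylorGraph M x T u C r) {v : T} {s : ℝ} (hs0 : 0 < s)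
    (hs : ‖v‖ + s ≤ r) :
    ENNReal.ofReal ((s / 2) ^ Module.finrank ℝ T * volume.real (Metric.ball (0 : T) 1)) ≤
      μHE[Module.finrank ℝ T] (M ∩ Metric.closedBall (graphMap x u v) s) := by
  have hsub : Metric.ball v (s / 2) ⊆ Metric.ball 0 r := by
    refine Metric.ball_subset_ball' ?_
    rw [dist_zero_right]
    linarith
  have hv : v ∈ Metric.ball (0 : T) r := hsub (Metric.mem_ball_self (by positivity))
  have h1 : graphMap x u '' (Metric.ball v (s / 2)) ⊆
      M ∩ Metric.closedBall (graphMap x u v) s := by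
    rintro _ ⟨w, hw, rfl⟩
    refine ⟨h.mem w (by simpa using hsub hw), ?_⟩
    have h2 := h.lipschitzOnWith_two.dist_le_mul w (hsub hw) v hv
    have h3 : dist w v < s / 2 := hw
    rw [Metric.mem_closedBall]
    refine h2.trans ?_
    norm_num
    linarith
  refine le_trans ?_ (measure_mono h1)
  refine le_trans (le_of_eq ?_) (h.volume_le_image _)
  rw [← IsTaylorGraph.volume_real_ball T v (by positivity), ofReal_measureReal]

/-- Upper Ahlfors regularity at small scales, uniform by compactness. -/
theorem exists_local_upper_bound (hMc : IsCompact M) (hM : IsSubmanifold 3 d M) :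
    ∃ A ρ : ℝ, 0 ≤ A ∧ 0 < ρ ∧ ∀ y ∈ M, ∀ s, 0 < s → s < ρ →
      μHE[d] (M ∩ Metric.closedBall y s) ≤ ENNReal.ofReal (A * s ^ d) := by
  have := hMc.induction_on (p := fun S => ∃ A ρ : ℝ, 0 ≤ A ∧ 0 < ρ ∧ ∀ y ∈ M, y ∈ S → ∀ s, 0 < s →
    s < ρ → μHE[d] (M ∩ Metric.closedBall y s) ≤ ENNReal.ofReal (A * s ^ d))
    ⟨0, 1, le_rfl, one_pos, by simp⟩ ?_ ?_ ?_
  · obtain ⟨A, ρ, hA, hρ, h⟩ := this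
    exact ⟨A, ρ, hA, hρ, fun y hy => h y hy hy⟩
  · rintro s t hst ⟨A, ρ, hA, hρ, h⟩
    exact ⟨A, ρ, hA, hρ, fun y hy hys => h y hy (hst hys)⟩
  · rintro s t ⟨A, ρ, hA, hρ, h⟩ ⟨A', ρ', hA', hρ', h'⟩
    refine ⟨max A A', min ρ ρ', hA.trans (le_max_left _ _), lt_min hρ hρ', ?_⟩
    rintro y hy (hys | hyt) q hq hqρ
    · refine (h y hy hys q hq (hqρ.trans_le (min_le_left _ _))).trans ?_
      gcongr; exact le_max_left _ _
    · refine (h' y hy hyt q hq (hqρ.trans_le (min_le_right _ _))).trans ?_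
      gcongr; exact le_max_right _ _
  · intro x hx
    obtain ⟨hT, u, C, r, h, -⟩ := exists_isTaylorGraph hM hx
    refine ⟨Metric.ball x (r / 2), nhdsWithin_le_nhds (Metric.ball_mem_nhds x (half_pos h.r_pos)),
      2 ^ d * volume.real (Metric.closedBall (0 : tangentSpace M x) 1), r / 2, by positivity,
      half_pos h.r_pos, fun y hy hyx s hs hsr => ?_⟩
    have := h.measure_closedBall_le (by simpa [dist_eq_norm] using hyx) hs hsr
    rwa [hT] at this

theorem hausdorffMeasure_lt_top (hMc : IsCompact M) (hM : IsSubmanifold 3 d M) :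
    μHE[d] M < ⊤ := by
  obtain ⟨A, ρ, hA, hρ, h⟩ := exists_local_upper_bound hMc hM
  refine hMc.measure_lt_top_of_nhdsWithin fun y hy => ⟨M ∩ Metric.closedBall y (ρ / 2), ?_, ?_⟩
  · exact inter_mem self_mem_nhdsWithin (nhdsWithin_le_nhds (Metric.closedBall_mem_nhds y (half_pos hρ)))
  · exact (h y hy _ (half_pos hρ) (by linarith)).trans_lt ENNReal.ofReal_lt_top

/-- Upper Ahlfors regularity of a compact submanifold at all scales. -/
theorem exists_upper_bound (hMc : IsCompact M) (hM : IsSubmanifold 3 d M) :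
    ∃ A : ℝ, 0 ≤ A ∧ ∀ y ∈ M, ∀ s, 0 < s →
      mass (smoothVarifold d M) (Metric.closedBall y s) ≤ ENNReal.ofReal (A * s ^ d) := by
  obtain ⟨A, ρ, hA, hρ, h⟩ := exists_local_upper_bound hMc hM
  refine ⟨max A (μHE[d].real M / ρ ^ d), le_max_of_le_left hA, fun y hy s hs => ?_⟩
  rw [mass_smoothVarifold hMc hM, Measure.restrict_apply Metric.isClosed_closedBall.measurableSet,
    inter_comm]
  rcases lt_or_ge s ρ with hsρ | hsρ
  · refine (h y hy s hs hsρ).trans ?_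
    gcongr
    exact le_max_left _ _
  · calc μHE[d] (M ∩ Metric.closedBall y s) ≤ μHE[d] M := measure_mono inter_subset_left
      _ = ENNReal.ofReal (μHE[d].real M) :=
        (ofReal_measureReal (hausdorffMeasure_lt_top hMc hM).ne).symm
      _ ≤ _ := by
        refine ENNReal.ofReal_le_ofReal ?_
        calc μHE[d].real M = μHE[d].real M / ρ ^ d * ρ ^ d := by field_simp
          _ ≤ _ := by
            gcongr
            exact le_max_right _ _

theorem isFiniteMeasure_smoothVarifold (hMc : IsCompact M) (hM : IsSubmanifold 3 d M) :
    IsFiniteMeasure (smoothVarifold d M) := by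
  constructor
  have h1 : mass (smoothVarifold d M) univ = smoothVarifold d M univ := by
    rw [mass, Measure.map_apply measurable_fst MeasurableSet.univ, preimage_univ]
  rw [← h1, mass_smoothVarifold hMc hM, Measure.restrict_apply_univ]
  exact hausdorffMeasure_lt_top hMc hM

theorem support_mass_smoothVarifold_subset (hMc : IsCompact M) (hM : IsSubmanifold 3 d M) :
    (mass (smoothVarifold d M)).support ⊆ M := by
  rw [mass_smoothVarifold hMc hM]
  exact Measure.support_subset_of_isClosed hMc.isClosed
    (ae_restrict_mem hMc.measurableSet)

theorem mem_support_mass (hMc : IsCompact M) (hM : IsSubmanifold 3 d M) {x : Euc n} (hx : x ∈ M) :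
    x ∈ (mass (smoothVarifold d M)).support := by
  rw [mass_smoothVarifold hMc hM, Metric.nhds_basis_closedBall.mem_measureSupport]
  intro s hs
  rw [Measure.restrict_apply Metric.isClosed_closedBall.measurableSet, inter_comm]
  obtain ⟨hT, u, C, r, h, -⟩ := exists_isTaylorGraph hM hx
  have h0 : 0 < min s r := lt_min hs h.r_pos
  have := h.le_measure_closedBall (v := 0) h0 (by simp)
  rw [graphMap_zero h.zero, hT] at this
  refine lt_of_lt_of_le ?_ (this.trans (measure_mono (inter_subset_inter_right _
    (Metric.closedBall_subset_closedBall (min_le_left _ _)))))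
  rw [ENNReal.ofReal_pos]
  have : 0 < volume.real (Metric.ball (0 : tangentSpace M x) 1) :=
    ENNReal.toReal_pos (Metric.measure_ball_pos _ _ one_pos).ne' measure_ball_lt_top.ne
  positivity

end SmoothVarifold

end Varifold

/-! ### The distances between varifolds -/

namespace Varifold

variable {n d : ℕ}

theorem prokhorovDist_nonneg (μ ν : Measure (Euc n)) : 0 ≤ prokhorovDist d μ ν :=
  Real.sInf_nonneg fun _ h => h.1.le

/-- The infimum defining `η_d` is over a nonempty upward closed set, so every `δ > η_d` is
admissible. -/
theorem le_of_prokhorovDist_lt (hd : 1 ≤ d) {μ ν : Measure (Euc n)} [IsFiniteMeasure μ]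
    [IsFiniteMeasure ν] {δ : ℝ} (hδ : prokhorovDist d μ ν < δ) (c : Euc n) {r : ℝ} (hr : 0 < r) :
    μ (Metric.closedBall c r) ≤
        ν (Metric.thickening δ (Metric.closedBall c r)) + ENNReal.ofReal (δ ^ d) ∧
    ν (Metric.closedBall c r) ≤
        μ (Metric.thickening δ (Metric.closedBall c r)) + ENNReal.ofReal (δ ^ d) := by
  have hne : {δ : ℝ | 0 < δ ∧ ∀ (c : Euc n) (r : ℝ), 0 < r →
    μ (Metric.closedBall c r) ≤
        ν (Metric.thickening δ (Metric.closedBall c r)) + ENNReal.ofReal (δ ^ d) ∧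
    ν (Metric.closedBall c r) ≤
        μ (Metric.thickening δ (Metric.closedBall c r)) + ENNReal.ofReal (δ ^ d)}.Nonempty := by
    set D := max 1 (max (μ.real univ) (ν.real univ)) with hD
    have hD1 : 1 ≤ D := le_max_left _ _
    have hDd : D ≤ D ^ d := le_self_pow₀ hD1 (by omega)
    refine ⟨D, by positivity, fun c r _ => ⟨?_, ?_⟩⟩
    · calc μ (Metric.closedBall c r) ≤ μ univ := measure_mono (subset_univ _)
        _ = ENNReal.ofReal (μ.real univ) := (ofReal_measureReal).symm
        _ ≤ ENNReal.ofReal (D ^ d) := ENNReal.ofReal_le_ofReal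
          (((le_max_left _ _).trans (le_max_right _ _)).trans hDd)
        _ ≤ _ := le_add_self
    · calc ν (Metric.closedBall c r) ≤ ν univ := measure_mono (subset_univ _)
        _ = ENNReal.ofReal (ν.real univ) := (ofReal_measureReal).symm
        _ ≤ ENNReal.ofReal (D ^ d) := ENNReal.ofReal_le_ofReal
          (((le_max_right _ _).trans (le_max_right _ _)).trans hDd)
        _ ≤ _ := le_add_self
  obtain ⟨δ', ⟨hδ'0, hδ'⟩, hlt⟩ := exists_lt_of_csInf_lt hne hδ
  obtain ⟨h1, h2⟩ := hδ' c r hr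
  have hp : ENNReal.ofReal (δ' ^ d) ≤ ENNReal.ofReal (δ ^ d) := by gcongr
  exact ⟨h1.trans (add_le_add (measure_mono (Metric.thickening_mono hlt.le _)) hp),
    h2.trans (add_le_add (measure_mono (Metric.thickening_mono hlt.le _)) hp)⟩

theorem mass_apply (V : Measure (Euc n × Gr d n)) {A : Set (Euc n)} (hA : MeasurableSet A) :
    mass V A = V (A ×ˢ univ) := by
  rw [mass, Measure.map_apply measurable_fst hA]
  congr 1
  ext p
  simp

instance isFiniteMeasure_mass (V : Measure (Euc n × Gr d n)) [IsFiniteMeasure V] :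
    IsFiniteMeasure (mass V) := by
  rw [mass]; infer_instance

theorem abs_integral_le_of_tsupport {V : Measure (Euc n × Gr d n)} [IsFiniteMeasure V]
    {φ : Euc n × Gr d n → ℝ} {x : Euc n} {r : ℝ} (h1 : ∀ p, |φ p| ≤ 1)
    (h2 : tsupport φ ⊆ Metric.ball x r ×ˢ univ) :
    |∫ p, φ p ∂V| ≤ (mass V).real (Metric.closedBall x r) := by
  have h3 : ∫ p, φ p ∂V = ∫ p in Metric.closedBall x r ×ˢ univ, φ p ∂V := by
    refine (setIntegral_eq_integral_of_forall_compl_eq_zero fun p hp => ?_).symm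
    by_contra hne
    exact hp (prod_mono Metric.ball_subset_closedBall le_rfl (h2 (subset_tsupport _ hne)))
  rw [h3, ← Real.norm_eq_abs]
  refine (norm_setIntegral_le_of_norm_le_const (C := 1) (measure_lt_top _ _)
    (fun p _ => h1 p)).trans (le_of_eq ?_)
  rw [one_mul, Measure.real, Measure.real, mass_apply V Metric.isClosed_closedBall.measurableSet]

/-- The localized distance `δ (V, W)` is finite when `V` is upper Ahlfors regular on its support:
the mass of `W` in a ball is controlled by that of `V` through the Prokhorov distance. -/
theorem varifoldDelta_lt_top (hd : 1 ≤ d) {V W : Measure (Euc n × Gr d n)} [IsFiniteMeasure V]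
    [IsFiniteMeasure W] {A : ℝ} (hA : 0 ≤ A)
    (hV : ∀ y ∈ (mass V).support, ∀ s, 0 < s →
      mass V (Metric.closedBall y s) ≤ ENNReal.ofReal (A * s ^ d)) :
    varifoldDelta V W < ⊤ := by
  set η := prokhorovDist d (mass V) (mass W) with hη
  have hη0 : 0 ≤ η := prokhorovDist_nonneg _ _
  -- Applying `η_d < η_d + r` to the ball of radius `r` gives mass at most `(A + 1) (2 (η_d + r)) ^ d`.
  refine lt_of_le_of_lt (b := ENNReal.ofReal (A + (A + 1) * 2 ^ d)) ?_ ENNReal.ofReal_lt_top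
  refine iSup_le fun y => iSup_le fun hy => iSup_le fun r => iSup_le fun hr => ?_
  rw [← hη]
  refine ENNReal.div_le_of_le_mul ?_
  rw [← ENNReal.ofReal_mul (by positivity)]
  refine iSup_le fun φ => iSup_le fun hφ => ENNReal.ofReal_le_ofReal ?_
  have h1 := abs_integral_le_of_tsupport (V := V) hφ.2.1 hφ.2.2
  have h2 := abs_integral_le_of_tsupport (V := W) hφ.2.1 hφ.2.2
  have h3 : (mass V).real (Metric.closedBall y r) ≤ A * (η + r) ^ d := by
    refine ENNReal.toReal_le_of_le_ofReal (by positivity) ((hV y hy r hr).trans ?_)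
    gcongr
    linarith
  have h4 : (mass W).real (Metric.closedBall y r) ≤ (A + 1) * 2 ^ d * (η + r) ^ d := by
    have hlt : η < η + r := by linarith
    refine ENNReal.toReal_le_of_le_ofReal (by positivity)
      ((le_of_prokhorovDist_lt hd hlt y hr).2.trans ?_)
    have hsub : Metric.thickening (η + r) (Metric.closedBall y r) ⊆
        Metric.closedBall y (2 * (η + r)) := by
      intro p hp
      obtain ⟨q, hq, hpq⟩ := Metric.mem_thickening_iff.1 hp
      rw [Metric.mem_closedBall] at hq ⊢
      have := dist_triangle p q y
      linarith
    calc _ ≤ ENNReal.ofReal (A * (2 * (η + r)) ^ d) + ENNReal.ofReal ((η + r) ^ d) := by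
          gcongr
          exact (measure_mono hsub).trans (hV y hy _ (by positivity))
      _ = ENNReal.ofReal (A * (2 * (η + r)) ^ d + (η + r) ^ d) :=
          (ENNReal.ofReal_add (by positivity) (by positivity)).symm
      _ ≤ _ := by
          refine ENNReal.ofReal_le_ofReal ?_
          have h2d : (1 : ℝ) ≤ 2 ^ d := one_le_pow₀ (by norm_num)
          rw [mul_pow]
          nlinarith [show 0 ≤ (η + r) ^ d by positivity]
  rw [abs_le] at h1 h2
  linarith

/-- Integrals of a vector valued Lipschitz function supported in a ball are compared through
`δ (V, W)`, by testing against the direction of the difference. -/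
theorem norm_integral_sub_le_varifoldDelta {E : Type*} [NormedAddCommGroup E]
    [InnerProductSpace ℝ E] [CompleteSpace E] {V W : Measure (Euc n × Gr d n)}
    [IsFiniteMeasure V] [IsFiniteMeasure W] (hfin : varifoldDelta V W < ⊤) {x : Euc n}
    (hx : x ∈ (mass V).support) {r : ℝ} (hr : 0 < r) {F : Euc n × Gr d n → E} {L : ℝ≥0}
    (hF : LipschitzWith L F) (hFb : ∀ p, ‖F p‖ ≤ L)
    (hsupp : tsupport F ⊆ Metric.ball x r ×ˢ univ) (hFm : StronglyMeasurable F) :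
    ‖∫ p, F p ∂V - ∫ p, F p ∂W‖ ≤
      L * ((varifoldDelta V W).toReal * (prokhorovDist d (mass V) (mass W) + r) ^ d) := by
  set w := ∫ p, F p ∂V - ∫ p, F p ∂W with hw
  set η := prokhorovDist d (mass V) (mass W) with hη
  have hη0 : 0 ≤ η := prokhorovDist_nonneg _ _
  rcases eq_or_ne w 0 with h0 | h0
  · rw [h0, norm_zero]; positivity
  have hw0 : 0 < ‖w‖ := norm_pos_iff.2 h0
  have hFi : ∀ U : Measure (Euc n × Gr d n), IsFiniteMeasure U → Integrable F U := fun U _ =>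
    Integrable.of_bound hFm.aestronglyMeasurable L (ae_of_all _ hFb)
  have hL : 0 < L := by
    by_contra! hL
    have hL0 : L = 0 := le_antisymm hL bot_le
    have : F = 0 := by
      ext1 p
      have := hFb p
      rw [hL0] at this
      simpa using this
    apply h0
    simp [hw, this]
  set φ : Euc n × Gr d n → ℝ := fun p => (L : ℝ)⁻¹ * ‖w‖⁻¹ * inner ℝ w (F p) with hφ
  have hφi : ∀ U : Measure (Euc n × Gr d n), IsFiniteMeasure U →
      ∫ p, φ p ∂U = (L : ℝ)⁻¹ * ‖w‖⁻¹ * inner ℝ w (∫ p, F p ∂U) := fun U hU => by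
    rw [hφ, integral_const_mul, integral_inner (hFi U hU)]
  have hφL : LipschitzWith 1 φ := by
    refine LipschitzWith.of_dist_le_mul fun p q => ?_
    have h1 : φ p - φ q = (L : ℝ)⁻¹ * ‖w‖⁻¹ * inner ℝ w (F p - F q) := by
      simp only [hφ, inner_sub_right]; ring
    rw [Real.dist_eq, h1, abs_mul, abs_of_nonneg (by positivity)]
    have h2 : ‖F p - F q‖ ≤ L * dist p q := by
      rw [← dist_eq_norm]; exact hF.dist_le_mul p q
    calc _ ≤ (L : ℝ)⁻¹ * ‖w‖⁻¹ * (‖w‖ * (L * dist p q)) := by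
          gcongr
          exact (abs_real_inner_le_norm _ _).trans (by gcongr)
      _ = _ := by
          have : (L : ℝ) ≠ 0 := by positivity
          field_simp
          simp
  have hφb : ∀ p, |φ p| ≤ 1 := fun p => by
    rw [hφ]
    simp only
    rw [abs_mul, abs_of_nonneg (by positivity)]
    calc _ ≤ (L : ℝ)⁻¹ * ‖w‖⁻¹ * (‖w‖ * L) := by
          gcongr
          exact (abs_real_inner_le_norm _ _).trans (by gcongr; exact hFb p)
      _ = 1 := by
          have : (L : ℝ) ≠ 0 := by positivity
          field_simp
  have hφs : tsupport φ ⊆ Metric.ball x r ×ˢ univ := by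
    refine (closure_mono ?_).trans hsupp
    intro p hp hF0
    exact hp (by simp [hφ, hF0])
  have h1 : ENNReal.ofReal (∫ p, φ p ∂V - ∫ p, φ p ∂W) ≤
      flatDist (Metric.ball x r ×ˢ univ) V W :=
    le_iSup₂_of_le (f := fun (φ : Euc n × Gr d n → ℝ) (_ : LipschitzWith 1 φ ∧ (∀ p, |φ p| ≤ 1) ∧
      tsupport φ ⊆ Metric.ball x r ×ˢ univ) => ENNReal.ofReal (∫ p, φ p ∂V - ∫ p, φ p ∂W))
      φ ⟨hφL, hφb, hφs⟩ le_rfl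
  have h2 : flatDist (Metric.ball x r ×ˢ univ) V W / ENNReal.ofReal ((η + r) ^ d) ≤
      varifoldDelta V W :=
    le_iSup₂_of_le x hx (le_iSup₂_of_le r hr le_rfl)
  have h3 : ENNReal.ofReal (∫ p, φ p ∂V - ∫ p, φ p ∂W) ≤
      varifoldDelta V W * ENNReal.ofReal ((η + r) ^ d) := by
    refine h1.trans ?_
    rwa [ENNReal.div_le_iff_le_mul (Or.inl (by rw [Ne, ENNReal.ofReal_eq_zero]; push Not; positivity))
      (Or.inl ENNReal.ofReal_ne_top)] at h2
  have h4 : ∫ p, φ p ∂V - ∫ p, φ p ∂W = (L : ℝ)⁻¹ * ‖w‖ := by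
    rw [hφi V inferInstance, hφi W inferInstance, ← mul_sub, ← inner_sub_right, ← hw,
      real_inner_self_eq_norm_sq]
    field_simp
  have h5 : (L : ℝ)⁻¹ * ‖w‖ ≤ (varifoldDelta V W).toReal * (η + r) ^ d := by
    rw [← h4]
    have := ENNReal.toReal_mono (ENNReal.mul_lt_top hfin ENNReal.ofReal_lt_top).ne h3
    rw [ENNReal.toReal_mul, ENNReal.toReal_ofReal (by positivity : 0 ≤ (η + r) ^ d)] at this
    refine le_trans ?_ this
    rw [ENNReal.toReal_ofReal']
    exact le_max_left _ _
  rwa [inv_mul_le_iff₀ (by positivity)] at h5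

end Varifold

/-! ### Kernel profiles and radial moments -/

namespace Varifold

/-- Bounds, with a common constant `L`, on the kernel profiles `k = ρ'` and `ξ`. -/
structure IsKernelBound (n : ℕ) (k ξ : ℝ → ℝ) (L : ℝ≥0) : Prop where
  lip_k : LipschitzWith L k
  lip_xi : LipschitzWith L ξ
  abs_k_le : ∀ s, |k s| ≤ L
  abs_xi_le : ∀ s, |ξ s| ≤ L
  abs_k_le_mul : ∀ s, |k s| ≤ L * |s|
  k_eq_zero : ∀ s, 1 ≤ |s| → k s = 0
  xi_eq_zero : ∀ s, 1 ≤ |s| → ξ s = 0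
  relation : ∀ s, s * k s = -(n * ξ s)

/-- By continuity the function vanishes at `±1` too. -/
theorem eq_zero_of_tsupport_subset {f : ℝ → ℝ} (hf : Continuous f)
    (hs : tsupport f ⊆ Icc (-1) 1) {s : ℝ} (h : 1 ≤ |s|) : f s = 0 := by
  have h1 : ∀ t, 1 < |t| → f t = 0 := fun t ht => by
    by_contra hne
    have := hs (subset_tsupport _ hne)
    rw [mem_Icc, ← abs_le] at this
    linarith
  have hcl : IsClosed {t | f t = 0} := isClosed_eq hf continuous_const
  -- `s` is the limit of `t s` as `t` decreases to `1`.
  have hlim : Tendsto (fun t : ℝ => t * s) (𝓝[>] 1) (𝓝 s) := by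
    have : Continuous fun t : ℝ => t * s := by fun_prop
    simpa using (this.tendsto 1).mono_left nhdsWithin_le_nhds
  refine hcl.mem_of_tendsto hlim ?_
  filter_upwards [self_mem_nhdsWithin] with t ht
  refine h1 _ ?_
  have ht' : (1 : ℝ) < t := ht
  rw [abs_mul, abs_of_pos (by linarith)]
  nlinarith

theorem IsKernelPair.exists_bound {n : ℕ} {ρ ξ : ℝ → ℝ} (h : IsKernelPair n ρ ξ) :
    ∃ L, IsKernelBound n (deriv ρ) ξ L := by
  have hρ1 : ContDiff ℝ 1 (deriv ρ) := (contDiff_infty_iff_deriv.1 h.smooth_rho).2.of_le (by exact_mod_cast le_top)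
  have hsk : tsupport (deriv ρ) ⊆ Icc (-1) 1 :=
    (closure_minimal support_deriv_subset (isClosed_tsupport ρ)).trans h.support_rho
  have hck : HasCompactSupport (deriv ρ) := isCompact_Icc.of_isClosed_subset (isClosed_tsupport _) hsk
  have hcx : HasCompactSupport ξ :=
    isCompact_Icc.of_isClosed_subset (isClosed_tsupport _) h.support_xi
  obtain ⟨L₁, hL₁⟩ := hρ1.lipschitzWith_of_hasCompactSupport hck (by simp)
  obtain ⟨L₂, hL₂⟩ := h.smooth_xi.lipschitzWith_of_hasCompactSupport hcx (by simp)
  obtain ⟨L₃, hL₃⟩ := hcx.exists_bound_of_continuous h.smooth_xi.continuous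
  have hk0 : ∀ s, 1 ≤ |s| → deriv ρ s = 0 := fun s => eq_zero_of_tsupport_subset hρ1.continuous hsk
  have hx0 : ∀ s, 1 ≤ |s| → ξ s = 0 := fun s =>
    eq_zero_of_tsupport_subset h.smooth_xi.continuous h.support_xi
  set L := max (max L₁ L₂) (Real.toNNReal L₃) with hL
  have hLk : LipschitzWith L (deriv ρ) := hL₁.weaken ((le_max_left _ _).trans (le_max_left _ _))
  have hzero : deriv ρ 0 = 0 := by
    have h1 : (fun s => ρ (-s)) = ρ := funext h.even_rho
    have h2 : deriv (fun s => ρ (-s)) 0 = -deriv ρ (-0) := deriv_comp_neg ρ 0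
    rw [h1, neg_zero] at h2
    linarith
  have hmul : ∀ s, |deriv ρ s| ≤ L * |s| := fun s => by
    have := hLk.dist_le_mul s 0
    simpa [Real.dist_eq, hzero] using this
  refine ⟨L, hLk, hL₂.weaken ((le_max_right _ _).trans (le_max_left _ _)), fun s => ?_,
    fun s => ?_, hmul, hk0, hx0, fun s => ?_⟩
  · rcases le_or_gt 1 |s| with hs | hs
    · simp [hk0 s hs]
    · exact (hmul s).trans (mul_le_of_le_one_right L.2 hs.le)
  · refine (hL₃ s).trans ((Real.le_coe_toNNReal L₃).trans ?_)
    exact_mod_cast le_max_right _ _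
  · rcases le_or_gt 1 |s| with hs | hs
    · simp [hk0 s hs, hx0 s hs]
    · have := h.relation s (abs_lt.1 hs)
      linarith

section Moments

variable {T E : Type*} [NormedAddCommGroup T] [InnerProductSpace ℝ T] [FiniteDimensional ℝ T]
  [MeasurableSpace T] [BorelSpace T] [NormedAddCommGroup E] [NormedSpace ℝ E]

theorem integral_radial_smul_self (κ : ℝ → ℝ) (A : T →L[ℝ] E) : ∫ v : T, κ ‖v‖ • A v = 0 := by
  have h1 := integral_neg_eq_self (fun v : T => κ ‖v‖ • A v) volume
  simp only [norm_neg, map_neg, smul_neg, integral_neg] at h1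
  have h2 : (2 : ℝ) • ∫ v : T, κ ‖v‖ • A v = 0 := by
    rw [two_smul, add_eq_zero_iff_eq_neg]
    exact h1.symm
  simpa using h2

theorem integral_radial_inner_isometry (κ : ℝ → ℝ) (R : T ≃ₗᵢ[ℝ] T) (a b : T) :
    ∫ v : T, κ ‖v‖ * (inner ℝ (R a) v * inner ℝ (R b) v) =
      ∫ v : T, κ ‖v‖ * (inner ℝ a v * inner ℝ b v) := by
  have := R.measurePreserving.integral_comp R.toHomeomorph.measurableEmbedding
    (fun v : T => κ ‖v‖ * (inner ℝ (R a) v * inner ℝ (R b) v))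
  rw [← this]
  simp [LinearIsometryEquiv.inner_map_map]

/-- Second moments of a radial density, by invariance under reflections. -/
theorem integral_radial_quadratic [CompleteSpace E] {ι : Type*} [Fintype ι] (b : OrthonormalBasis ι ℝ T)
    (κ : ℝ → ℝ) (hκ : AEStronglyMeasurable (fun v : T => κ ‖v‖))
    (hint : Integrable (fun v : T => κ ‖v‖ * ‖v‖ ^ 2)) (B : T →L[ℝ] T →L[ℝ] E) :
    ∫ v : T, κ ‖v‖ • B v v =
      ((Module.finrank ℝ T : ℝ)⁻¹ * ∫ v : T, κ ‖v‖ * ‖v‖ ^ 2) • ∑ i, B (b i) (b i) := by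
  classical
  set I : ι → ι → ℝ := fun i j => ∫ v : T, κ ‖v‖ * (inner ℝ (b i) v * inner ℝ (b j) v) with hI
  have hint2 : ∀ i j, Integrable (fun v : T => κ ‖v‖ * (inner ℝ (b i) v * inner ℝ (b j) v)) := by
    intro i j
    refine hint.mono (hκ.mul (Continuous.aestronglyMeasurable (by fun_prop)))
      (ae_of_all _ fun v => ?_)
    simp only [norm_mul, norm_norm, sq]
    have hb : ∀ i, ‖inner ℝ (b i) v‖ ≤ ‖v‖ := fun i => by
      simpa using norm_inner_le_norm (𝕜 := ℝ) (b i) v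
    gcongr
    · exact hb i
    · exact hb j
  have hoff : ∀ i j, i ≠ j → I i j = 0 := by
    intro i j hij
    have h1 := integral_radial_inner_isometry κ (ℝ ∙ (b i))ᗮ.reflection (b i) (b j)
    have h2 : (ℝ ∙ (b i))ᗮ.reflection (b i) = -b i :=
      Submodule.reflection_orthogonalComplement_singleton_eq_neg _
    have h3 : (ℝ ∙ (b i))ᗮ.reflection (b j) = b j :=
      Submodule.reflection_mem_subspace_eq_self
        (Submodule.mem_orthogonal_singleton_iff_inner_right.2 (b.orthonormal.2 hij))
    rw [h2, h3] at h1
    simp only [inner_neg_left, neg_mul, mul_neg, integral_neg] at h1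
    exact self_eq_neg.1 h1.symm
  have hdiag : ∀ i j, I i i = I j j := by
    intro i j
    have h1 := integral_radial_inner_isometry κ (ℝ ∙ (b i - b j))ᗮ.reflection (b i) (b i)
    have h2 : (ℝ ∙ (b i - b j))ᗮ.reflection (b i) = b j :=
      Submodule.reflection_sub (by simp)
    rw [h2] at h1
    exact h1.symm
  have hsum : ∑ i, I i i = ∫ v : T, κ ‖v‖ * ‖v‖ ^ 2 := by
    rw [← integral_finsetSum _ fun i _ => hint2 i i]
    refine integral_congr_ae (ae_of_all _ fun v => ?_)
    simp only
    rw [← Finset.mul_sum, ← b.sum_sq_norm_inner_right v]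
    simp [sq]
  have hIi : ∀ i, I i i = (Module.finrank ℝ T : ℝ)⁻¹ * ∫ v : T, κ ‖v‖ * ‖v‖ ^ 2 := by
    intro i
    rw [← hsum, Finset.sum_congr rfl fun j _ => hdiag j i, Finset.sum_const, nsmul_eq_mul,
      Finset.card_univ, ← Module.finrank_eq_card_basis b.toBasis, ← mul_assoc, inv_mul_cancel₀,
      one_mul]
    have : Nonempty ι := ⟨i⟩
    rw [Module.finrank_eq_card_basis b.toBasis]
    exact_mod_cast Fintype.card_ne_zero
  have hexp : ∀ v : T, κ ‖v‖ • B v v = ∑ i, ∑ j,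
      (κ ‖v‖ * (inner ℝ (b i) v * inner ℝ (b j) v)) • B (b i) (b j) := by
    intro v
    have h1 : B v v = ∑ i, (inner ℝ (b i) v : ℝ) • B (b i) v := by
      have := congrArg (fun w => B w v) (b.sum_repr' v).symm
      simpa only [map_sum, map_smul, sum_apply, smul_apply] using this
    have h2 : ∀ i, B (b i) v = ∑ j, (inner ℝ (b j) v : ℝ) • B (b i) (b j) := fun i => by
      have := congrArg (fun w => B (b i) w) (b.sum_repr' v).symm
      simpa only [map_sum, map_smul] using this
    rw [h1]
    simp only [h2, Finset.smul_sum, smul_smul]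
  simp_rw [hexp]
  rw [integral_finsetSum _ fun i _ => integrable_finsetSum _ fun j _ => (hint2 i j).smul_const _]
  have : ∀ i, ∫ v : T, ∑ j, (κ ‖v‖ * (inner ℝ (b i) v * inner ℝ (b j) v)) • B (b i) (b j) =
      I i i • B (b i) (b i) := by
    intro i
    rw [integral_finsetSum _ fun j _ => (hint2 i j).smul_const _]
    rw [Finset.sum_eq_single i]
    · rw [integral_smul_const]
    · intro j _ hj
      rw [integral_smul_const]
      have := hoff i j hj.symm
      simp only [hI] at this
      rw [this, zero_smul]
    · simp
  simp_rw [this, hIi]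
  rw [Finset.smul_sum]

end Moments

end Varifold

/-! ### The integrand of the first variation -/

namespace Varifold

variable {n d : ℕ}

/-- The radial vector field `k (|w| / ε) w / |w|`. -/
noncomputable def radialField (k : ℝ → ℝ) (ε : ℝ) (w : Euc n) : Euc n := (k (‖w‖ / ε) * ‖w‖⁻¹) • w

section RadialField

variable {k ξ : ℝ → ℝ} {L : ℝ≥0}

theorem norm_radialField (k : ℝ → ℝ) (ε : ℝ) {w : Euc n} (hw : w ≠ 0) :
    ‖radialField k ε w‖ = |k (‖w‖ / ε)| := by
  have : ‖w‖ ≠ 0 := norm_ne_zero_iff.2 hw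
  rw [radialField, norm_smul, norm_mul, norm_inv, norm_norm, Real.norm_eq_abs]
  field_simp

theorem norm_radialField_le (h : IsKernelBound n k ξ L) (ε : ℝ) (w : Euc n) :
    ‖radialField k ε w‖ ≤ L := by
  rcases eq_or_ne w 0 with rfl | hw
  · simp [radialField]
  · rw [norm_radialField k ε hw]
    exact h.abs_k_le _

theorem radialField_eq_zero (h : IsKernelBound n k ξ L) {ε : ℝ} (hε : 0 < ε) {w : Euc n}
    (hw : ε ≤ ‖w‖) : radialField k ε w = 0 := by
  rw [radialField, h.k_eq_zero, zero_mul, zero_smul]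
  rwa [abs_of_nonneg (by positivity), one_le_div hε]

/-- The radial field has Lipschitz constant `3 L / ε`, also near its apparent singularity at `0`,
because `|k s| ≤ L |s|`. -/
theorem norm_radialField_sub_le (h : IsKernelBound n k ξ L) {ε : ℝ} (hε : 0 < ε)
    (w w' : Euc n) : ‖radialField k ε w - radialField k ε w'‖ ≤ 3 * L / ε * ‖w - w'‖ := by
  rcases eq_or_ne w' 0 with rfl | hw'
  · rcases eq_or_ne w 0 with rfl | hw
    · simp
    have h0 : radialField k ε (0 : Euc n) = 0 := by simp [radialField]
    rw [h0, sub_zero, sub_zero, norm_radialField k ε hw]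
    refine (h.abs_k_le_mul _).trans ?_
    rw [abs_of_nonneg (by positivity)]
    have : 0 ≤ L * ‖w‖ / ε := by positivity
    calc L * (‖w‖ / ε) = L * ‖w‖ / ε := by ring
      _ ≤ 3 * (L * ‖w‖ / ε) := by linarith
      _ = _ := by ring
  rcases eq_or_ne w 0 with rfl | hw
  · have h0 : radialField k ε (0 : Euc n) = 0 := by simp [radialField]
    rw [h0, zero_sub, norm_neg, zero_sub, norm_neg, norm_radialField k ε hw']
    refine (h.abs_k_le_mul _).trans ?_
    rw [abs_of_nonneg (by positivity)]
    have : 0 ≤ L * ‖w'‖ / ε := by positivity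
    calc L * (‖w'‖ / ε) = L * ‖w'‖ / ε := by ring
      _ ≤ 3 * (L * ‖w'‖ / ε) := by linarith
      _ = _ := by ring
  have hn : 0 < ‖w‖ := norm_pos_iff.2 hw
  have hn' : 0 < ‖w'‖ := norm_pos_iff.2 hw'
  have hnn : |‖w‖ - ‖w'‖| ≤ ‖w - w'‖ := abs_norm_sub_norm_le w w'
  have hsplit : radialField k ε w - radialField k ε w' =
      ((k (‖w‖ / ε) - k (‖w'‖ / ε)) * ‖w‖⁻¹) • w +
        (k (‖w'‖ / ε) * ‖w'‖⁻¹) • ((‖w'‖ * ‖w‖⁻¹ - 1) • w + (w - w')) := by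
    have : ‖w'‖ ≠ 0 := hn'.ne'
    simp only [radialField, smul_add, smul_smul, smul_sub]
    have e : k (‖w'‖ / ε) * ‖w'‖⁻¹ * (‖w'‖ * ‖w‖⁻¹ - 1) =
        k (‖w'‖ / ε) * ‖w‖⁻¹ - k (‖w'‖ / ε) * ‖w'‖⁻¹ := by
      field_simp
    rw [e]
    module
  have h1 : ‖((k (‖w‖ / ε) - k (‖w'‖ / ε)) * ‖w‖⁻¹) • w‖ ≤ L / ε * ‖w - w'‖ := by
    rw [norm_smul, norm_mul, norm_inv, norm_norm, mul_assoc, inv_mul_cancel₀ hn.ne', mul_one]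
    have := h.lip_k.dist_le_mul (‖w‖ / ε) (‖w'‖ / ε)
    rw [Real.dist_eq, Real.dist_eq, ← sub_div, abs_div, abs_of_pos hε] at this
    calc _ ≤ _ := this
      _ ≤ L * (‖w - w'‖ / ε) := by gcongr
      _ = _ := by ring
  have h2 : ‖(‖w'‖ * ‖w‖⁻¹ - 1) • w + (w - w')‖ ≤ 2 * ‖w - w'‖ := by
    have : ‖(‖w'‖ * ‖w‖⁻¹ - 1) • w‖ ≤ ‖w - w'‖ := by
      have e : ‖w'‖ * ‖w‖⁻¹ - 1 = (‖w'‖ - ‖w‖) * ‖w‖⁻¹ := by field_simp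
      rw [e, norm_smul, norm_mul, norm_inv, norm_norm, mul_assoc, inv_mul_cancel₀ hn.ne', mul_one,
        Real.norm_eq_abs, abs_sub_comm]
      exact hnn
    have := norm_add_le ((‖w'‖ * ‖w‖⁻¹ - 1) • w) (w - w')
    linarith
  have h3 : ‖k (‖w'‖ / ε) * ‖w'‖⁻¹‖ ≤ L / ε := by
    rw [norm_mul, norm_inv, norm_norm, Real.norm_eq_abs]
    have := h.abs_k_le_mul (‖w'‖ / ε)
    rw [abs_of_nonneg (by positivity : 0 ≤ ‖w'‖ / ε)] at this
    calc _ ≤ L * (‖w'‖ / ε) * ‖w'‖⁻¹ := by gcongr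
      _ = _ := by field_simp
  rw [hsplit]
  calc _ ≤ L / ε * ‖w - w'‖ + L / ε * (2 * ‖w - w'‖) := by
        refine (norm_add_le _ _).trans (add_le_add h1 ?_)
        rw [norm_smul]
        gcongr
    _ = _ := by ring

theorem continuous_radialField (h : IsKernelBound n k ξ L) {ε : ℝ} (hε : 0 < ε) :
    Continuous (radialField (n := n) k ε) := by
  refine (LipschitzWith.of_dist_le_mul (K := Real.toNNReal (3 * L / ε)) fun w w' => ?_).continuous
  rw [dist_eq_norm, dist_eq_norm, Real.coe_toNNReal _ (by positivity)]
  exact norm_radialField_sub_le h hε w w'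

end RadialField

/-- What the six operators have in common, as functions `Q` of the projector `Π_S`: at a point
`v + w` of a graph over `T` whose tangent plane has direction `v + z` over `v`, they give the same
normal component to second order. Indeed `z = 2 w` up to third order, so that `b w + c z` equals
`(b / 2 + c) z = z` up to third order. -/
structure IsAdmissible (T : Submodule ℝ (Euc n))
    (Q : (Euc n →L[ℝ] Euc n) → (Euc n →L[ℝ] Euc n)) (a b c : ℝ) : Prop where
  abs_a_le : |a| ≤ 2
  abs_b_le : |b| ≤ 2
  abs_c_le : |c| ≤ 2
  half_add : b / 2 + c = 1
  lip : ∀ A A', ‖Q A - Q A'‖ ≤ 2 * ‖A - A'‖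
  bound : ∀ S : Submodule ℝ (Euc n), ‖Q S.starProjection‖ ≤ 2
  expand : ∀ (A : Euc n →L[ℝ] Euc n) (v w z : Euc n), v ∈ T → w ∈ Tᗮ → z ∈ Tᗮ →
    ‖Q A (v + w) - (a • v + b • w + c • z)‖ ≤ 2 * ‖A (v + w) - (v + z)‖

theorem norm_two_smul_id_le : ‖(2 : ℝ) • ContinuousLinearMap.id ℝ (Euc n)‖ ≤ 2 := by
  rw [norm_smul]
  calc ‖(2 : ℝ)‖ * ‖ContinuousLinearMap.id ℝ (Euc n)‖ ≤ ‖(2 : ℝ)‖ * 1 := by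
        gcongr; exact ContinuousLinearMap.norm_id_le
    _ = 2 := by norm_num

theorem IsAdmissible.normal_comp {T : Submodule ℝ (Euc n)}
    {Q : (Euc n →L[ℝ] Euc n) → (Euc n →L[ℝ] Euc n)} {a b c : ℝ} (h : IsAdmissible T Q a b c) :
    IsAdmissible T (fun A => Tᗮ.starProjection ∘L Q A) 0 b c := by
  have hN : ∀ w, ‖Tᗮ.starProjection w‖ ≤ ‖w‖ := Submodule.norm_starProjection_apply_le _
  have hN' : ‖Tᗮ.starProjection‖ ≤ 1 := Submodule.starProjection_norm_le _
  refine ⟨by simp, h.abs_b_le, h.abs_c_le, h.half_add, fun A A' => ?_, fun S => ?_,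
    fun A v w z hv hw hz => ?_⟩
  · rw [← ContinuousLinearMap.comp_sub]
    exact ((ContinuousLinearMap.opNorm_comp_le _ _).trans
      (mul_le_of_le_one_left (norm_nonneg _) hN')).trans (h.lip A A')
  · exact ((ContinuousLinearMap.opNorm_comp_le _ _).trans
      (mul_le_of_le_one_left (norm_nonneg _) hN')).trans (h.bound S)
  · have hv0 : Tᗮ.starProjection v = 0 := by
      rw [Submodule.starProjection_apply_eq_zero_iff, Submodule.orthogonal_orthogonal]
      exact hv
    have hw0 : Tᗮ.starProjection w = w := Submodule.starProjection_eq_self_iff.2 hw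
    have hz0 : Tᗮ.starProjection z = z := Submodule.starProjection_eq_self_iff.2 hz
    have e : (Tᗮ.starProjection ∘L Q A) (v + w) - ((0 : ℝ) • v + b • w + c • z) =
        Tᗮ.starProjection (Q A (v + w) - (a • v + b • w + c • z)) := by
      simp only [ContinuousLinearMap.comp_apply, map_sub, map_add, map_smul, hv0, hw0, hz0,
        smul_zero, zero_smul]
    rw [e]
    exact (hN _).trans (h.expand A v w z hv hw hz)

theorem isAdmissible_id (T : Submodule ℝ (Euc n)) : IsAdmissible T id 1 0 1 where
  abs_a_le := by norm_num
  abs_b_le := by norm_num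
  abs_c_le := by norm_num
  half_add := by norm_num
  lip A A' := by have := norm_nonneg (A - A'); simp only [id]; linarith
  bound S := (Submodule.starProjection_norm_le S).trans (by norm_num)
  expand A v w z _ _ _ := by
    have := norm_nonneg (A (v + w) - (v + z))
    simp only [id, one_smul, zero_smul, add_zero]
    linarith

theorem isAdmissible_orth (T : Submodule ℝ (Euc n)) :
    IsAdmissible T (fun A => (-2 : ℝ) • (ContinuousLinearMap.id ℝ (Euc n) - A)) 0 (-2) 2 where
  abs_a_le := by norm_num
  abs_b_le := by norm_num
  abs_c_le := by norm_num
  half_add := by norm_num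
  lip A A' := by
    have e : (-2 : ℝ) • (ContinuousLinearMap.id ℝ (Euc n) - A) -
        (-2 : ℝ) • (ContinuousLinearMap.id ℝ (Euc n) - A') = (2 : ℝ) • (A - A') := by module
    rw [e, norm_smul]
    norm_num
  bound S := by
    rw [← Submodule.starProjection_orthogonal, norm_smul]
    have := Submodule.starProjection_norm_le Sᗮ
    norm_num
    linarith
  expand A v w z _ _ _ := by
    have e : ((-2 : ℝ) • (ContinuousLinearMap.id ℝ (Euc n) - A)) (v + w) -
        ((0 : ℝ) • v + (-2 : ℝ) • w + (2 : ℝ) • z) = (2 : ℝ) • (A (v + w) - (v + z)) := by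
      simp only [smul_apply, sub_apply, ContinuousLinearMap.id_apply]
      module
    rw [e, norm_smul]
    norm_num

theorem isAdmissible_const (T : Submodule ℝ (Euc n)) :
    IsAdmissible T (fun _ => (2 : ℝ) • ContinuousLinearMap.id ℝ (Euc n)) 2 2 0 where
  abs_a_le := by norm_num
  abs_b_le := by norm_num
  abs_c_le := by norm_num
  half_add := by norm_num
  lip A A' := by simp
  bound S := norm_two_smul_id_le
  expand A v w z _ _ _ := by simp

theorem exists_isAdmissible {M : Set (Euc n)} {x : Euc n} {P : Gr d n → (Euc n →L[ℝ] Euc n)}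
    (hP : P ∈ admissibleOperators d M x) :
    ∃ Q a b c, IsAdmissible (tangentSpace M x) Q a b c ∧ ∀ S, P S = Q S.proj := by
  have hproj : ∀ S : Gr d n, S.projOrth = ContinuousLinearMap.id ℝ (Euc n) - S.proj := fun S =>
    Submodule.starProjection_orthogonal _
  simp only [admissibleOperators, mem_insert_iff, mem_singleton_iff] at hP
  rcases hP with rfl | rfl | rfl | rfl | rfl | rfl
  · exact ⟨_, _, _, _, isAdmissible_id _, fun S => rfl⟩
  · exact ⟨_, _, _, _, isAdmissible_orth _, fun S => by simp only [hproj]⟩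
  · exact ⟨_, _, _, _, isAdmissible_const _, fun S => rfl⟩
  · exact ⟨_, _, _, _, (isAdmissible_id _).normal_comp, fun S => rfl⟩
  · exact ⟨_, _, _, _, (isAdmissible_orth _).normal_comp, fun S => by
      simp only [hproj, ContinuousLinearMap.comp_smul]⟩
  · exact ⟨_, _, _, _, (isAdmissible_const _).normal_comp, fun S => by
      rw [ContinuousLinearMap.comp_smul, ContinuousLinearMap.comp_id]⟩

namespace IsAdmissible

variable {T : Submodule ℝ (Euc n)} {Q : (Euc n →L[ℝ] Euc n) → (Euc n →L[ℝ] Euc n)} {a b c : ℝ}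
  {k ξ : ℝ → ℝ} {L : ℝ≥0}

theorem continuous (h : IsAdmissible T Q a b c) : Continuous Q := by
  refine (LipschitzWith.of_dist_le_mul (K := 2) fun A A' => ?_).continuous
  simpa [dist_eq_norm] using h.lip A A'

theorem continuous_integrand (h : IsAdmissible T Q a b c) (hk : IsKernelBound n k ξ L) {ε : ℝ}
    (hε : 0 < ε) (z : Euc n) :
    Continuous fun p : Euc n × (Euc n →L[ℝ] Euc n) => Q p.2 (radialField k ε (p.1 - z)) :=
  (h.continuous.comp continuous_snd).clm_apply
    ((continuous_radialField hk hε).comp (continuous_fst.sub continuous_const))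

theorem lipschitzWith_integrand (h : IsAdmissible T Q a b c) (hk : IsKernelBound n k ξ L) {ε : ℝ}
    (hε : 0 < ε) (hε1 : ε < 1) (z : Euc n) :
    LipschitzWith (Real.toNNReal (8 * L / ε))
      fun p : Euc n × Gr d n => Q p.2.proj (radialField k ε (p.1 - z)) := by
  refine LipschitzWith.of_dist_le_mul fun p q => ?_
  rw [Real.coe_toNNReal _ (by positivity), dist_eq_norm]
  have h1 : ‖p.1 - q.1‖ ≤ dist p q := by rw [← dist_eq_norm]; exact le_max_left _ _
  have h2 : ‖p.2.proj - q.2.proj‖ ≤ dist p q := by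
    rw [← dist_eq_norm]; exact le_max_right _ _
  have h3 := norm_radialField_sub_le hk hε (p.1 - z) (q.1 - z)
  rw [sub_sub_sub_cancel_right] at h3
  have e : Q p.2.proj (radialField k ε (p.1 - z)) - Q q.2.proj (radialField k ε (q.1 - z)) =
      Q p.2.proj (radialField k ε (p.1 - z) - radialField k ε (q.1 - z)) +
        (Q p.2.proj - Q q.2.proj) (radialField k ε (q.1 - z)) := by
    rw [map_sub, sub_apply]; abel
  have hLε : (L : ℝ) ≤ L / ε := by
    rw [le_div_iff₀ hε]
    exact mul_le_of_le_one_right L.2 hε1.le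
  rw [e]
  calc _ ≤ 2 * (3 * L / ε * dist p q) + 2 * dist p q * L := by
        refine (norm_add_le _ _).trans (add_le_add ?_ ?_)
        · refine (ContinuousLinearMap.le_opNorm _ _).trans ?_
          exact mul_le_mul (h.bound _) (h3.trans (by gcongr)) (norm_nonneg _) (by norm_num)
        · refine (ContinuousLinearMap.le_opNorm _ _).trans ?_
          exact mul_le_mul ((h.lip _ _).trans (by gcongr)) (norm_radialField_le hk _ _)
            (norm_nonneg _) (by positivity)
    _ ≤ 2 * (3 * L / ε * dist p q) + 2 * dist p q * (L / ε) := by gcongr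
    _ = _ := by ring

theorem norm_integrand_le (h : IsAdmissible T Q a b c) (hk : IsKernelBound n k ξ L) {ε : ℝ}
    (hε : 0 < ε) (hε1 : ε < 1) (z : Euc n) (p : Euc n × Gr d n) :
    ‖Q p.2.proj (radialField k ε (p.1 - z))‖ ≤ Real.toNNReal (8 * L / ε) := by
  rw [Real.coe_toNNReal _ (by positivity)]
  have hLε : (L : ℝ) ≤ L / ε := by
    rw [le_div_iff₀ hε]
    exact mul_le_of_le_one_right L.2 hε1.le
  have h0 : 0 ≤ (L : ℝ) / ε := by positivity
  calc _ ≤ 2 * (L : ℝ) := by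
        refine (ContinuousLinearMap.le_opNorm _ _).trans ?_
        exact mul_le_mul (h.bound _) (norm_radialField_le hk _ _) (norm_nonneg _) (by norm_num)
    _ ≤ 8 * (L / ε) := by linarith
    _ = _ := by ring

/-- On a graph over `T`, an admissible operator sends `y - x` to `a v + D²u(0)(v, v)` up to a
cubic error. -/
theorem norm_apply_sub_le {M : Set (Euc n)} {x : Euc n} {u : T → Euc n} {C r : ℝ}
    (h : IsAdmissible T Q a b c) (hg : IsTaylorGraph M x T u C r) {v : T} (hv : ‖v‖ < r) :
    ‖Q (tangentSpace M (graphMap x u v)).starProjection (graphMap x u v - x) -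
      (a • (v : Euc n) + fderiv ℝ (fderiv ℝ u) 0 v v)‖ ≤ 8 * C ^ 2 * ‖v‖ ^ 3 := by
  set D := fderiv ℝ u v with hD
  set B := fderiv ℝ (fderiv ℝ u) 0 v v with hB
  have hC := hg.one_le
  have hC0 : 0 ≤ C := zero_le_one.trans hC
  have e1 : graphMap x u v - x = v + u v := by simp [graphMap, add_assoc]
  have hDn := hg.fderiv_mem v hv
  have h1 := h.expand (graphPlane D).starProjection v (u v) (D v) v.2 (hg.normal v) (hDn v)
  have h2 := norm_graphPlane_proj_sub_le hDn v (hg.normal v)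
  rw [hg.tangent v hv, e1]
  have h3 : ‖D v‖ ≤ C * ‖v‖ ^ 2 := by
    refine (D.le_opNorm v).trans ?_
    calc ‖D‖ * ‖v‖ ≤ C * ‖v‖ * ‖v‖ := by gcongr; exact hg.norm_fderiv v hv
      _ = _ := by ring
  have h4 : ‖(graphPlane D).starProjection (v + u v) - (v + D v)‖ ≤ 2 * C ^ 2 * ‖v‖ ^ 3 := by
    refine h2.trans ?_
    calc ‖D‖ * ‖u v - D v‖ ≤ (C * ‖v‖) * (C * ‖v‖ ^ 2 + C * ‖v‖ ^ 2) := by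
          gcongr
          · exact hg.norm_fderiv v hv
          · exact (norm_sub_le _ _).trans (add_le_add (hg.norm_le v hv) h3)
      _ = _ := by ring
  have e2 : Q (graphPlane D).starProjection (v + u v) - (a • (v : Euc n) + B) =
      (Q (graphPlane D).starProjection (v + u v) - (a • (v : Euc n) + b • u v + c • D v)) +
        (b • (u v - (1 / 2 : ℝ) • B) + c • (D v - B)) := by
    have : B = (b / 2 + c) • B := by rw [h.half_add, one_smul]
    conv_lhs => rw [this]
    module
  have h5 := hg.norm_sub v hv
  have h6 := hg.norm_fderiv_sub v hv
  have hv3 : 0 ≤ C * ‖v‖ ^ 3 := by positivity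
  have hCC : C * ‖v‖ ^ 3 ≤ C ^ 2 * ‖v‖ ^ 3 := by
    gcongr
    nlinarith
  rw [e2]
  calc _ ≤ 2 * (2 * C ^ 2 * ‖v‖ ^ 3) + (2 * (C * ‖v‖ ^ 3) + 2 * (C * ‖v‖ ^ 3)) := by
        refine (norm_add_le _ _).trans (add_le_add (h1.trans (by gcongr)) ?_)
        refine (norm_add_le _ _).trans (add_le_add ?_ ?_)
        · rw [norm_smul]
          exact mul_le_mul h.abs_b_le h5 (norm_nonneg _) (by norm_num)
        · rw [norm_smul]
          exact mul_le_mul h.abs_c_le h6 (norm_nonneg _) (by norm_num)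
    _ ≤ _ := by linarith

end IsAdmissible

/-- Distances to `x` on the graph agree with those in `T` up to a cubic error, not just a quadratic
one, since `u` is normal. -/
theorem IsTaylorGraph.norm_graphMap_sub {M : Set (Euc n)} {x : Euc n} {T : Submodule ℝ (Euc n)}
    {u : T → Euc n} {C r : ℝ} (h : IsTaylorGraph M x T u C r) {v : T} (hv : ‖v‖ < r) :
    ‖v‖ ≤ ‖graphMap x u v - x‖ ∧ ‖graphMap x u v - x‖ ≤ ‖v‖ + C ^ 2 * ‖v‖ ^ 3 := by
  have e1 : graphMap x u v - x = v + u v := by simp [graphMap, add_assoc]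
  have hC0 : 0 ≤ C := zero_le_one.trans h.one_le
  rw [e1]
  refine ⟨norm_le_norm_add_of_mem_orthogonal v (h.normal v), ?_⟩
  have h1 : inner ℝ (v : Euc n) (u v) = 0 := h.normal v v v.2
  have h2 := norm_add_sq_eq_norm_sq_add_norm_sq_real h1
  have h3 : ‖(v : Euc n)‖ = ‖v‖ := rfl
  have h4 := h.norm_le v hv
  have h5 : ‖u v‖ * ‖u v‖ ≤ (C * ‖v‖ ^ 2) * (C * ‖v‖ ^ 2) := by gcongr
  refine abs_le_of_sq_le_sq' ?_ (by positivity) |>.2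
  have h6 : 0 ≤ (C ^ 2 * ‖v‖ ^ 3) ^ 2 := by positivity
  have h7 : 0 ≤ C ^ 2 * ‖v‖ ^ 4 := by positivity
  rw [h3] at h2
  calc ‖(v : Euc n) + u v‖ ^ 2 ≤ ‖v‖ ^ 2 + C ^ 2 * ‖v‖ ^ 4 := by
        rw [sq, h2, sq]; nlinarith
    _ ≤ ‖v‖ ^ 2 + 2 * (C ^ 2 * ‖v‖ ^ 4) + (C ^ 2 * ‖v‖ ^ 3) ^ 2 := by linarith
    _ = _ := by ring

end Varifold

/-! ### Expansion at a point of the submanifold -/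

namespace Varifold

section TangentIntegrals

variable {n : ℕ} {T E : Type*}

theorem integrable_of_bound_of_support [NormedAddCommGroup T]
    [InnerProductSpace ℝ T] [FiniteDimensional ℝ T] [MeasurableSpace T] [BorelSpace T]
    [NormedAddCommGroup E] {f : T → E} (hf : AEStronglyMeasurable f) {ε a : ℝ}
    (hb : ∀ v, ‖f v‖ ≤ a) (hs : ∀ v, ε ≤ ‖v‖ → f v = 0) : Integrable f := by
  have hsub : Function.support f ⊆ Metric.ball 0 ε := by
    intro v hv
    by_contra hlt
    exact hv (hs v (by simpa using hlt))
  rw [← integrableOn_iff_integrable_of_support_subset hsub]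
  have : IsFiniteMeasure ((volume : Measure T).restrict (Metric.ball 0 ε)) :=
    ⟨by rw [Measure.restrict_apply_univ]; exact measure_ball_lt_top⟩
  exact Integrable.of_bound hf.restrict a (ae_of_all _ hb)

section Normed

variable [NormedAddCommGroup T] {k ξ : ℝ → ℝ} {L : ℝ≥0}

theorem IsKernelBound.scaled_eq_zero (h : IsKernelBound n k ξ L) {ε : ℝ} (hε : 0 < ε) {t : ℝ}
    (ht : ε ≤ t) : k (t / ε) = 0 ∧ ξ (t / ε) = 0 := by
  have : 1 ≤ |t / ε| := by
    rw [abs_of_nonneg (div_nonneg (hε.le.trans ht) hε.le), one_le_div hε]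
    exact ht
  exact ⟨h.k_eq_zero _ this, h.xi_eq_zero _ this⟩

theorem IsKernelBound.abs_quotient_le (h : IsKernelBound n k ξ L) {ε : ℝ} (hε : 0 < ε) (v : T) :
    |k (‖v‖ / ε) * ‖v‖⁻¹| ≤ L / ε := by
  have h1 := h.abs_k_le_mul (‖v‖ / ε)
  rw [abs_of_nonneg (by positivity : 0 ≤ ‖v‖ / ε)] at h1
  rw [abs_mul, abs_of_nonneg (by positivity : 0 ≤ ‖v‖⁻¹)]
  rcases eq_or_ne ‖v‖ 0 with h0 | h0
  · rw [h0, inv_zero, mul_zero]; positivity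
  · calc _ ≤ L * (‖v‖ / ε) * ‖v‖⁻¹ := by gcongr
      _ = _ := by field_simp

theorem IsKernelBound.quotient_mul_sq (h : IsKernelBound n k ξ L) {ε : ℝ} (hε : 0 < ε) (v : T) :
    k (‖v‖ / ε) * ‖v‖⁻¹ * ‖v‖ ^ 2 = -(n * ε) * ξ (‖v‖ / ε) := by
  have h1 := h.relation (‖v‖ / ε)
  have h2 : ‖v‖ * k (‖v‖ / ε) = -(n * ε) * ξ (‖v‖ / ε) := by
    have : ‖v‖ * k (‖v‖ / ε) = ε * (‖v‖ / ε * k (‖v‖ / ε)) := by field_simp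
    rw [this, h1]; ring
  rw [← h2]
  rcases eq_or_ne ‖v‖ 0 with h0 | h0
  · simp [h0]
  · field_simp

theorem IsKernelBound.measurable_quotient [MeasurableSpace T]
    [OpensMeasurableSpace T] (h : IsKernelBound n k ξ L) (ε : ℝ) :
    Measurable fun v : T => k (‖v‖ / ε) * ‖v‖⁻¹ :=
  (h.lip_k.continuous.measurable.comp (measurable_norm.div_const ε)).mul measurable_norm.inv

variable [NormedSpace ℝ T] [NormedAddCommGroup E] [NormedSpace ℝ E]

theorem exists_quadratic_bound (B : T →L[ℝ] T →L[ℝ] E) :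
    ∃ β : ℝ, 0 ≤ β ∧ ∀ v, ‖B v v‖ ≤ β * ‖v‖ ^ 2 :=
  ⟨‖B‖, B.opNorm_nonneg, fun v => (B.le_opNorm₂ v v).trans (le_of_eq (by ring))⟩

theorem norm_linear_add_quadratic_le (A : T →L[ℝ] E) {B : T →L[ℝ] T →L[ℝ] E} {β : ℝ}
    (hβ0 : 0 ≤ β) (hβ : ∀ v, ‖B v v‖ ≤ β * ‖v‖ ^ 2) (a : ℝ) {s : ℝ}
    {v : T} (hv : ‖v‖ ≤ s) (hs : s ≤ 1) : ‖a • A v + B v v‖ ≤ (|a| * ‖A‖ + β) * s := by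
  have hs0 : 0 ≤ s := (norm_nonneg v).trans hv
  calc ‖a • A v + B v v‖ ≤ |a| * (‖A‖ * ‖v‖) + β * ‖v‖ ^ 2 := by
        refine (norm_add_le _ _).trans (add_le_add ?_ (hβ v))
        rw [norm_smul, Real.norm_eq_abs]
        gcongr
        exact A.le_opNorm v
    _ ≤ |a| * (‖A‖ * s) + β * (s * 1) := by
        gcongr
        rw [sq]
        gcongr
        exact hv.trans hs
    _ = _ := by ring

end Normed

variable [NormedAddCommGroup T] [InnerProductSpace ℝ T]
  [FiniteDimensional ℝ T] [MeasurableSpace T] [BorelSpace T] [NormedAddCommGroup E]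
  [NormedSpace ℝ E] {k ξ : ℝ → ℝ} {L : ℝ≥0}

/-- The leading term of the first variation: the linear part vanishes by symmetry and the quadratic
part gives the trace, while `n ξ (s) = - s ρ' (s)` turns `ρ'` into `ξ`. -/
theorem integral_quotient_smul [CompleteSpace E] {ι : Type*} [Fintype ι]
    (b : OrthonormalBasis ι ℝ T) (h : IsKernelBound n k ξ L) {ε : ℝ} (hε : 0 < ε) (hε1 : ε ≤ 1)
    (A : T →L[ℝ] E) (B : T →L[ℝ] T →L[ℝ] E) (a : ℝ) :
    ∫ v : T, (k (‖v‖ / ε) * ‖v‖⁻¹) • (a • A v + B v v) =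
      -((n * ε / Module.finrank ℝ T * ∫ v : T, ξ (‖v‖ / ε)) • ∑ i, B (b i) (b i)) := by
  have hκm := h.measurable_quotient (T := T) ε
  have hint : ∀ (A : T →L[ℝ] E) (B : T →L[ℝ] T →L[ℝ] E) (a : ℝ),
      Integrable fun v : T => (k (‖v‖ / ε) * ‖v‖⁻¹) • (a • A v + B v v) := by
    intro A B a
    obtain ⟨β, hβ0, hβ⟩ := exists_quadratic_bound B
    refine integrable_of_bound_of_support (ε := ε) (a := L / ε * ((|a| * ‖A‖ + β) * ε)) ?_ ?_ ?_
    · exact (hκm.aestronglyMeasurable.smul (Continuous.aestronglyMeasurable (by fun_prop)))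
    · intro v
      rcases le_or_gt ε ‖v‖ with hv | hv
      · rw [(h.scaled_eq_zero hε hv).1, zero_mul, zero_smul, norm_zero]
        positivity
      · rw [norm_smul, Real.norm_eq_abs]
        exact mul_le_mul (h.abs_quotient_le hε v) (norm_linear_add_quadratic_le A hβ0 hβ a hv.le hε1)
          (norm_nonneg _) (by positivity)
    · intro v hv
      rw [(h.scaled_eq_zero hε hv).1, zero_mul, zero_smul]
  have h1 : ∀ v : T, (k (‖v‖ / ε) * ‖v‖⁻¹) • (a • A v + B v v) =
      a • ((k (‖v‖ / ε) * ‖v‖⁻¹) • A v) + (k (‖v‖ / ε) * ‖v‖⁻¹) • B v v := fun v => by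
    rw [smul_add, smul_comm]
  have hA := hint A 0 1
  have hB := hint 0 B 1
  simp only [zero_apply, add_zero, one_smul, smul_zero, zero_add] at hA hB
  simp_rw [h1]
  rw [integral_add (hA.fun_smul a) hB, integral_smul,
    integral_radial_smul_self (fun t => k (t / ε) * t⁻¹) A, smul_zero, zero_add]
  have hq : ∀ v : T, k (‖v‖ / ε) * ‖v‖⁻¹ * ‖v‖ ^ 2 = -(n * ε) * ξ (‖v‖ / ε) :=
    h.quotient_mul_sq hε
  have hξi : Integrable fun v : T => ξ (‖v‖ / ε) := by
    refine integrable_of_bound_of_support (ε := ε) (a := L) ?_ (fun v => h.abs_xi_le _)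
      (fun v hv => (h.scaled_eq_zero hε hv).2)
    have := h.lip_xi.continuous
    exact Continuous.aestronglyMeasurable (by fun_prop)
  rw [integral_radial_quadratic b (fun t => k (t / ε) * t⁻¹) hκm.aestronglyMeasurable ?_ B]
  · simp_rw [hq]
    rw [integral_const_mul, ← neg_smul]
    congr 1
    ring
  · simp_rw [hq]
    exact hξi.const_mul _

end TangentIntegrals

namespace IsTaylorGraph

variable {n : ℕ} {M : Set (Euc n)} {x : Euc n} {T : Submodule ℝ (Euc n)} {u : T → Euc n}
  {C r : ℝ} {k ξ : ℝ → ℝ} {L : ℝ≥0}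

/-- The denominator for the smooth varifold, compared with its value on the tangent space. -/
theorem norm_integral_xi_sub_le (h : IsTaylorGraph M x T u C r) (hM : MeasurableSet M)
    (hk : IsKernelBound n k ξ L) {ε : ℝ} (hε : 0 < ε) (hr : 2 * ε ≤ r) :
    |∫ p in M, ξ (‖p - x‖ / ε) ∂μHE[Module.finrank ℝ T] - ∫ v : T, ξ (‖v‖ / ε)| ≤
      ((1 + 2 ^ (Module.finrank ℝ T)) * (8 * L * C ^ 2 * ε ^ 2) +
        2 ^ (Module.finrank ℝ T) * C ^ 2 * (2 * ε) ^ 2 * L) *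
        ((2 * ε) ^ (Module.finrank ℝ T) * (volume : Measure T).real (Metric.ball 0 1)) := by
  have hξ := hk.lip_xi.continuous
  have hball : ∫ v : T, ξ (‖v‖ / ε) = ∫ v in Metric.ball (0 : T) (2 * ε), ξ (‖v‖ / ε) := by
    refine (setIntegral_eq_integral_of_forall_compl_eq_zero fun v hv => ?_).symm
    rw [Metric.mem_ball, dist_zero_right, not_lt] at hv
    exact (hk.scaled_eq_zero hε (by linarith)).2
  rw [hball, ← Real.norm_eq_abs]
  refine h.norm_setIntegral_sub_le hM (t := ε) (by linarith) (by positivity) hr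
    (f := fun p => ξ (‖p - x‖ / ε)) (g := fun v : T => ξ (‖v‖ / ε))
    (Continuous.aestronglyMeasurable (by fun_prop)) (Continuous.stronglyMeasurable (by fun_prop))
    (fun p hp => (hk.scaled_eq_zero hε hp.le).2) (fun v _ => hk.abs_xi_le _) fun v hv => ?_
  obtain ⟨h1, h2⟩ := h.norm_graphMap_sub (hv.trans_le hr)
  have h3 := hk.lip_xi.dist_le_mul (‖graphMap x u v - x‖ / ε) (‖v‖ / ε)
  rw [Real.dist_eq, Real.dist_eq, ← sub_div, abs_of_nonneg (div_nonneg (sub_nonneg.2 h1) hε.le)]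
    at h3
  calc _ ≤ _ := h3
    _ ≤ L * ((C ^ 2 * (2 * ε) ^ 3) / ε) := by
      gcongr
      calc _ ≤ C ^ 2 * ‖v‖ ^ 3 := by linarith
        _ ≤ _ := by gcongr
    _ = _ := by field_simp; ring

/-- The numerator for the smooth varifold, compared with its second order approximation on the
tangent space. -/
theorem norm_integral_field_sub_le (h : IsTaylorGraph M x T u C r) (hM : MeasurableSet M)
    (hk : IsKernelBound n k ξ L) {Q : (Euc n →L[ℝ] Euc n) → (Euc n →L[ℝ] Euc n)} {a b c : ℝ}
    (hQ : IsAdmissible T Q a b c) {β : ℝ} (hβ0 : 0 ≤ β)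
    (hβ : ∀ v, ‖fderiv ℝ (fderiv ℝ u) 0 v v‖ ≤ β * ‖v‖ ^ 2) {ε : ℝ} (hε : 0 < ε) (hr : 2 * ε ≤ r) (hε1 : 2 * ε ≤ 1)
    (hmeas : AEStronglyMeasurable
      (fun p => Q (tangentSpace M p).starProjection (radialField k ε (p - x)))
      (μHE[Module.finrank ℝ T].restrict M)) :
    ‖∫ p in M, Q (tangentSpace M p).starProjection (radialField k ε (p - x))
        ∂μHE[Module.finrank ℝ T] -
      ∫ v : T, (k (‖v‖ / ε) * ‖v‖⁻¹) • (a • T.subtypeL v + fderiv ℝ (fderiv ℝ u) 0 v v)‖ ≤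
      ((1 + 2 ^ (Module.finrank ℝ T)) * (96 * L * C ^ 2 * ε ^ 2) +
        2 ^ (Module.finrank ℝ T) * C ^ 2 * (2 * ε) ^ 2 *
          (2 * L * (2 + β))) *
        ((2 * ε) ^ (Module.finrank ℝ T) * (volume : Measure T).real (Metric.ball 0 1)) := by
  set B := fderiv ℝ (fderiv ℝ u) 0 with hB
  have hC0 : 0 ≤ C := zero_le_one.trans h.one_le
  have hball : ∫ v : T, (k (‖v‖ / ε) * ‖v‖⁻¹) • (a • T.subtypeL v + B v v) =
      ∫ v in Metric.ball (0 : T) (2 * ε), (k (‖v‖ / ε) * ‖v‖⁻¹) • (a • T.subtypeL v + B v v) := by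
    refine (setIntegral_eq_integral_of_forall_compl_eq_zero fun v hv => ?_).symm
    rw [Metric.mem_ball, dist_zero_right, not_lt] at hv
    rw [(hk.scaled_eq_zero hε (by linarith)).1, zero_mul, zero_smul]
  rw [hball]
  refine h.norm_setIntegral_sub_le hM (t := ε) (by linarith) (by positivity) hr
    (f := fun p => Q (tangentSpace M p).starProjection (radialField k ε (p - x)))
    (g := fun v : T => (k (‖v‖ / ε) * ‖v‖⁻¹) • (a • T.subtypeL v + B v v)) hmeas ?_
    (fun p hp => by rw [radialField_eq_zero hk hε hp.le, map_zero]) (fun v hv => ?_) fun v hv => ?_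
  · exact (hk.measurable_quotient ε).stronglyMeasurable.smul
      (Continuous.stronglyMeasurable (by fun_prop))
  · have h1 : ‖T.subtypeL‖ ≤ 1 := Submodule.norm_subtypeL_le T
    have h2 := norm_linear_add_quadratic_le T.subtypeL hβ0 hβ a hv.le hε1
    rw [norm_smul, Real.norm_eq_abs]
    calc _ ≤ L / ε * ((2 * 1 + β) * (2 * ε)) := by
          refine mul_le_mul (hk.abs_quotient_le hε v) (h2.trans ?_) (norm_nonneg _) (by positivity)
          gcongr
          exact hQ.abs_a_le
      _ = _ := by field_simp
  · obtain ⟨h1, h2⟩ := h.norm_graphMap_sub (hv.trans_le hr)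
    set y := graphMap x u v with hy
    set A := Q (tangentSpace M y).starProjection with hA
    have hAn : ‖A‖ ≤ 2 := hQ.bound _
    have h3 := hQ.norm_apply_sub_le h (hv.trans_le hr)
    rw [← hy, ← hA, ← hB] at h3
    have e : A (radialField k ε (y - x)) - (k (‖v‖ / ε) * ‖v‖⁻¹) • (a • T.subtypeL v + B v v) =
        (k (‖y - x‖ / ε) * ‖y - x‖⁻¹ - k (‖v‖ / ε) * ‖v‖⁻¹) • A (y - x) +
        (k (‖v‖ / ε) * ‖v‖⁻¹) • (A (y - x) - (a • (v : Euc n) + B v v)) := by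
      rw [radialField, map_smul, Submodule.subtypeL_apply]
      module
    have h5 : ‖(k (‖v‖ / ε) * ‖v‖⁻¹) • (A (y - x) - (a • (v : Euc n) + B v v))‖ ≤
        64 * L * C ^ 2 * ε ^ 2 := by
      rw [norm_smul, Real.norm_eq_abs]
      calc _ ≤ L / ε * (8 * C ^ 2 * (2 * ε) ^ 3) := by
            refine mul_le_mul (hk.abs_quotient_le hε v) (h3.trans ?_) (norm_nonneg _)
              (by positivity)
            gcongr
        _ = _ := by field_simp; ring
    have h6 : ‖(k (‖y - x‖ / ε) * ‖y - x‖⁻¹ - k (‖v‖ / ε) * ‖v‖⁻¹) • A (y - x)‖ ≤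
        32 * L * C ^ 2 * ε ^ 2 := by
      rcases eq_or_ne v 0 with h0 | h0
      · have : y - x = 0 := by rw [hy, h0, graphMap_zero h.zero, sub_self]
        rw [this, map_zero, smul_zero, norm_zero]
        positivity
      have hv0 : 0 < ‖v‖ := norm_pos_iff.2 h0
      have hy0 : 0 < ‖y - x‖ := hv0.trans_le h1
      have h7 := hk.lip_k.dist_le_mul (‖y - x‖ / ε) (‖v‖ / ε)
      rw [Real.dist_eq, Real.dist_eq, ← sub_div,
        abs_of_nonneg (div_nonneg (sub_nonneg.2 h1) hε.le)] at h7
      have h8 := hk.abs_quotient_le hε v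
      have h9 : |(k (‖y - x‖ / ε) * ‖y - x‖⁻¹ - k (‖v‖ / ε) * ‖v‖⁻¹) * ‖y - x‖| ≤
          2 * (L / ε * (‖y - x‖ - ‖v‖)) := by
        have e2 : (k (‖y - x‖ / ε) * ‖y - x‖⁻¹ - k (‖v‖ / ε) * ‖v‖⁻¹) * ‖y - x‖ =
            (k (‖y - x‖ / ε) - k (‖v‖ / ε)) - k (‖v‖ / ε) * ‖v‖⁻¹ * (‖y - x‖ - ‖v‖) := by
          field_simp
          ring
        rw [e2]
        have h10 : |k (‖v‖ / ε) * ‖v‖⁻¹ * (‖y - x‖ - ‖v‖)| ≤ L / ε * (‖y - x‖ - ‖v‖) := by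
          rw [abs_mul, abs_of_nonneg (sub_nonneg.2 h1)]
          exact mul_le_mul_of_nonneg_right h8 (sub_nonneg.2 h1)
        have h11 : L * ((‖y - x‖ - ‖v‖) / ε) = L / ε * (‖y - x‖ - ‖v‖) := by ring
        rw [h11] at h7
        refine (abs_sub _ _).trans ?_
        linarith
      rw [norm_smul, Real.norm_eq_abs]
      have h12 : ‖y - x‖ - ‖v‖ ≤ C ^ 2 * (2 * ε) ^ 3 := by
        calc _ ≤ C ^ 2 * ‖v‖ ^ 3 := by linarith
          _ ≤ _ := by gcongr
      calc _ ≤ |k (‖y - x‖ / ε) * ‖y - x‖⁻¹ - k (‖v‖ / ε) * ‖v‖⁻¹| * (2 * ‖y - x‖) := by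
            gcongr
            exact (A.le_opNorm _).trans (by gcongr)
        _ = 2 * |(k (‖y - x‖ / ε) * ‖y - x‖⁻¹ - k (‖v‖ / ε) * ‖v‖⁻¹) * ‖y - x‖| := by
            rw [abs_mul, abs_of_pos hy0]; ring
        _ ≤ 2 * (2 * (L / ε * (C ^ 2 * (2 * ε) ^ 3))) := by
            gcongr
            exact h9.trans (by gcongr)
        _ = _ := by field_simp; ring
    change ‖A (radialField k ε (y - x)) - _‖ ≤ _
    rw [e]
    refine (norm_add_le _ _).trans ?_
    linarith

/-- Consistency for the smooth varifold: the numerator of the approximate mean curvature is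
`- (n ε / d) H` times the denominator, with an error of relative order `ε²`. -/
theorem exists_consistency {d : ℕ} (h : IsTaylorGraph M x T u C r)
    (hT : Module.finrank ℝ T = d) (hMc : IsCompact M) (hM : IsSubmanifold 3 d M)
    (hk : IsKernelBound n k ξ L) {Q : (Euc n →L[ℝ] Euc n) → (Euc n →L[ℝ] Euc n)} {a b c : ℝ}
    (hQ : IsAdmissible T Q a b c) : ∃ K : ℝ, 0 ≤ K ∧ ∀ ε, 0 < ε → 2 * ε ≤ r → 2 * ε ≤ 1 →
      ‖∫ p, Q p.2.proj (radialField k ε (p.1 - x)) ∂(smoothVarifold d M) +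
        (n * ε / d * ∫ p, ξ (‖p - x‖ / ε) ∂(mass (smoothVarifold d M))) •
          Laplacian.laplacian u 0‖ ≤ K * ε ^ 2 * ε ^ d := by
  have hC0 : 0 ≤ C := zero_le_one.trans h.one_le
  obtain ⟨β, hβ0, hβ⟩ := exists_quadratic_bound (fderiv ℝ (fderiv ℝ u) 0)
  set w := (volume : Measure T).real (Metric.ball 0 1) with hw
  have hw0 : 0 ≤ w := measureReal_nonneg
  set H := Laplacian.laplacian u 0 with hH
  set K₁ : ℝ := ((1 + 2 ^ d) * (8 * L * C ^ 2) + 2 ^ d * C ^ 2 * 4 * L) * (2 ^ d * w) with hK₁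
  set K₂ : ℝ := ((1 + 2 ^ d) * (96 * L * C ^ 2) + 2 ^ d * C ^ 2 * 4 *
    (2 * L * (2 + β))) * (2 ^ d * w) with hK₂
  have hK₁0 : 0 ≤ K₁ := by positivity
  have hK₂0 : 0 ≤ K₂ := by positivity
  refine ⟨K₂ + n / d * ‖H‖ * K₁, by positivity, fun ε hε hεr hε1 => ?_⟩
  rw [mass_smoothVarifold hMc hM, integral_smoothVarifold hMc hM
    (F := fun p => Q p.2 (radialField k ε (p.1 - x))) (hQ.continuous_integrand hk hε x)]
  have hmeas := aestronglyMeasurable_tangent hMc hM (hQ.continuous_integrand hk hε x) (μHE[d])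
  have h1 := h.norm_integral_xi_sub_le hMc.measurableSet hk hε hεr
  rw [hT] at h1
  have h2 := h.norm_integral_field_sub_le hMc.measurableSet hk hQ hβ0 hβ hε hεr hε1 (by rwa [hT])
  rw [hT, integral_quotient_smul (stdOrthonormalBasis ℝ T) hk hε (by linarith) T.subtypeL
    (fderiv ℝ (fderiv ℝ u) 0) a, ← laplacian_eq_sum_fderiv, ← hH, hT] at h2
  set J := ∫ p in M, Q (tangentSpace M p).starProjection (radialField k ε (p - x)) ∂μHE[d]
  set I := ∫ p in M, ξ (‖p - x‖ / ε) ∂μHE[d]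
  set I₀ := ∫ v : T, ξ (‖v‖ / ε)
  have h1' : |I - I₀| ≤ K₁ * ε ^ 2 * ε ^ d := h1.trans (le_of_eq (by rw [hK₁, mul_pow]; ring))
  have h2' : ‖J - -((n * ε / d * I₀) • H)‖ ≤ K₂ * ε ^ 2 * ε ^ d :=
    h2.trans (le_of_eq (by rw [hK₂, mul_pow]; ring))
  have e : J + (n * ε / d * I) • H =
      (J - -((n * ε / d * I₀) • H)) + (n * ε / d * (I - I₀)) • H := by module
  change ‖J + (n * ε / d * I) • H‖ ≤ _
  rw [e]
  have h3 : ‖(n * ε / d * (I - I₀)) • H‖ ≤ n * 1 / d * (K₁ * ε ^ 2 * ε ^ d) * ‖H‖ := by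
    rw [norm_smul, norm_mul, Real.norm_eq_abs, Real.norm_eq_abs, abs_of_nonneg (by positivity)]
    gcongr
    linarith
  calc _ ≤ K₂ * ε ^ 2 * ε ^ d + n * 1 / d * (K₁ * ε ^ 2 * ε ^ d) * ‖H‖ :=
        (norm_add_le _ _).trans (add_le_add h2' h3)
    _ = _ := by ring

end IsTaylorGraph

end Varifold

/-! ### Stability, and the error estimate -/

namespace Varifold

variable {n d : ℕ}

theorem integral_mass {V : Measure (Euc n × Gr d n)} {f : Euc n → ℝ} (hf : Continuous f) :
    ∫ y, f y ∂(mass V) = ∫ p, f p.1 ∂V := by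
  rw [mass, integral_map measurable_fst.aemeasurable hf.aestronglyMeasurable]

/-- Non-degeneracy of the denominator: every measure close to `‖V‖` in the Prokhorov distance
charges a ball whose centre lies at distance about `ε / 2` from `x`, where the kernel is bounded
from below. -/
theorem IsTaylorGraph.exists_lower_bound {M : Set (Euc n)} {x : Euc n} {T : Submodule ℝ (Euc n)}
    {u : T → Euc n} {C r : ℝ} (h : IsTaylorGraph M x T u C r) (hd : 1 ≤ d)
    (hT : Module.finrank ℝ T = d) (hMc : IsCompact M) (hM : IsSubmanifold 3 d M) {ξ : ℝ → ℝ}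
    (hξc : Continuous ξ) {L : ℝ} (hξL : ∀ s, |ξ s| ≤ L) (hξ0 : ∀ s, 0 ≤ ξ s)
    (hξ : ∀ s ∈ Ioo (0 : ℝ) 1, 0 < ξ s) :
    ∃ κ c : ℝ, 0 < κ ∧ 0 < c ∧ ∀ ε, 0 < ε → 4 * ε ≤ r → ∀ (ν : Measure (Euc n)) (z : Euc n),
      IsFiniteMeasure ν → ‖x - z‖ ≤ ε / 16 →
      (∀ y s, 0 < s → mass (smoothVarifold d M) (Metric.closedBall y s) ≤
        ν (Metric.thickening (κ * ε) (Metric.closedBall y s)) + ENNReal.ofReal ((κ * ε) ^ d)) →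
      c * ε ^ d ≤ ∫ y, ξ (‖y - z‖ / ε) ∂ν := by
  set w := (volume : Measure T).real (Metric.ball 0 1) with hw
  have hw0 : 0 < w :=
    ENNReal.toReal_pos (Metric.measure_ball_pos _ _ one_pos).ne' measure_ball_lt_top.ne
  have hTn : Nontrivial T := Module.nontrivial_of_finrank_pos (R := ℝ) (by omega)
  obtain ⟨t₀, ht₀, hmin⟩ := (isCompact_Icc (a := (1 / 4 : ℝ)) (b := 7 / 8)).exists_isMinOn
    ⟨1 / 4, by norm_num⟩ hξc.continuousOn
  have hm : 0 < ξ t₀ := hξ t₀ ⟨by linarith [ht₀.1], by linarith [ht₀.2]⟩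
  set θ := min 1 (w / 2) with hθ
  have hθ0 : 0 < θ := by positivity
  have hθ1 : θ ≤ 1 := min_le_left _ _
  -- `κ = θ / 16` is chosen so that `(κ ε) ^ d` is at most half the mass of the ball of radius `ε / 8`.
  refine ⟨1 / 16 * θ, ξ t₀ * ((1 / 16) ^ d * (w / 2)), by positivity, by positivity,
    fun ε hε hεr ν z hν hz hprok => ?_⟩
  obtain ⟨v, hv⟩ := exists_norm_eq T (show 0 ≤ ε / 2 by positivity)
  set y₀ := graphMap x u v with hy₀
  have hvr : ‖v‖ < r := by rw [hv]; linarith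
  obtain ⟨h1, h2⟩ := h.norm_graphMap_sub hvr
  rw [← hy₀, hv] at h1 h2
  have hC0 : 0 ≤ C := zero_le_one.trans h.one_le
  have hCε : C * ε ≤ 1 / 4 := by
    have : C * (4 * ε) ≤ 1 := (mul_le_mul_of_nonneg_left hεr hC0).trans h.C_mul_r
    linarith
  have h2' : ‖y₀ - x‖ ≤ ε / 2 + ε / 16 := by
    have h3 : C ^ 2 * (ε / 2) ^ 3 = (C * ε) ^ 2 * ε / 8 := by ring
    have h4 : (C * ε) ^ 2 ≤ 1 := pow_le_one₀ (by positivity) (by linarith)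
    have h5 : (C * ε) ^ 2 * ε ≤ (1 / 4) ^ 2 * ε := by gcongr
    rw [h3] at h2
    linarith
  have hball := h.le_measure_closedBall (v := v) (s := ε / 8) (by positivity) (by rw [hv]; linarith)
  rw [hT, ← hy₀, ← hw] at hball
  set S := Metric.thickening (1 / 16 * θ * ε) (Metric.closedBall y₀ (ε / 8)) with hS
  have hmass := hprok y₀ (ε / 8) (by positivity)
  rw [mass_smoothVarifold hMc hM, Measure.restrict_apply Metric.isClosed_closedBall.measurableSet,
    inter_comm] at hmass
  have hreal : (ε / 8 / 2) ^ d * w ≤ ν.real S + (1 / 16 * θ * ε) ^ d := by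
    have h3 := ENNReal.toReal_mono (ENNReal.add_lt_top.2
      ⟨measure_lt_top ν S, ENNReal.ofReal_lt_top⟩).ne (hball.trans hmass)
    rwa [ENNReal.toReal_add (measure_ne_top _ _) ENNReal.ofReal_ne_top,
      ENNReal.toReal_ofReal (by positivity), ENNReal.toReal_ofReal (by positivity)] at h3
  have hθd : θ ^ d ≤ w / 2 := (pow_le_of_le_one hθ0.le hθ1 (by omega)).trans (min_le_right _ _)
  have hνS : (1 / 16) ^ d * (w / 2) * ε ^ d ≤ ν.real S := by
    have e1 : (ε / 8 / 2) ^ d * w = (1 / 16) ^ d * w * ε ^ d := by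
      have : ε / 8 / 2 = 1 / 16 * ε := by ring
      rw [this, mul_pow]; ring
    have e2 : (1 / 16 * θ * ε) ^ d = (1 / 16) ^ d * θ ^ d * ε ^ d := by rw [mul_pow, mul_pow]
    rw [e1, e2] at hreal
    have : (1 / 16 : ℝ) ^ d * θ ^ d * ε ^ d ≤ (1 / 16) ^ d * (w / 2) * ε ^ d := by gcongr
    have e3 : (1 / 16 : ℝ) ^ d * w * ε ^ d = 2 * ((1 / 16) ^ d * (w / 2) * ε ^ d) := by ring
    linarith
  have hSm : MeasurableSet S := Metric.isOpen_thickening.measurableSet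
  have hfc : Continuous fun y : Euc n => ξ (‖y - z‖ / ε) := by fun_prop
  have hfi : Integrable (fun y : Euc n => ξ (‖y - z‖ / ε)) ν :=
    Integrable.of_bound hfc.aestronglyMeasurable L (ae_of_all _ fun y => hξL _)
  have hlow : ∀ y ∈ S, ξ t₀ ≤ ξ (‖y - z‖ / ε) := by
    intro y hy
    obtain ⟨q, hq, hyq⟩ := Metric.mem_thickening_iff.1 hy
    rw [Metric.mem_closedBall] at hq
    have h3 : 1 / 16 * θ * ε ≤ 1 / 16 * 1 * ε := by gcongr
    have h4 : ‖y - y₀‖ ≤ 3 * ε / 16 := by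
      rw [← dist_eq_norm]
      have := dist_triangle y q y₀
      linarith
    have h5 : ‖y - z‖ ≤ ‖y - y₀‖ + ‖y₀ - x‖ + ‖x - z‖ := by
      have := norm_sub_le_norm_sub_add_norm_sub y y₀ z
      have := norm_sub_le_norm_sub_add_norm_sub y₀ x z
      linarith
    have h6 : ‖y₀ - x‖ ≤ ‖y - y₀‖ + ‖y - z‖ + ‖x - z‖ := by
      have h7 := norm_sub_le_norm_sub_add_norm_sub y₀ y x
      have h8 := norm_sub_le_norm_sub_add_norm_sub y z x
      rw [norm_sub_rev y₀ y] at h7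
      rw [norm_sub_rev z x] at h8
      linarith
    refine hmin ⟨?_, ?_⟩
    · rw [le_div_iff₀ hε]; linarith
    · rw [div_le_iff₀ hε]; linarith
  calc _ = ξ t₀ * ((1 / 16) ^ d * (w / 2) * ε ^ d) := by ring
    _ ≤ ξ t₀ * ν.real S := by gcongr
    _ = ∫ _ in S, ξ t₀ ∂ν := by rw [setIntegral_const, smul_eq_mul, mul_comm]
    _ ≤ ∫ y in S, ξ (‖y - z‖ / ε) ∂ν :=
        setIntegral_mono_on (integrable_const _).integrableOn hfi.integrableOn hSm hlow
    _ ≤ _ := setIntegral_le_integral hfi (ae_of_all _ fun y => hξ0 _)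

/-- Stability of localized integrals under a change of the varifold and of the centre. -/
theorem norm_integral_sub_integral_le_delta {E : Type*} [NormedAddCommGroup E]
    [InnerProductSpace ℝ E] [CompleteSpace E] {V W : Measure (Euc n × Gr d n)} [IsFiniteMeasure V]
    [IsFiniteMeasure W] (hfin : varifoldDelta V W < ⊤) {x z : Euc n} (hx : x ∈ (mass V).support)
    {A : ℝ} (hA0 : 0 ≤ A)
    (hA : ∀ s, 0 < s → mass V (Metric.closedBall x s) ≤ ENNReal.ofReal (A * s ^ d)) {ε : ℝ}
    (hε : 0 < ε) (hz : ‖x - z‖ ≤ ε / 2) (hη : prokhorovDist d (mass V) (mass W) ≤ ε)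
    {F : Euc n → Euc n × Gr d n → E} {Λ : ℝ≥0} (hF : ∀ y, LipschitzWith Λ (F y))
    (hFb : ∀ y p, ‖F y p‖ ≤ Λ) (hF0 : ∀ y p, ε ≤ ‖p.1 - y‖ → F y p = 0)
    (hFm : ∀ y, StronglyMeasurable (F y)) (hFz : ∀ p, ‖F z p - F x p‖ ≤ Λ * ‖x - z‖) :
    ‖∫ p, F z p ∂W - ∫ p, F x p ∂V‖ ≤
      Λ * (3 ^ d * (varifoldDelta V W).toReal + 2 ^ d * A * ‖x - z‖) * ε ^ d := by
  have hint : ∀ y, Integrable (F y) V := fun y =>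
    Integrable.of_bound (hFm y).aestronglyMeasurable Λ (ae_of_all _ (hFb y))
  have hsub : ∀ p : Euc n × Gr d n, 2 * ε ≤ ‖p.1 - x‖ → F z p = 0 ∧ F x p = 0 := fun p hp => by
    have h1 := norm_sub_le_norm_sub_add_norm_sub p.1 z x
    rw [norm_sub_rev z x] at h1
    exact ⟨hF0 z p (by linarith), hF0 x p (by linarith)⟩
  have hsupp : tsupport (F z) ⊆ Metric.ball x (2 * ε) ×ˢ univ := by
    have hcl : IsClosed (Metric.closedBall z ε ×ˢ (univ : Set (Gr d n))) :=
      Metric.isClosed_closedBall.prod isClosed_univ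
    refine (closure_minimal ?_ hcl).trans (prod_mono ?_ le_rfl)
    · intro p hp
      refine ⟨?_, trivial⟩
      rw [Metric.mem_closedBall, dist_eq_norm]
      by_contra! hlt
      exact hp (hF0 z p hlt.le)
    · refine Metric.closedBall_subset_ball' ?_
      rw [dist_comm, dist_eq_norm]
      linarith
  have h1 := norm_integral_sub_le_varifoldDelta hfin hx (r := 2 * ε) (by positivity) (hF z) (hFb z)
    hsupp (hFm z)
  have h2 : ‖∫ p, F z p ∂V - ∫ p, F x p ∂V‖ ≤ Λ * ‖x - z‖ * (A * (2 * ε) ^ d) := by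
    rw [← integral_sub (hint z) (hint x)]
    have h3 : ∫ p, (F z p - F x p) ∂V =
        ∫ p in Metric.closedBall x (2 * ε) ×ˢ univ, (F z p - F x p) ∂V := by
      refine (setIntegral_eq_integral_of_forall_compl_eq_zero fun p hp => ?_).symm
      have : 2 * ε ≤ ‖p.1 - x‖ := by
        by_contra! hlt
        exact hp ⟨by simpa [dist_eq_norm] using hlt.le, trivial⟩
      rw [(hsub p this).1, (hsub p this).2, sub_zero]
    rw [h3]
    refine (norm_setIntegral_le_of_norm_le_const (measure_lt_top _ _) fun p _ => hFz p).trans ?_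
    gcongr
    refine ENNReal.toReal_le_of_le_ofReal (by positivity) ?_
    rw [← mass_apply V Metric.isClosed_closedBall.measurableSet]
    exact hA _ (by positivity)
  have hη0 := prokhorovDist_nonneg (d := d) (mass V) (mass W)
  calc _ ≤ ‖∫ p, F z p ∂W - ∫ p, F z p ∂V‖ + ‖∫ p, F z p ∂V - ∫ p, F x p ∂V‖ :=
        norm_sub_le_norm_sub_add_norm_sub _ _ _
    _ ≤ Λ * ((varifoldDelta V W).toReal * (ε + 2 * ε) ^ d) + Λ * ‖x - z‖ * (A * (2 * ε) ^ d) := by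
        rw [norm_sub_rev]
        refine add_le_add (h1.trans ?_) h2
        gcongr
    _ = _ := by
        have : ε + 2 * ε = 3 * ε := by ring
        rw [this, mul_pow, mul_pow]
        ring

theorem lipschitzWith_xi {ξ : ℝ → ℝ} {L : ℝ≥0} (hξ : LipschitzWith L ξ) {ε : ℝ} (hε : 0 < ε)
    (z : Euc n) : LipschitzWith (Real.toNNReal (8 * L / ε))
      fun p : Euc n × Gr d n => ξ (‖p.1 - z‖ / ε) := by
  refine LipschitzWith.of_dist_le_mul fun p q => ?_
  rw [Real.coe_toNNReal _ (by positivity)]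
  have h1 : ‖p.1 - q.1‖ ≤ dist p q := by rw [← dist_eq_norm]; exact le_max_left _ _
  have h2 := hξ.dist_le_mul (‖p.1 - z‖ / ε) (‖q.1 - z‖ / ε)
  have h3 := abs_norm_sub_norm_le (p.1 - z) (q.1 - z)
  rw [sub_sub_sub_cancel_right] at h3
  have h0 : 0 ≤ L * (dist p q / ε) := by positivity
  rw [Real.dist_eq (‖p.1 - z‖ / ε), ← sub_div, abs_div, abs_of_pos hε] at h2
  calc _ ≤ _ := h2
    _ ≤ L * (dist p q / ε) := by gcongr; exact h3.trans h1
    _ ≤ 8 * (L * (dist p q / ε)) := by linarith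
    _ = _ := by ring

/-- The error estimate: for all small `ε`, all centres close to `x` and all varifolds `W` close to
the varifold `V` of `M`, relative to `ε`. -/
theorem exists_error_bound (hd : 1 ≤ d) {ρ ξ : ℝ → ℝ} (hρξ : IsKernelPair n ρ ξ)
    {M : Set (Euc n)} (hMc : IsCompact M) (hM : IsSubmanifold 3 d M) {x : Euc n} (hx : x ∈ M)
    {P : Gr d n → (Euc n →L[ℝ] Euc n)} (hP : P ∈ admissibleOperators d M x) :
    ∃ κ ε₀ K : ℝ, 0 < κ ∧ 0 < ε₀ ∧ 0 ≤ K ∧ ∀ ε, 0 < ε → ε < ε₀ →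
      ∀ (W : Measure (Euc n × Gr d n)) (z : Euc n), IsFiniteMeasure W →
      ‖x - z‖ + prokhorovDist d (mass (smoothVarifold d M)) (mass W) < κ * ε →
      ‖approxMeanCurvature ρ ξ P ε z W - meanCurvature M x‖ ≤
        K * (((varifoldDelta (smoothVarifold d M) W).toReal + ‖x - z‖) / ε ^ 2 + ε) := by
  obtain ⟨hT, u, C, r, hg, hH⟩ := exists_isTaylorGraph hM hx
  obtain ⟨L, hk⟩ := hρξ.exists_bound
  obtain ⟨Q, a, b, c, hQ, hPQ⟩ := exists_isAdmissible hP
  obtain ⟨A, hA0, hA⟩ := exists_upper_bound hMc hM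
  obtain ⟨K₀, hK₀, hcons⟩ := hg.exists_consistency hT hMc hM hk hQ
  have hξc := hk.lip_xi.continuous
  obtain ⟨κ, c₀, hκ, hc₀, hlow⟩ := hg.exists_lower_bound hd hT hMc hM hξc hk.abs_xi_le
    hρξ.nonneg_xi hρξ.pos_xi
  have hVfin := isFiniteMeasure_smoothVarifold hMc hM
  have hxV := mem_support_mass hMc hM hx
  set V := smoothVarifold d M with hV
  set H := meanCurvature M x with hHdef
  have hn : 0 < n := by
    have := Submodule.finrank_le (tangentSpace M x)
    rw [hT, finrank_euclideanSpace_fin] at this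
    omega
  have hn' : (0 : ℝ) < n := by exact_mod_cast hn
  have hd' : (0 : ℝ) < d := by exact_mod_cast (by omega : 0 < d)
  set B : ℝ := 8 * L * (3 ^ d + 2 ^ d * A) with hB
  have hB0 : 0 ≤ B := by positivity
  set K : ℝ := d / n / c₀ * (B + K₀ + n / d * B * ‖H‖) with hK
  refine ⟨min κ (1 / 16), min (r / 4) (1 / 2), K, by positivity,
    lt_min (by linarith [hg.r_pos]) (by norm_num), by positivity,
    fun ε hε hε0 W z hWfin hsmall => ?_⟩
  have hεr : 4 * ε ≤ r := by linarith [hε0.trans_le (min_le_left _ _)]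
  have hε1 : 2 * ε ≤ 1 := by linarith [hε0.trans_le (min_le_right _ _)]
  set η := prokhorovDist d (mass V) (mass W) with hη
  have hη0 : 0 ≤ η := prokhorovDist_nonneg _ _
  have hs1 : ‖x - z‖ + η < κ * ε := hsmall.trans_le (by gcongr; exact min_le_left _ _)
  have hs2 : ‖x - z‖ + η < 1 / 16 * ε := hsmall.trans_le (by gcongr; exact min_le_right _ _)
  have hxz := norm_nonneg (x - z)
  have hδ : varifoldDelta V W < ⊤ := varifoldDelta_lt_top hd hA0 fun y hy =>
    hA y (support_mass_smoothVarifold_subset hMc hM hy)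
  set δ := (varifoldDelta V W).toReal with hδdef
  have hδ0 : 0 ≤ δ := ENNReal.toReal_nonneg
  have hΛ : ((Real.toNNReal (8 * L / ε) : ℝ≥0) : ℝ) = 8 * L / ε :=
    Real.coe_toNNReal _ (by positivity)
  have hLε : (L : ℝ) ≤ L / ε := by
    rw [le_div_iff₀ hε]
    exact mul_le_of_le_one_right L.2 (by linarith)
  have hL0 : 0 ≤ (L : ℝ) / ε := by positivity
  have hBbound : 8 * (L : ℝ) / ε * (3 ^ d * δ + 2 ^ d * A * ‖x - z‖) * ε ^ d ≤
      B * ((δ + ‖x - z‖) / ε) * ε ^ d := by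
    have h1 : 3 ^ d * δ + 2 ^ d * A * ‖x - z‖ ≤ (3 ^ d + 2 ^ d * A) * (δ + ‖x - z‖) := by
      have h3 : (0 : ℝ) ≤ 3 ^ d * ‖x - z‖ := by positivity
      have h4 : 0 ≤ 2 ^ d * A * δ := by positivity
      linarith
    calc _ ≤ 8 * (L : ℝ) / ε * ((3 ^ d + 2 ^ d * A) * (δ + ‖x - z‖)) * ε ^ d := by gcongr
      _ = _ := by rw [hB]; ring
  -- Comparison of the denominators `I`, for `W` and `z`, and `I₀`, for `V` and `x`.
  set I := ∫ y, ξ (‖y - z‖ / ε) ∂(mass W) with hI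
  set I₀ := ∫ y, ξ (‖y - x‖ / ε) ∂(mass V) with hI₀
  have hIlow : c₀ * ε ^ d ≤ I := by
    refine hlow ε hε hεr (mass W) z inferInstance (by linarith) fun y s hs => ?_
    exact (le_of_prokhorovDist_lt hd (by linarith : η < κ * ε) y hs).1
  have hIpos : 0 < I := lt_of_lt_of_le (by positivity) hIlow
  have hIdiff : |I - I₀| ≤ B * ((δ + ‖x - z‖) / ε) * ε ^ d := by
    have h1 := norm_integral_sub_integral_le_delta hδ hxV hA0 (hA x hx) hε
      (by linarith : ‖x - z‖ ≤ ε / 2) (by linarith : η ≤ ε)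
      (F := fun y p => ξ (‖p.1 - y‖ / ε)) (Λ := Real.toNNReal (8 * L / ε))
      (fun y => lipschitzWith_xi hk.lip_xi hε y)
      (fun y p => by
        rw [hΛ]
        refine (hk.abs_xi_le _).trans ?_
        calc (L : ℝ) ≤ 8 * (L / ε) := by linarith
          _ = _ := by ring)
      (fun y p hp => (hk.scaled_eq_zero hε hp).2)
      (fun y => Continuous.stronglyMeasurable (by fun_prop))
      (fun p => by
        have h2 := hk.lip_xi.dist_le_mul (‖p.1 - z‖ / ε) (‖p.1 - x‖ / ε)
        have h3 := abs_norm_sub_norm_le (p.1 - z) (p.1 - x)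
        rw [sub_sub_sub_cancel_left] at h3
        have h4 : 0 ≤ L * (‖x - z‖ / ε) := by positivity
        rw [Real.dist_eq (‖p.1 - z‖ / ε), ← sub_div, abs_div, abs_of_pos hε] at h2
        rw [hΛ]
        calc _ ≤ _ := h2
          _ ≤ L * (‖x - z‖ / ε) := by gcongr
          _ ≤ 8 * (L * (‖x - z‖ / ε)) := by linarith
          _ = _ := by ring)
    rw [hΛ, ← integral_mass (V := W) (f := fun y => ξ (‖y - z‖ / ε)) (by fun_prop),
      ← integral_mass (V := V) (f := fun y => ξ (‖y - x‖ / ε)) (by fun_prop)] at h1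
    exact h1.trans hBbound
  -- Comparison of the numerators, where the kernel is `8 L / ε`-Lipschitz.
  set J := ∫ p, Q p.2.proj (radialField (deriv ρ) ε (p.1 - z)) ∂W with hJ
  set J₀ := ∫ p, Q p.2.proj (radialField (deriv ρ) ε (p.1 - x)) ∂V with hJ₀
  have hJdiff : ‖J - J₀‖ ≤ B * ((δ + ‖x - z‖) / ε) * ε ^ d := by
    have h1 := norm_integral_sub_integral_le_delta hδ hxV hA0 (hA x hx) hε
      (by linarith : ‖x - z‖ ≤ ε / 2) (by linarith : η ≤ ε)
      (F := fun y p => Q p.2.proj (radialField (deriv ρ) ε (p.1 - y)))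
      (Λ := Real.toNNReal (8 * L / ε))
      (fun y => hQ.lipschitzWith_integrand hk hε (by linarith) y)
      (fun y p => hQ.norm_integrand_le hk hε (by linarith) y p)
      (fun y p hp => by rw [radialField_eq_zero hk hε hp, map_zero])
      (fun y => Continuous.stronglyMeasurable
        (hQ.lipschitzWith_integrand hk hε (by linarith) y).continuous)
      (fun p => by
        have h2 := norm_radialField_sub_le hk hε (p.1 - z) (p.1 - x)
        rw [sub_sub_sub_cancel_left] at h2
        rw [hΛ, ← map_sub]
        have h4 : 0 ≤ L / ε * ‖x - z‖ := by positivity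
        calc _ ≤ 2 * (3 * L / ε * ‖x - z‖) := by
              refine (ContinuousLinearMap.le_opNorm _ _).trans ?_
              exact mul_le_mul (hQ.bound _) h2 (norm_nonneg _) (by norm_num)
          _ = 6 * (L / ε * ‖x - z‖) := by ring
          _ ≤ 8 * (L / ε * ‖x - z‖) := by linarith
          _ = _ := by ring)
    rw [hΛ] at h1
    exact h1.trans hBbound
  have hcε := hcons ε hε (by linarith) hε1
  rw [← hH] at hcε
  have happ : approxMeanCurvature ρ ξ P ε z W = (-((d : ℝ) / (n * ε)) * I⁻¹) • J := by
    rw [approxMeanCurvature, ← hI, hJ]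
    congr 1
    refine integral_congr_ae (ae_of_all _ fun p => ?_)
    simp only
    rw [hPQ, radialField, map_smul]
  -- The error splits into the change of numerator, the consistency error and the change of
  -- denominator; only `I` needs a lower bound.
  have hdiff : approxMeanCurvature ρ ξ P ε z W - H = (-((d : ℝ) / (n * ε)) * I⁻¹) •
      ((J - J₀) + (J₀ + (n * ε / d * I₀) • H) + (n * ε / d * (I - I₀)) • H) := by
    have e1 : (J - J₀) + (J₀ + (n * ε / d * I₀) • H) + (n * ε / d * (I - I₀)) • H =
        J + (n * ε / d * I) • H := by module
    have e2 : -((d : ℝ) / (n * ε)) * I⁻¹ * (n * ε / d * I) = -1 := by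
      field_simp
    rw [happ, e1, smul_add, smul_smul, e2, neg_smul, one_smul, sub_eq_add_neg]
  have hcoef : ‖-((d : ℝ) / (n * ε)) * I⁻¹‖ ≤ d / (n * ε) * (c₀ * ε ^ d)⁻¹ := by
    rw [norm_mul, norm_neg, Real.norm_eq_abs, Real.norm_eq_abs, abs_of_nonneg (by positivity),
      abs_of_nonneg (by positivity)]
    gcongr
  have hH3 : ‖(n * ε / d * (I - I₀)) • H‖ ≤
      n * ε / d * (B * ((δ + ‖x - z‖) / ε) * ε ^ d) * ‖H‖ := by
    rw [norm_smul, norm_mul, Real.norm_eq_abs, Real.norm_eq_abs, abs_of_nonneg (by positivity)]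
    gcongr
  set q := δ + ‖x - z‖ with hq
  have hq0 : 0 ≤ q := by positivity
  rw [hdiff, norm_smul]
  calc _ ≤ d / (n * ε) * (c₀ * ε ^ d)⁻¹ * (B * (q / ε) * ε ^ d + K₀ * ε ^ 2 * ε ^ d +
        n * ε / d * (B * (q / ε) * ε ^ d) * ‖H‖) := by
        gcongr
        exact (norm_add₃_le).trans (add_le_add (add_le_add hJdiff hcε) hH3)
    _ = d / n / c₀ * (B * (q / ε ^ 2) + K₀ * ε + n / d * B * ‖H‖ * (q / ε ^ 2 * ε)) := by
        field_simp
    _ ≤ d / n / c₀ * (B * (q / ε ^ 2 + ε) + K₀ * (q / ε ^ 2 + ε) +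
        n / d * B * ‖H‖ * (q / ε ^ 2 + ε)) := by
        have h0 : 0 ≤ q / ε ^ 2 := by positivity
        have h1 : q / ε ^ 2 * ε ≤ q / ε ^ 2 := mul_le_of_le_one_right h0 (by linarith)
        gcongr
        · linarith
        · linarith
        · linarith
    _ = _ := by rw [hK]; ring

end Varifold

theorem corollary4p2 {d n : ℕ} (hd : 1 ≤ d) (ρ ξ : ℝ → ℝ) (hρξ : IsKernelPair n ρ ξ)
    (M : Set (Euc n)) (hMc : IsCompact M) (hM : IsSubmanifold 3 d M)
    (W : ℕ → Measure (Euc n × Gr d n)) [hWfin : ∀ i, IsLocallyFiniteMeasure (W i)]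
    (hW : WeakStarConverges W (smoothVarifold d M))
    (K : Set (Euc n)) (hK : IsCompact K) (hWK : ∀ i, (W i).support ⊆ K ×ˢ univ)
    (x : Euc n) (hx : x ∈ M) (P : Gr d n → (Euc n →L[ℝ] Euc n))
    (hP : P ∈ admissibleOperators d M x)
    (z : ℕ → Euc n) (hz : Tendsto z atTop (𝓝 x))
    (ε : ℕ → ℝ) (hε : ∀ i, ε i ∈ Ioo (0 : ℝ) 1) (hε0 : Tendsto ε atTop (𝓝 0))
    (hη : (fun i => ‖x - z i‖ + prokhorovDist d (mass (smoothVarifold d M)) (mass (W i)))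
      =o[atTop] ε) :
    (∀ i, varifoldDelta (smoothVarifold d M) (W i) < ⊤) ∧
    ((fun i => ‖approxMeanCurvature ρ ξ P (ε i) (z i) (W i) - meanCurvature M x‖) =O[atTop]
      (fun i => ((varifoldDelta (smoothVarifold d M) (W i)).toReal + ‖x - z i‖) / ε i ^ 2
        + ε i)) ∧
    ((fun i => √((varifoldDelta (smoothVarifold d M) (W i)).toReal + ‖x - z i‖)) =o[atTop] ε →
      Tendsto (fun i => approxMeanCurvature ρ ξ P (ε i) (z i) (W i)) atTop
        (𝓝 (meanCurvature M x))) := by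
  have hfinW : ∀ i, IsFiniteMeasure (W i) := fun i => isFiniteMeasure_of_support_subset hK (hWK i)
  have hfinV := isFiniteMeasure_smoothVarifold hMc hM
  obtain ⟨A, hA0, hA⟩ := exists_upper_bound hMc hM
  obtain ⟨κ, ε₀, K', hκ, hε₀, hK', hmain⟩ := exists_error_bound hd hρξ hMc hM hx hP
  have hO : (fun i => ‖approxMeanCurvature ρ ξ P (ε i) (z i) (W i) - meanCurvature M x‖) =O[atTop]
      (fun i => ((varifoldDelta (smoothVarifold d M) (W i)).toReal + ‖x - z i‖) / ε i ^ 2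
        + ε i) := by
    refine IsBigO.of_bound K' ?_
    filter_upwards [hη.def (half_pos hκ), hε0.eventually (gt_mem_nhds hε₀)] with i hi hi'
    have hεi := (hε i).1
    have hη0 := prokhorovDist_nonneg (d := d) (mass (smoothVarifold d M)) (mass (W i))
    rw [Real.norm_of_nonneg (by positivity), Real.norm_of_nonneg hεi.le] at hi
    rw [norm_norm, Real.norm_of_nonneg (by positivity)]
    refine hmain (ε i) hεi hi' (W i) (z i) (hfinW i) (hi.trans_lt ?_)
    have : 0 < κ * ε i := by positivity
    linarith
  refine ⟨fun i => varifoldDelta_lt_top hd hA0 fun y hy =>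
    hA y (support_mass_smoothVarifold_subset hMc hM hy), hO, fun ho => ?_⟩
  rw [tendsto_iff_norm_sub_tendsto_zero]
  refine hO.trans_tendsto ?_
  have h1 := (ho.tendsto_div_nhds_zero.pow 2).add hε0
  rw [zero_pow two_ne_zero, add_zero] at h1
  refine h1.congr fun i => ?_
  rw [div_pow, Real.sq_sqrt (by positivity)]
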